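/- Let $d\in\{2,3\}$, let $\Omega\subset\mathbb R^d$ be a bounded domain with Lipschitz boundary $\Gamma=\partial\Omega$ and outer unit normal $n$, and let $\eta,\gamma_b,\gamma_u,\gamma_p,\gamma_\sigma>0$. Let $f\in[L^2(\Omega)]^d$ and $g\in[L^2(\Gamma)]^d$ with $\int_\Gamma n\cdot g\,ds=0$. Write $\epsilon(u)=\frac12(\nabla u+\nabla u^\top)$; let $(\cdot,\cdot)_\Omega$ and $\langle\cdot,\cdot\rangle_\Gamma$ be the $L^2$ inner products on $\Omega$ and $\Gamma$, where boundary values of $H^1(\Omega)$ functions are traces. Let $U=(\sigma,u,p)$ be a weak solution of the three field Stokes problem: $\sigma\in[L^2(\Omega)]^{d\times d}$, $u\in[H^1(\Omega)]^d$ with trace $u|_\Gamma=g$, $p\in L^2(\Omega)$ with $\int_\Omega p=0$, and $$\tfrac1{2\eta}(\sigma,\tau)_\Omega-(\epsilon(u),\tau)_\Omega=0,\qquad (\sigma,\epsilon(v))_\Omega-(p,\nabla\cdot v)_\Omega=(f,v)_\Omega,\qquad (\nabla\cdot u,q)_\Omega=0$$ for all $\tau\in[L^2(\Omega)]^{d\times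 d}$, all $v\in[H^1_0(\Omega)]^d$ and all $q\in L^2(\Omega)$ with $\int_\Omega q=0$. Let $\mathcal T_h$ be a finite conforming simplicial mesh, not necessarily fitted to $\Gamma$, whose elements all meet $\Omega$ and whose union $\Omega^*$ contains $\Omega$. Let $h$ be the maximal element diameter, $\mathcal F_i$ the set of interior faces (those shared by two elements $T_F^+,T_F^-$), $\mathcal F_\Gamma\subset\mathcal F_i$ the set of those $F$ for which $T_F^+$ or $T_F^-$ meets $\Gamma$, and $n_F$ a unit normal of $F$ (arbitrary orientation). Put $[\![\nabla x]\!]_n=\nabla x|_{T_F^+}n_F-\nabla x|_{T_F^-}n_F$. Let $\mathcal V_h$ be the space of continuous functions on $\Omega^*$ that are affine on each element, and $\mathbb V_h=\mathcal V_h^{d\times d}\times\mathcal V_h^d\times\mathcal V_h$. Define $$a_h(\sigma,v)=(\sigma,\epsilon(v))_\Omega-\langle\sigma\cdot n,v\rangle_\Gamma,\qquad b_h(p,v)=-(p,\nabla\cdot v)_\Omega+\langle pn,v\rangle_\Gamma,$$ and, for $U=(\sigma,u,p)$ and $V=(\tau,v,q)$, $$A_h(U,V)=\tfrac1{2\eta}(\sigma,\tau)_\Omega+\tfrac{\gamma_b\eta}{h}\langle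 u,v\rangle_\Gamma+a_h(\sigma,v)-a_h(\tau,u)+b_h(p,v)-b_h(q,u),$$ $$L_h(V)=(f,v)_\Omega+\langle\tau\cdot n,g\rangle_\Gamma-\langle qn,g\rangle_\Gamma+\tfrac{\gamma_b\eta}{h}\langle g,v\rangle_\Gamma,$$ $$S_h(U,V)=\tfrac{\gamma_\sigma}{2\eta}\sum_{F\in\mathcal F_\Gamma}h^3([\![\nabla\sigma]\!]_n,[\![\nabla\tau]\!]_n)_F+2\eta\gamma_u\sum_{F\in\mathcal F_i}h([\![\nabla u]\!]_n,[\![\nabla v]\!]_n)_F+\tfrac{\gamma_p}{2\eta}\sum_{F\in\mathcal F_i}h^3([\![\nabla p]\!]_n,[\![\nabla q]\!]_n)_F,$$ where each $(\cdot,\cdot)_F$ is the $L^2$ inner product over the entire face $F$. Let $U_h\in\mathbb V_h$ satisfy $A_h(U_h,V_h)+S_h(U_h,V_h)=L_h(V_h)$ for all $V_h\in\mathbb V_h$. If $U\in[H^1(\Omega)]^{d\times d}\times[H^2(\Omega)]^d\times H^1(\Omega)$, then for all $V_h\in\mathbb V_h$ $$A_h(U,V_h)=L_h(V_h)\qquad\text{and}\qquad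 A_h(U-U_h,V_h)=S_h(U_h,V_h).$$ -/

import Mathlib

open MeasureTheory Filter Topology
open scoped ContDiff NNReal ENNReal

noncomputable section

namespace ThreeFieldStokes

/-- Euclidean space `ℝ^d`. -/
abbrev E (d : ℕ) : Type := EuclideanSpace ℝ (Fin d)

/-- The `j`-th standard basis vector. -/
def basisVec {d : ℕ} (j : Fin d) : E d := EuclideanSpace.single j (1 : ℝ)

/-- The classical partial derivative `∂_j φ`. -/
def classicalPartial {d : ℕ} (j : Fin d) (φ : E d → ℝ) (x : E d) : ℝ :=
  fderiv ℝ φ x (basisVec j)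

/-! ### Lipschitz domains, surface measure, outer normal -/

/-- Near each of its boundary points `Ω` is, in the direction of some unit vector `ν`, the strict
epigraph of a Lipschitz function of the variables orthogonal to `ν`. -/
def HasLipschitzBoundary {d : ℕ} (Ω : Set (E d)) : Prop :=
  ∀ x₀ ∈ frontier Ω, ∃ (ν : E d) (ψ : E d → ℝ) (K : ℝ≥0) (r : ℝ),
    ‖ν‖ = 1 ∧ LipschitzWith K ψ ∧ (∀ (y : E d) (t : ℝ), ψ (y + t • ν) = ψ y) ∧ 0 < r ∧
      ∀ y ∈ Metric.ball x₀ r, (y ∈ Ω ↔ ψ y < inner ℝ y ν)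

/-- A bounded domain (open, connected, nonempty) with Lipschitz boundary. -/
structure IsBoundedLipschitzDomain {d : ℕ} (Ω : Set (E d)) : Prop where
  isOpen : IsOpen Ω
  isConnected : IsConnected Ω
  isBounded : Bornology.IsBounded Ω
  lipschitz : HasLipschitzBoundary Ω

/-- The surface measure on `∂Ω`: the `(d-1)`-dimensional Hausdorff measure, normalized as
`(d-1)`-dimensional area. -/
def surfaceMeasure {d : ℕ} (Ω : Set (E d)) : Measure (E d) :=
  (μHE[d - 1] : Measure (E d)).restrict (frontier Ω)

/-- `ν` is the outer unit normal of `Ω` at `x`: the boundary of `Ω` has at `x` the tangent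
hyperplane orthogonal to `ν`, with `Ω` on the side of `-ν`. -/
def IsOuterNormal {d : ℕ} (Ω : Set (E d)) (x ν : E d) : Prop :=
  ‖ν‖ = 1 ∧ ∀ ε > 0, ∃ r > 0, ∀ y ∈ Metric.ball x r,
    (ε * ‖y - x‖ < inner ℝ (y - x) ν → y ∉ Ω) ∧
    (inner ℝ (y - x) ν < -(ε * ‖y - x‖) → y ∈ Ω)

open Classical in
/-- The outer unit normal field; it is unique where it exists, and for a Lipschitz domain it
exists at almost every boundary point. -/
def outerNormal {d : ℕ} (Ω : Set (E d)) (x : E d) : E d :=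
  if h : ∃ ν, IsOuterNormal Ω x ν then h.choose else 0

/-! ### Sobolev spaces and traces -/

/-- `w ∈ L²(Ω)`. -/
def MemL2 {d : ℕ} (Ω : Set (E d)) (w : E d → ℝ) : Prop :=
  MemLp w 2 (volume.restrict Ω)

/-- `w ∈ L²₀(Ω)`: square integrable with zero average. -/
def MemL20 {d : ℕ} (Ω : Set (E d)) (w : E d → ℝ) : Prop :=
  MemL2 Ω w ∧ ∫ x in Ω, w x = 0

/-- `g ∈ L²(Ω)` is the weak partial derivative `∂_j w` on `Ω`. -/
def IsWeakPartial {d : ℕ} (Ω : Set (E d)) (j : Fin d) (w g : E d → ℝ) : Prop :=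
  MemL2 Ω g ∧ ∀ φ : E d → ℝ, ContDiff ℝ ∞ φ → HasCompactSupport φ → tsupport φ ⊆ Ω →
    ∫ x in Ω, w x * classicalPartial j φ x = -∫ x in Ω, g x * φ x

/-- `w ∈ H¹(Ω)`. -/
def MemH1 {d : ℕ} (Ω : Set (E d)) (w : E d → ℝ) : Prop :=
  MemL2 Ω w ∧ ∀ j, ∃ g, IsWeakPartial Ω j w g

open Classical in
/-- The (almost everywhere unique) weak partial derivative `∂_j w` on `Ω`. -/
def weakPartial {d : ℕ} (Ω : Set (E d)) (j : Fin d) (w : E d → ℝ) : E d → ℝ :=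
  if h : ∃ g, IsWeakPartial Ω j w g then h.choose else 0

/-- `w ∈ H²(Ω)`. -/
def MemH2 {d : ℕ} (Ω : Set (E d)) (w : E d → ℝ) : Prop :=
  MemH1 Ω w ∧ ∀ j, MemH1 Ω (weakPartial Ω j w)

/-- `g ∈ L²(∂Ω)` is the boundary trace of `w ∈ H¹(Ω)`: some functions that are smooth up to the
boundary converge to `w` in `H¹(Ω)` while their boundary values converge to `g` in `L²(∂Ω)`. -/
def IsTrace {d : ℕ} (Ω : Set (E d)) (w g : E d → ℝ) : Prop :=
  MemH1 Ω w ∧ MemLp g 2 (surfaceMeasure Ω) ∧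
  ∃ φ : ℕ → E d → ℝ, (∀ k, ContDiff ℝ ∞ (φ k)) ∧
    Tendsto (fun k => eLpNorm (φ k - w) 2 (volume.restrict Ω)) atTop (𝓝 0) ∧
    (∀ j, Tendsto (fun k => eLpNorm (classicalPartial j (φ k) - weakPartial Ω j w) 2
      (volume.restrict Ω)) atTop (𝓝 0)) ∧
    Tendsto (fun k => eLpNorm (φ k - g) 2 (surfaceMeasure Ω)) atTop (𝓝 0)

open Classical in
/-- The trace operator `H¹(Ω) → L²(∂Ω)`. -/
def trace {d : ℕ} (Ω : Set (E d)) (w : E d → ℝ) : E d → ℝ :=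
  if h : ∃ g, IsTrace Ω w g then h.choose else 0

/-! ### Fields and the continuous problem -/

/-- Triples (extra-stress, velocity, pressure). -/
structure Fields (d : ℕ) where
  σ : E d → Matrix (Fin d) (Fin d) ℝ
  u : E d → E d
  p : E d → ℝ

/-- Difference of triples of fields. -/
instance {d : ℕ} : Sub (Fields d) :=
  ⟨fun U V => ⟨fun x => U.σ x - V.σ x, fun x => U.u x - V.u x, fun x => U.p x - V.p x⟩⟩

/-- The rate of deformation `ε(u)_{ij} = (∂_j u_i + ∂_i u_j) / 2`. -/
def strain {d : ℕ} (Ω : Set (E d)) (u : E d → E d) (x : E d) : Matrix (Fin d) (Fin d) ℝ :=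
  fun i j => (weakPartial Ω j (fun y => u y i) x + weakPartial Ω i (fun y => u y j) x) / 2

/-- The divergence `∇ · u`. -/
def divergence {d : ℕ} (Ω : Set (E d)) (u : E d → E d) (x : E d) : ℝ :=
  ∑ i, weakPartial Ω i (fun y => u y i) x

/-- The inner product `(σ, τ)_Ω` of tensor fields. -/
def tensorInner {d : ℕ} (Ω : Set (E d)) (σ τ : E d → Matrix (Fin d) (Fin d) ℝ) : ℝ :=
  ∫ x in Ω, ∑ i, ∑ j, σ x i j * τ x i j

/-- The inner product `(f, v)_Ω` of vector fields. -/
def vectorInner {d : ℕ} (Ω : Set (E d)) (f v : E d → E d) : ℝ :=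
  ∫ x in Ω, ∑ i, f x i * v x i

/-- The inner product `(p, q)_Ω` of scalar fields. -/
def scalarInner {d : ℕ} (Ω : Set (E d)) (p q : E d → ℝ) : ℝ :=
  ∫ x in Ω, p x * q x

/-- `(σ, u, p)` is a weak solution, with `u ∈ [H¹_g(Ω)]^d` and `p ∈ L²₀(Ω)`, of the three field
Stokes problem with viscosity `η`, body force `f` and boundary value `g`. -/
structure IsWeakSolution {d : ℕ} (Ω : Set (E d)) (η : ℝ) (f g : E d → E d) (U : Fields d) :
    Prop where
  stress_mem : ∀ i j, MemL2 Ω (fun x => U.σ x i j)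
  velocity_trace : ∀ i, IsTrace Ω (fun x => U.u x i) (fun x => g x i)
  pressure_mem : MemL20 Ω U.p
  constitutive : ∀ τ : E d → Matrix (Fin d) (Fin d) ℝ, (∀ i j, MemL2 Ω (fun x => τ x i j)) →
    1 / (2 * η) * tensorInner Ω U.σ τ - tensorInner Ω (strain Ω U.u) τ = 0
  momentum : ∀ v : E d → E d, (∀ i, IsTrace Ω (fun x => v x i) 0) →
    tensorInner Ω U.σ (strain Ω v) - scalarInner Ω U.p (divergence Ω v) = vectorInner Ω f v
  incompressible : ∀ q : E d → ℝ, MemL20 Ω q → scalarInner Ω (divergence Ω U.u) q = 0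

/-! ### Meshes and finite element spaces -/

/-- A conforming simplicial mesh; an element is given by the finite set of its `d + 1` vertices. -/
structure Mesh (d : ℕ) where
  elems : Finset (Finset (E d))
  card_eq : ∀ T ∈ elems, T.card = d + 1
  indep : ∀ T ∈ elems, AffineIndependent ℝ ((↑) : T → E d)
  conforming : ∀ T ∈ elems, ∀ T' ∈ elems,
    convexHull ℝ (T : Set (E d)) ∩ convexHull ℝ (T' : Set (E d)) =
      convexHull ℝ ((T : Set (E d)) ∩ (T' : Set (E d)))

/-- The closed simplex with the given vertices. -/
def hull {d : ℕ} (T : Finset (E d)) : Set (E d) := convexHull ℝ (T : Set (E d))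

namespace Mesh

variable {d : ℕ} (𝒯 : Mesh d)

/-- The fictitious domain `Ω*`, the union of all elements. -/
def fictitiousDomain : Set (E d) := ⋃ T ∈ 𝒯.elems, hull T

/-- The mesh covers `Ω` and each element meets `Ω`. It need not be fitted to `∂Ω`. -/
def Covers (Ω : Set (E d)) : Prop :=
  Ω ⊆ 𝒯.fictitiousDomain ∧ ∀ T ∈ 𝒯.elems, (hull T ∩ Ω).Nonempty

/-- The mesh size `h`, the largest element diameter. -/
def meshSize : ℝ := ⨆ T : 𝒯.elems, Metric.diam (hull T.1)

open Classical in
/-- The interior faces `𝓕_i`: the faces shared by two elements. -/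
def interiorFaces : Finset (Finset (E d)) :=
  (𝒯.elems.biUnion (fun T => T.powersetCard d)).filter
    (fun F => ∃ T ∈ 𝒯.elems, ∃ T' ∈ 𝒯.elems, T ≠ T' ∧ F ⊆ T ∧ F ⊆ T')

/-- A numbering `T_F^+, T_F^-` of the two elements at each interior face together with a unit
normal `n_F`, all of them fixed but arbitrary. -/
structure Orientation where
  plus : Finset (E d) → Finset (E d)
  minus : Finset (E d) → Finset (E d)
  normal : Finset (E d) → E d
  plus_mem : ∀ F ∈ 𝒯.interiorFaces, plus F ∈ 𝒯.elems ∧ F ⊆ plus F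
  minus_mem : ∀ F ∈ 𝒯.interiorFaces, minus F ∈ 𝒯.elems ∧ F ⊆ minus F
  plus_ne_minus : ∀ F ∈ 𝒯.interiorFaces, plus F ≠ minus F
  norm_normal : ∀ F ∈ 𝒯.interiorFaces, ‖normal F‖ = 1
  normal_orthogonal : ∀ F ∈ 𝒯.interiorFaces, ∀ a ∈ F, ∀ b ∈ F, inner ℝ (a - b) (normal F) = 0

open Classical in
/-- The interior faces `𝓕_Γ` of elements that are intersected by `Γ = ∂Ω`. -/
def cutFaces (o : 𝒯.Orientation) (Ω : Set (E d)) : Finset (Finset (E d)) :=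
  𝒯.interiorFaces.filter (fun F =>
    (hull (o.plus F) ∩ frontier Ω).Nonempty ∨ (hull (o.minus F) ∩ frontier Ω).Nonempty)

/-- The space `𝒱_h` of continuous functions on `Ω*` that are affine on each element (their values
outside of `Ω*` are irrelevant). -/
def MemV (v : E d → ℝ) : Prop :=
  ContinuousOn v 𝒯.fictitiousDomain ∧
    ∀ T ∈ 𝒯.elems, ∃ L : E d →ᵃ[ℝ] ℝ, Set.EqOn v L (hull T)

/-- The mixed space `𝕍_h = 𝒱_h^{d×d} × 𝒱_h^d × 𝒱_h`. -/
def MemVV (V : Fields d) : Prop :=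
  (∀ i j, 𝒯.MemV (fun x => V.σ x i j)) ∧ (∀ i, 𝒯.MemV (fun x => V.u x i)) ∧ 𝒯.MemV V.p

variable {𝒯}

/-- The normal jump `⟦∇w⟧_n = ∇w|_{T_F^+} n_F - ∇w|_{T_F^-} n_F` over the face `F`. -/
def Orientation.normalJump (o : 𝒯.Orientation) (F : Finset (E d)) (w : E d → ℝ) (x : E d) : ℝ :=
  fderivWithin ℝ w (hull (o.plus F)) x (o.normal F) -
    fderivWithin ℝ w (hull (o.minus F)) x (o.normal F)

/-- `∑_{F ∈ 𝓕} h^k (⟦∇w⟧_n, ⟦∇y⟧_n)_F`, where each integral is over the entire face. -/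
def Orientation.jumpForm (o : 𝒯.Orientation) (𝓕 : Finset (Finset (E d))) (k : ℕ)
    (w y : E d → ℝ) : ℝ :=
  ∑ F ∈ 𝓕, 𝒯.meshSize ^ k *
    ∫ x in hull F, o.normalJump F w x * o.normalJump F y x ∂(μHE[d - 1] : Measure (E d))

end Mesh

/-! ### The stabilized cut finite element method -/

/-- The viscosity `η` and the penalty parameters `γ_b, γ_u, γ_p, γ_σ`. -/
structure Params where
  η : ℝ
  γb : ℝ
  γu : ℝ
  γp : ℝ
  γσ : ℝ

/-- All parameters are positive. -/
structure Params.Pos (P : Params) : Prop where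
  η : 0 < P.η
  γb : 0 < P.γb
  γu : 0 < P.γu
  γp : 0 < P.γp
  γσ : 0 < P.γσ

variable {d : ℕ}

/-- The boundary pairing `⟨σ · n, v⟩_{∂Ω}`, where `v` is already given on `∂Ω`. -/
def stressFlux (Ω : Set (E d)) (σ : E d → Matrix (Fin d) (Fin d) ℝ) (v : E d → E d) : ℝ :=
  ∫ x, ∑ i, ∑ j, trace Ω (fun y => σ y i j) x * outerNormal Ω x j * v x i ∂(surfaceMeasure Ω)

/-- The boundary pairing `⟨p n, v⟩_{∂Ω}`, where `v` is already given on `∂Ω`. -/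
def pressureFlux (Ω : Set (E d)) (p : E d → ℝ) (v : E d → E d) : ℝ :=
  ∫ x, ∑ i, trace Ω p x * outerNormal Ω x i * v x i ∂(surfaceMeasure Ω)

/-- The boundary pairing `⟨u, v⟩_{∂Ω}` of vector fields given on `∂Ω`. -/
def boundaryInner (Ω : Set (E d)) (u v : E d → E d) : ℝ :=
  ∫ x, ∑ i, u x i * v x i ∂(surfaceMeasure Ω)

/-- The componentwise trace of a vector field. -/
def vectorTrace (Ω : Set (E d)) (v : E d → E d) (x : E d) : E d :=
  WithLp.toLp 2 (fun i => trace Ω (fun y => v y i) x)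

/-- `a_h(σ, v) = (σ, ε(v))_Ω - ⟨σ · n, v⟩_{∂Ω}`. -/
def aForm (Ω : Set (E d)) (σ : E d → Matrix (Fin d) (Fin d) ℝ) (v : E d → E d) : ℝ :=
  tensorInner Ω σ (strain Ω v) - stressFlux Ω σ (vectorTrace Ω v)

/-- `b_h(p, v) = -(p, ∇ · v)_Ω + ⟨p n, v⟩_{∂Ω}`. -/
def bForm (Ω : Set (E d)) (p : E d → ℝ) (v : E d → E d) : ℝ :=
  -scalarInner Ω p (divergence Ω v) + pressureFlux Ω p (vectorTrace Ω v)

/-- The bilinear form `A_h(U, V)`. -/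
def AForm (Ω : Set (E d)) (P : Params) (h : ℝ) (U V : Fields d) : ℝ :=
  1 / (2 * P.η) * tensorInner Ω U.σ V.σ
    + P.γb * P.η / h * boundaryInner Ω (vectorTrace Ω U.u) (vectorTrace Ω V.u)
    + aForm Ω U.σ V.u - aForm Ω V.σ U.u
    + bForm Ω U.p V.u - bForm Ω V.p U.u

/-- The linear form `L_h(V)`. -/
def LForm (Ω : Set (E d)) (P : Params) (h : ℝ) (f g : E d → E d) (V : Fields d) : ℝ :=
  vectorInner Ω f V.u + stressFlux Ω V.σ g - pressureFlux Ω V.p g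
    + P.γb * P.η / h * boundaryInner Ω g (vectorTrace Ω V.u)

/-- The stabilization `S_h(U, V) = s_σ(σ, τ) + s_u(u, v) + s_p(p, q)`. -/
def SForm {𝒯 : Mesh d} (o : 𝒯.Orientation) (Ω : Set (E d)) (P : Params) (U V : Fields d) : ℝ :=
  P.γσ / (2 * P.η) *
      ∑ i, ∑ j, o.jumpForm (𝒯.cutFaces o Ω) 3 (fun x => U.σ x i j) (fun x => V.σ x i j)
    + 2 * P.η * P.γu *
      ∑ i, o.jumpForm 𝒯.interiorFaces 1 (fun x => U.u x i) (fun x => V.u x i)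
    + P.γp / (2 * P.η) * o.jumpForm 𝒯.interiorFaces 3 U.p V.p

/-- `U_h ∈ 𝕍_h` satisfies `A_h(U_h, V_h) + S_h(U_h, V_h) = L_h(V_h)` for all `V_h ∈ 𝕍_h`. -/
def IsDiscreteSolution {𝒯 : Mesh d} (o : 𝒯.Orientation) (Ω : Set (E d)) (P : Params)
    (f g : E d → E d) (Uh : Fields d) : Prop :=
  𝒯.MemVV Uh ∧ ∀ Vh : Fields d, 𝒯.MemVV Vh →
    AForm Ω P 𝒯.meshSize Uh Vh + SForm o Ω P Uh Vh = LForm Ω P 𝒯.meshSize f g Vh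

end ThreeFieldStokes

end

open ThreeFieldStokes

/-! The second identity is the first one minus the discrete equation, once `AForm` is known to be
linear in its first argument. The first identity is obtained term by term. The constitutive equation
tested with `V.σ` removes the pair of tensor products. Since the trace of u is g, the boundary terms
that contain u become those of `LForm`. The term (q, ∇·u) vanishes because (∇·u, q) = 0 for
mean-zero q, and ∫ n·g = 0 extends this to every q. What remains is (σ, ε(v)) - ⟨σn, v⟩ - (p, ∇·v) +
⟨pn, v⟩ = (f, v). Testing the constitutive equation with σ - σᵀ shows that σ is symmetric, so σ :
ε(v) = σ : ∇v. Green's formula then turns the left side into (∇p - ∇·σ, v). Testing the momentum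
equation with smooth functions compactly supported in Ω gives ∇p - ∇·σ = f almost everywhere, so v
need not vanish on Γ.

The analytic work lies in Green's formula `IsTrace.green` and in the trace theory of a Lipschitz
domain. `trace`, `weakPartial` and `outerNormal` are chosen objects with default value 0, so
existence and almost everywhere uniqueness have to be proved before they can be computed with. The
area formula for Lipschitz graphs (`restrict_range_graphMap`) identifies the Hausdorff measure on Γ.
Fubini and the fundamental theorem of calculus in an epigraph, localized by a partition of unity,
give the divergence theorem `integral_fderiv_eq_boundary`. Applied to χφ² in a direction transversal
to Γ, it yields the trace inequality `exists_trace_inequality`. Mollification with kernels shifted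
into Ω gives density of smooth functions (`exists_contDiff_approx`). Density and the trace
inequality give existence and uniqueness of traces, and Green's formula passes to the limit.
Finally, continuous piecewise affine functions lie in H¹(Ω) (`Mesh.MemV.memH1`), so all of this
applies to the discrete fields as well. -/

namespace ThreeFieldStokes

open Module Set

/-! ### Area formula: volume distortion of expanding maps. -/

section AreaFormula

/-- The hypothesis makes p factor through q by a K-Lipschitz map on `q '' s`, and Lipschitz maps
scale Hausdorff measure by at most K ^ n. Neither p nor q has to be injective or Lipschitz, so two
maps can be compared directly with each other. -/
theorem euclideanHausdorffMeasure_image_le_of_dist_le {α X Y : Type*} [EMetricSpace X]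
    [MeasurableSpace X] [BorelSpace X] [EMetricSpace Y] [MeasurableSpace Y] [BorelSpace Y]
    {n : ℕ} {p : α → Y} {q : α → X} {s : Set α} {K : ℝ≥0}
    (h : ∀ x ∈ s, ∀ y ∈ s, edist (p x) (p y) ≤ K * edist (q x) (q y)) :
    (μHE[n] : Measure Y) (p '' s) ≤ (K : ℝ≥0∞) ^ n * (μHE[n] : Measure X) (q '' s) := by
  rcases s.eq_empty_or_nonempty with rfl | ⟨x₀, hx₀⟩
  · simp
  have : Nonempty α := ⟨x₀⟩
  set r : X → α := Function.invFunOn q s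
  have hr : ∀ z ∈ q '' s, r z ∈ s ∧ q (r z) = z := fun z hz =>
    ⟨Function.invFunOn_mem hz, Function.invFunOn_eq hz⟩
  have hlip : LipschitzOnWith K (p ∘ r) (q '' s) := by
    intro a ha b hb
    have := h _ (hr a ha).1 _ (hr b hb).1
    rwa [(hr a ha).2, (hr b hb).2] at this
  have himg : p '' s = (p ∘ r) '' (q '' s) := by
    ext z
    constructor
    · rintro ⟨x, hx, rfl⟩
      refine ⟨q x, mem_image_of_mem _ hx, ?_⟩
      have hqx := hr (q x) (mem_image_of_mem _ hx)
      have := h _ hqx.1 _ hx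
      rw [hqx.2, edist_self, mul_zero] at this
      exact edist_le_zero.1 this
    · rintro ⟨z, hz, rfl⟩
      exact mem_image_of_mem _ (hr z hz).1
  have := hlip.hausdorffMeasure_image_le (d := n) (Nat.cast_nonneg n)
  rw [himg]
  simp only [Measure.euclideanHausdorffMeasure_def, Measure.smul_apply, ENNReal.smul_def,
    smul_eq_mul]
  rw [ENNReal.rpow_natCast] at this
  calc _ ≤ _ := mul_le_mul_right this _
    _ = _ := by ring

variable {W V : Type*} [NormedAddCommGroup W] [InnerProductSpace ℝ W] [FiniteDimensional ℝ W]
  [MeasurableSpace W] [BorelSpace W] [NormedAddCommGroup V] [InnerProductSpace ℝ V]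
  [MeasurableSpace V] [BorelSpace V]

/-- Volume distortion of a map which is approximated by an expanding linear map. -/
theorem ApproximatesLinearOn.euclideanHausdorffMeasure_image {G : W → V} {A : W →L[ℝ] V}
    {s : Set W} {δ : ℝ≥0} (happ : ApproximatesLinearOn G A s δ) (hA : ∀ w, ‖w‖ ≤ ‖A w‖)
    (hG : ∀ x y, dist x y ≤ dist (G x) (G y)) :
    (μHE[finrank ℝ W] : Measure V) (G '' s) ≤
        (1 + δ : ℝ≥0∞) ^ finrank ℝ W * (ENNReal.ofReal A.toLinearMap.normDet * volume s) ∧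
      ENNReal.ofReal A.toLinearMap.normDet * volume s ≤
        (1 + δ : ℝ≥0∞) ^ finrank ℝ W * (μHE[finrank ℝ W] : Measure V) (G '' s) := by
  have hvol := A.toLinearMap.euclideanHausdorffMeasure_image_eq_normDet_mul_volume s
  have e1 : ((1 + δ : ℝ≥0) : ℝ≥0∞) = 1 + δ := by push_cast; rfl
  have key : ∀ x ∈ s, ∀ y ∈ s, ‖G x - G y - A (x - y)‖ ≤ δ * ‖x - y‖ := happ
  rw [← hvol, ← e1]
  -- The error δ‖x - y‖ is absorbed by ‖A x - A y‖ in one direction and by ‖G x - G y‖ in the other.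
  -- As both maps are expanding, each direction costs the same factor 1 + δ.
  constructor
  · refine euclideanHausdorffMeasure_image_le_of_dist_le fun x hx y hy => ?_
    rw [edist_nndist, edist_nndist, ← ENNReal.coe_mul, ENNReal.coe_le_coe, ← NNReal.coe_le_coe]
    push_cast
    rw [dist_eq_norm, dist_eq_norm]
    have h1 := key x hx y hy
    have h2 : ‖x - y‖ ≤ ‖A x - A y‖ := by rw [← map_sub]; exact hA _
    have h3 : ‖G x - G y‖ ≤ ‖G x - G y - A (x - y)‖ + ‖A (x - y)‖ := by
      simpa using norm_add_le (G x - G y - A (x - y)) (A (x - y))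
    rw [map_sub] at *
    have : (δ : ℝ) * ‖x - y‖ ≤ δ * ‖A x - A y‖ := by gcongr
    linarith
  · refine euclideanHausdorffMeasure_image_le_of_dist_le fun x hx y hy => ?_
    rw [edist_nndist, edist_nndist, ← ENNReal.coe_mul, ENNReal.coe_le_coe, ← NNReal.coe_le_coe]
    push_cast
    have h2 := hG x y
    rw [dist_eq_norm, dist_eq_norm] at *
    have h1 := key x hx y hy
    have h3 : ‖A (x - y)‖ ≤ ‖G x - G y - A (x - y)‖ + ‖G x - G y‖ := by
      have := norm_sub_le (G x - G y) (G x - G y - A (x - y))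
      rw [sub_sub_cancel] at this
      linarith
    rw [map_sub] at *
    have : (δ : ℝ) * ‖x - y‖ ≤ δ * ‖G x - G y‖ := by gcongr
    linarith

/-- If the Jacobian of an expanding map lies in `[a, b]`, then so does its volume distortion. -/
theorem euclideanHausdorffMeasure_image_mem_of_normDet_mem [FiniteDimensional ℝ V] {G : W → V}
    {G' : W → W →L[ℝ] V} {s : Set W}
    (hs : MeasurableSet s) (hGc : MeasurableEmbedding G)
    (hG' : ∀ x ∈ s, HasFDerivAt G (G' x) x) (hA : ∀ x ∈ s, ∀ w, ‖w‖ ≤ ‖G' x w‖)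
    (hG : ∀ x y, dist x y ≤ dist (G x) (G y)) {a b : ℝ}
    (ha : ∀ x ∈ s, a ≤ (G' x).toLinearMap.normDet)
    (hb : ∀ x ∈ s, (G' x).toLinearMap.normDet ≤ b) :
    (μHE[finrank ℝ W] : Measure V) (G '' s) ≤ ENNReal.ofReal b * volume s ∧
      ENNReal.ofReal a * volume s ≤ (μHE[finrank ℝ W] : Measure V) (G '' s) := by
  rcases s.eq_empty_or_nonempty with rfl | hne
  · simp
  set n := finrank ℝ W
  -- A countable partition makes G δ-close on each piece to one of its own derivatives, whose
  -- Jacobian lies in [a, b]. The loss (1 + δ) ^ n is uniform over the pieces and disappears as δ →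
  -- 0.
  have main : ∀ δ : ℝ≥0, δ ≠ 0 →
      (μHE[n] : Measure V) (G '' s) ≤ (1 + δ : ℝ≥0∞) ^ n * (ENNReal.ofReal b * volume s) ∧
      ENNReal.ofReal a * volume s ≤ (1 + δ : ℝ≥0∞) ^ n * (μHE[n] : Measure V) (G '' s) := by
    intro δ hδ
    obtain ⟨t, A, tdisj, tmeas, tcov, tapp, tA⟩ :=
      exists_partition_approximatesLinearOn_of_hasFDerivWithinAt G s G'
        (fun x hx => (hG' x hx).hasFDerivWithinAt) (fun _ => δ) (fun _ => hδ)
    have hsU : s = ⋃ k, s ∩ t k := by rw [← inter_iUnion, inter_eq_left.2 tcov]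
    have hdisj : Pairwise (Function.onFun Disjoint fun k => s ∩ t k) := fun i j hij =>
      (tdisj hij).mono inter_subset_right inter_subset_right
    have hm : ∀ k, MeasurableSet (s ∩ t k) := fun k => hs.inter (tmeas k)
    have hvol : volume s = ∑' k, volume (s ∩ t k) := by
      conv_lhs => rw [hsU]
      exact measure_iUnion hdisj hm
    have himg : (μHE[n] : Measure V) (G '' s) = ∑' k, (μHE[n] : Measure V) (G '' (s ∩ t k)) := by
      conv_lhs => rw [hsU, image_iUnion]
      refine measure_iUnion (fun i j hij => ?_) fun k => hGc.measurableSet_image.2 (hm k)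
      exact (disjoint_image_iff hGc.injective).2 (hdisj hij)
    have hk : ∀ k, (∀ w, ‖w‖ ≤ ‖A k w‖) ∧ a ≤ (A k).toLinearMap.normDet ∧
        (A k).toLinearMap.normDet ≤ b := by
      intro k
      obtain ⟨y, hy, hAy⟩ := tA hne k
      rw [hAy]
      exact ⟨hA y hy, ha y hy, hb y hy⟩
    rw [hvol, himg]
    simp only [← ENNReal.tsum_mul_left]
    constructor
    · refine ENNReal.tsum_le_tsum fun k =>
        ((ApproximatesLinearOn.euclideanHausdorffMeasure_image (tapp k) (hk k).1 hG).1).trans ?_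
      gcongr
      exact (hk k).2.2
    · refine ENNReal.tsum_le_tsum fun k => le_trans ?_
        (ApproximatesLinearOn.euclideanHausdorffMeasure_image (tapp k) (hk k).1 hG).2
      gcongr
      exact (hk k).2.1
  have hlim : ∀ c : ℝ≥0∞, Tendsto (fun δ : ℝ≥0 => (1 + δ : ℝ≥0∞) ^ n * c) (𝓝[≠] 0) (𝓝 c) := by
    intro c
    have h1 : Tendsto (fun δ : ℝ≥0 => (1 + δ : ℝ≥0∞) ^ n) (𝓝 0) (𝓝 1) := by
      have : Continuous fun δ : ℝ≥0 => (((1 + δ) ^ n : ℝ≥0) : ℝ≥0∞) := by fun_prop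
      simpa using this.tendsto 0
    simpa using ENNReal.Tendsto.mul_const (h1.mono_left nhdsWithin_le_nhds) (Or.inl one_ne_zero)
  exact ⟨ge_of_tendsto (hlim _) (eventually_mem_nhdsWithin.mono fun δ hδ => (main δ hδ).1),
    ge_of_tendsto (hlim _) (eventually_mem_nhdsWithin.mono fun δ hδ => (main δ hδ).2)⟩

/-- A measure which is comparable to `J • μ` on each set where `J` is almost constant is the
measure with density `J`. -/
theorem eq_withDensity_of_le_mul {α : Type*} [MeasurableSpace α] {μ ν : Measure α} {J : α → ℝ}
    (hJ : Measurable J) (hJ1 : ∀ x, 1 ≤ J x)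
    (h : ∀ s, MeasurableSet s → ∀ a b : ℝ, (∀ x ∈ s, a ≤ J x) → (∀ x ∈ s, J x ≤ b) →
      ν s ≤ ENNReal.ofReal b * μ s ∧ ENNReal.ofReal a * μ s ≤ ν s) :
    ν = μ.withDensity fun x => ENNReal.ofReal (J x) := by
  ext s hs
  rw [withDensity_apply _ hs]
  set m : ℝ≥0∞ := ∫⁻ x in s, ENNReal.ofReal (J x) ∂μ
  have main : ∀ c : ℝ≥0, 1 < c → ν s ≤ c * m ∧ m ≤ c * ν s := by
    intro c hc
    have hc' : (1 : ℝ) < c := by exact_mod_cast hc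
    -- On the layers c ^ k ≤ J < c ^ (k + 1) the density is constant up to the factor c, which tends
    -- to 1 at the end. Since J ≥ 1, natural exponents k suffice.
    set t : ℕ → Set α := fun k => s ∩ J ⁻¹' Ico ((c : ℝ) ^ k) ((c : ℝ) ^ (k + 1))
    have ht : ∀ k, MeasurableSet (t k) := fun k => hs.inter (hJ measurableSet_Ico)
    have hcov : s = ⋃ k, t k := by
      ext x
      simp only [mem_iUnion, t, mem_inter_iff, mem_preimage, mem_Ico]
      refine ⟨fun hx => ?_, fun ⟨k, hk⟩ => hk.1⟩
      obtain ⟨k, hk⟩ := exists_nat_pow_near (hJ1 x) hc'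
      exact ⟨k, hx, hk⟩
    have hdisj : Pairwise (Function.onFun Disjoint t) := by
      intro i j hij
      refine Set.disjoint_left.2 fun x hi hj => hij ?_
      have h1 : (c : ℝ) ^ i < c ^ (j + 1) := hi.2.1.trans_lt hj.2.2
      have h2 : (c : ℝ) ^ j < c ^ (i + 1) := hj.2.1.trans_lt hi.2.2
      rw [pow_lt_pow_iff_right₀ hc'] at h1 h2
      omega
    have hν : ν s = ∑' k, ν (t k) := by
      conv_lhs => rw [hcov]
      exact measure_iUnion hdisj ht
    have hm : m = ∑' k, ∫⁻ x in t k, ENNReal.ofReal (J x) ∂μ := by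
      simp only [m]
      conv_lhs => rw [hcov]
      exact lintegral_iUnion ht hdisj _
    have hpow : ∀ k, ENNReal.ofReal ((c : ℝ) ^ (k + 1)) = c * ENNReal.ofReal ((c : ℝ) ^ k) := by
      intro k
      rw [pow_succ', ENNReal.ofReal_mul c.coe_nonneg, ENNReal.ofReal_coe_nnreal]
    have hlow : ∀ k, ENNReal.ofReal ((c : ℝ) ^ k) * μ (t k) ≤
        ∫⁻ x in t k, ENNReal.ofReal (J x) ∂μ := by
      intro k
      rw [← setLIntegral_const]
      exact setLIntegral_mono' (ht k) fun x hx => ENNReal.ofReal_le_ofReal hx.2.1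
    have hup : ∀ k, ∫⁻ x in t k, ENNReal.ofReal (J x) ∂μ ≤
        ENNReal.ofReal ((c : ℝ) ^ (k + 1)) * μ (t k) := by
      intro k
      rw [← setLIntegral_const]
      exact setLIntegral_mono' (ht k) fun x hx => ENNReal.ofReal_le_ofReal hx.2.2.le
    have hk := fun k => h (t k) (ht k) _ _ (fun x hx => hx.2.1) (fun x hx => hx.2.2.le)
    rw [hν, hm]
    simp only [← ENNReal.tsum_mul_left]
    constructor
    · refine ENNReal.tsum_le_tsum fun k => (hk k).1.trans ?_
      rw [hpow, mul_assoc]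
      gcongr
      exact hlow k
    · refine ENNReal.tsum_le_tsum fun k => (hup k).trans ?_
      rw [hpow, mul_assoc]
      gcongr
      exact (hk k).2
  have hlim : ∀ e : ℝ≥0∞, Tendsto (fun c : ℝ≥0 => (c : ℝ≥0∞) * e) (𝓝[>] 1) (𝓝 e) := by
    intro e
    have h1 : Tendsto (fun c : ℝ≥0 => (c : ℝ≥0∞)) (𝓝 1) (𝓝 ((1 : ℝ≥0) : ℝ≥0∞)) :=
      ENNReal.continuous_coe.tendsto 1
    simpa using ENNReal.Tendsto.mul_const (h1.mono_left nhdsWithin_le_nhds) (Or.inl (by simp))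
  exact le_antisymm
    (ge_of_tendsto (hlim _) (eventually_mem_nhdsWithin.mono fun c hc => (main c hc).1))
    (ge_of_tendsto (hlim _) (eventually_mem_nhdsWithin.mono fun c hc => (main c hc).2))

end AreaFormula

/-! ### Lipschitz graphs over a hyperplane and their area element. -/

section Graph

variable {d : ℕ} {ν : E d}

/-- The hyperplane of the vectors orthogonal to `ν`. -/
noncomputable abbrev hyperplane (ν : E d) : Submodule ℝ (E d) := (ℝ ∙ ν)ᗮ

theorem inner_hyperplane (w : hyperplane ν) : inner ℝ (w : E d) ν = 0 :=
  (Submodule.mem_orthogonal_singleton_iff_inner_left).1 w.2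

theorem finrank_hyperplane (hν : ‖ν‖ = 1) : finrank ℝ (hyperplane ν) = d - 1 := by
  have h0 : ν ≠ 0 := by rintro rfl; simp at hν
  have h1 := (ℝ ∙ ν).finrank_add_finrank_orthogonal
  rw [finrank_span_singleton h0, finrank_euclideanSpace_fin] at h1
  have : finrank ℝ (hyperplane ν) = finrank ℝ ↥(ℝ ∙ ν)ᗮ := rfl
  omega

/-- The orthogonal projection onto the hyperplane orthogonal to `ν`. -/
noncomputable def hyperplaneProj (ν : E d) : E d →L[ℝ] hyperplane ν := (hyperplane ν).orthogonalProjectionOnto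

theorem hyperplaneProj_coe (w : hyperplane ν) : hyperplaneProj ν w = w := by
  simp [hyperplaneProj]

theorem hyperplaneProj_normal : hyperplaneProj ν ν = 0 :=
  Submodule.orthogonalProjectionOnto_orthogonalComplement_singleton_eq_zero ν

theorem coe_hyperplaneProj (hν : ‖ν‖ = 1) (x : E d) :
    (hyperplaneProj ν x : E d) = x - (inner ℝ x ν : ℝ) • ν := by
  have hw : x - (inner ℝ x ν : ℝ) • ν ∈ hyperplane ν := by
    rw [Submodule.mem_orthogonal_singleton_iff_inner_left, inner_sub_left, inner_smul_left]
    simp [hν]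
  have h := hyperplaneProj_coe ⟨_, hw⟩
  rw [map_sub, map_smul, hyperplaneProj_normal, smul_zero, sub_zero] at h
  rw [h]

/-- The parametrization of the graph of `g` in direction `ν`. -/
noncomputable def graphMap (ν : E d) (g : hyperplane ν → ℝ) (w : hyperplane ν) : E d := w + g w • ν

variable {g : hyperplane ν → ℝ} {K : ℝ≥0}

theorem hyperplaneProj_graphMap (w : hyperplane ν) : hyperplaneProj ν (graphMap ν g w) = w := by
  simp [graphMap, hyperplaneProj_coe, hyperplaneProj_normal]

theorem inner_graphMap (hν : ‖ν‖ = 1) (w : hyperplane ν) : inner ℝ (graphMap ν g w) ν = g w := by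
  simp [graphMap, inner_add_left, inner_hyperplane, inner_smul_left, hν]

theorem norm_add_smul_sq (hν : ‖ν‖ = 1) (w : hyperplane ν) (t : ℝ) :
    ‖(w : E d) + t • ν‖ ^ 2 = ‖w‖ ^ 2 + t ^ 2 := by
  rw [norm_add_sq_real, inner_smul_right, inner_hyperplane, norm_smul, hν]
  simp

theorem norm_le_norm_add_smul (hν : ‖ν‖ = 1) (w : hyperplane ν) (t : ℝ) :
    ‖w‖ ≤ ‖(w : E d) + t • ν‖ := by
  have := norm_add_smul_sq hν w t
  nlinarith [norm_nonneg w, norm_nonneg ((w : E d) + t • ν), sq_nonneg t]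

theorem dist_le_dist_graphMap (hν : ‖ν‖ = 1) (w w' : hyperplane ν) :
    dist w w' ≤ dist (graphMap ν g w) (graphMap ν g w') := by
  rw [dist_eq_norm, dist_eq_norm]
  have h : graphMap ν g w - graphMap ν g w' = ((w - w' : hyperplane ν) : E d) + (g w - g w') • ν := by
    rw [graphMap, graphMap, sub_smul, Submodule.coe_sub]
    abel
  rw [h]
  exact norm_le_norm_add_smul hν _ _

theorem continuous_graphMap (hg : Continuous g) : Continuous (graphMap ν g) := by
  unfold graphMap; fun_prop

theorem lipschitzWith_graphMap (hν : ‖ν‖ = 1) (hg : LipschitzWith K g) :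
    LipschitzWith (1 + K) (graphMap ν g) := by
  have h1 : LipschitzWith 1 (fun w : hyperplane ν => (w : E d)) := LipschitzWith.subtype_val _
  have h2 : LipschitzWith K (fun w : hyperplane ν => g w • ν) := by
    refine LipschitzWith.of_dist_le_mul fun x y => ?_
    rw [dist_eq_norm, ← sub_smul, norm_smul, hν, mul_one, ← dist_eq_norm]
    exact hg.dist_le_mul x y
  exact h1.add h2

theorem measurableEmbedding_graphMap (hg : Continuous g) : MeasurableEmbedding (graphMap ν g) := by
  have : Topology.IsClosedEmbedding (graphMap ν g) :=
    Function.LeftInverse.isClosedEmbedding (f := hyperplaneProj ν)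
      (fun w => hyperplaneProj_graphMap w) (hyperplaneProj ν).continuous (continuous_graphMap hg)
  exact this.measurableEmbedding

/-- The area element of the graph of `g`. -/
noncomputable def areaElement (g : hyperplane ν → ℝ) (w : hyperplane ν) : ℝ := √(1 + ‖gradient g w‖ ^ 2)

theorem measurable_gradient : Measurable (gradient g) :=
  (InnerProductSpace.toDual ℝ _).symm.continuous.measurable.comp (measurable_fderiv ℝ g)

theorem measurable_areaElement : Measurable (areaElement g) := by
  unfold areaElement
  exact ((measurable_gradient.norm.pow_const 2).const_add 1).sqrt

theorem one_le_areaElement (w : hyperplane ν) : 1 ≤ areaElement g w := by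
  unfold areaElement
  rw [Real.one_le_sqrt]
  nlinarith [sq_nonneg ‖gradient g w‖]

theorem norm_gradient_le (hg : LipschitzWith K g) (w : hyperplane ν) : ‖gradient g w‖ ≤ K := by
  unfold gradient
  rw [LinearIsometryEquiv.norm_map]
  exact norm_fderiv_le_of_lipschitz ℝ hg

theorem areaElement_le (hg : LipschitzWith K g) (w : hyperplane ν) :
    areaElement g w ≤ √(1 + K ^ 2) := by
  unfold areaElement
  gcongr
  exact norm_gradient_le hg w

/-- The linear map `w ↦ w + ⟨q, w⟩ ν`. -/
noncomputable def tangentMap (ν : E d) (q : hyperplane ν) : hyperplane ν →L[ℝ] E d :=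
  (hyperplane ν).subtypeL + (innerSL ℝ q).smulRight ν

theorem tangentMap_apply (q w : hyperplane ν) :
    tangentMap ν q w = (w : E d) + (inner ℝ q w : ℝ) • ν := rfl

theorem hasFDerivAt_graphMap {w : hyperplane ν} (hg : DifferentiableAt ℝ g w) :
    HasFDerivAt (graphMap ν g) (tangentMap ν (gradient g w)) w := by
  have h := hg.hasGradientAt.hasFDerivAt
  exact ((hyperplane ν).subtypeL.hasFDerivAt).add (h.smul_const ν)

/-- In an orthonormal basis the Gram matrix of the images is 1 + q qᵀ, because ν is a unit vector
orthogonal to the hyperplane. The determinant lemma for a rank one perturbation gives 1 + ‖q‖². -/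
theorem normDet_tangentMap (hν : ‖ν‖ = 1) (q : hyperplane ν) :
    (tangentMap ν q).toLinearMap.normDet = √(1 + ‖q‖ ^ 2) := by
  set b := stdOrthonormalBasis ℝ (hyperplane ν)
  have h := (tangentMap ν q).toLinearMap.normDet_sq_eq_det_gram b
  have hgram : Matrix.gram ℝ (fun i => (tangentMap ν q).toLinearMap (b i)) =
      1 + Matrix.replicateCol Unit (fun i => inner ℝ q (b i)) *
        Matrix.replicateRow Unit (fun i => inner ℝ q (b i)) := by
    ext i j
    have hb : inner ℝ (b i : E d) (b j : E d) = if i = j then (1 : ℝ) else 0 := by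
      have := orthonormal_iff_ite.1 b.orthonormal i j
      simpa using this
    simp only [Matrix.gram_apply, ContinuousLinearMap.coe_coe, tangentMap_apply, inner_add_left,
      inner_add_right, inner_smul_left, inner_smul_right, inner_hyperplane,
      real_inner_comm _ ν, hb, real_inner_self_eq_norm_sq, hν, Matrix.add_apply, Matrix.one_apply,
      Matrix.mul_apply, Matrix.replicateCol_apply, Matrix.replicateRow_apply]
    simp
    exact mul_comm _ _
  rw [hgram, Matrix.det_one_add_replicateCol_mul_replicateRow] at h
  have hsum : (fun i => inner ℝ q (b i)) ⬝ᵥ (fun i => inner ℝ q (b i)) = ‖q‖ ^ 2 := by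
    rw [← b.sum_sq_norm_inner_left q]
    simp [dotProduct, sq]
  rw [hsum] at h
  have h' : (tangentMap ν q).toLinearMap.normDet ^ 2 = 1 + ‖q‖ ^ 2 := h
  rw [← h', Real.sqrt_sq (LinearMap.normDet_nonneg _)]

/-- The area formula for the graph of a Lipschitz function. -/
theorem restrict_range_graphMap (hν : ‖ν‖ = 1) (hg : LipschitzWith K g) :
    (μHE[d - 1] : Measure (E d)).restrict (range (graphMap ν g)) =
      (volume.withDensity fun w => ENNReal.ofReal (areaElement g w)).map (graphMap ν g) := by
  have hemb := measurableEmbedding_graphMap hg.continuous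
  rw [← hemb.map_comap]
  congr 1
  refine eq_withDensity_of_le_mul measurable_areaElement one_le_areaElement ?_
  intro s hs a b ha hb
  rw [hemb.comap_apply, ← finrank_hyperplane hν]
  -- By Rademacher's theorem g is differentiable off a null set. The Lipschitz map `graphMap` sends
  -- that null set to a null set of the graph, so only `s ∩ D` counts on both sides.
  set D : Set (hyperplane ν) := {w | DifferentiableAt ℝ g w}
  have hD : MeasurableSet D := measurableSet_of_differentiableAt ℝ g
  have hnull : volume (s \ D) = 0 :=
    measure_mono_null (sdiff_subset_compl _ _) hg.ae_differentiableAt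
  have himg0 : (μHE[finrank ℝ (hyperplane ν)] : Measure (E d)) (graphMap ν g '' (s \ D)) = 0 := by
    have := euclideanHausdorffMeasure_image_le_of_dist_le (n := finrank ℝ (hyperplane ν))
      (p := graphMap ν g) (q := id) (s := s \ D) (K := 1 + K)
      (fun x _ y _ => lipschitzWith_graphMap hν hg x y)
    rw [image_id, InnerProductSpace.euclideanHausdorffMeasure_eq_volume, hnull, mul_zero] at this
    exact le_antisymm this bot_le
  have hvol : volume s = volume (s ∩ D) := by
    rw [← measure_inter_add_sdiff s hD, hnull, add_zero]
  have himg : (μHE[finrank ℝ (hyperplane ν)] : Measure (E d)) (graphMap ν g '' s) =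
      (μHE[finrank ℝ (hyperplane ν)] : Measure (E d)) (graphMap ν g '' (s ∩ D)) := by
    refine le_antisymm ?_ (measure_mono (image_mono inter_subset_left))
    conv_lhs => rw [← inter_union_sdiff s D, image_union]
    exact (measure_union_le _ _).trans (by rw [himg0, add_zero])
  rw [hvol, himg]
  refine euclideanHausdorffMeasure_image_mem_of_normDet_mem (hs.inter hD) hemb
    (fun x hx => hasFDerivAt_graphMap hx.2) (fun x _ w => ?_) (dist_le_dist_graphMap hν)
    (fun x hx => ?_) (fun x hx => ?_)
  · exact norm_le_norm_add_smul hν _ _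
  · rw [normDet_tangentMap hν]; exact ha x hx.1
  · rw [normDet_tangentMap hν]; exact hb x hx.1

end Graph

/-! ### The divergence theorem in the epigraph of a Lipschitz function. -/

section Epigraph

variable {d : ℕ} {ν : E d} {g : hyperplane ν → ℝ} {K : ℝ≥0}

/-- The strict epigraph of `g` in direction `ν`. -/
def epigraph (ν : E d) (g : hyperplane ν → ℝ) : Set (E d) :=
  {x | g (hyperplaneProj ν x) < inner ℝ x ν}

theorem measurableSet_epigraph (hg : Continuous g) : MeasurableSet (epigraph ν g) :=
  (isOpen_lt (hg.comp (hyperplaneProj ν).continuous) (by fun_prop)).measurableSet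

theorem hyperplaneProj_add_smul (hν : ‖ν‖ = 1) (x : E d) :
    (hyperplaneProj ν x : E d) + (inner ℝ x ν : ℝ) • ν = x := by
  rw [coe_hyperplaneProj hν, sub_add_cancel]

/-- The coordinates `(w, t) ↦ w + t ν` as an isometry. -/
noncomputable def cylinderIsometry (hν : ‖ν‖ = 1) : WithLp 2 (hyperplane ν × ℝ) ≃ₗᵢ[ℝ] E d where
  toFun p := (p.fst : E d) + p.snd • ν
  map_add' p q := by
    simp only [WithLp.add_fst, WithLp.add_snd, Submodule.coe_add, add_smul]
    abel
  map_smul' c p := by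
    simp only [WithLp.smul_fst, WithLp.smul_snd, Submodule.coe_smul, smul_add, smul_smul,
      smul_eq_mul, RingHom.id_apply]
  invFun x := WithLp.toLp 2 (hyperplaneProj ν x, inner ℝ x ν)
  left_inv p := by
    refine WithLp.ofLp_injective 2 (Prod.ext ?_ ?_)
    · simp [hyperplaneProj_coe, hyperplaneProj_normal]
    · simp [inner_add_left, inner_hyperplane, inner_smul_left, hν]
  right_inv x := hyperplaneProj_add_smul hν x
  norm_map' p := by
    have h := norm_add_smul_sq hν p.fst p.snd
    have h2 := WithLp.prod_norm_sq_eq_of_L2 p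
    rw [Real.norm_eq_abs, sq_abs] at h2
    rw [← h2] at h
    exact (sq_eq_sq₀ (norm_nonneg _) (norm_nonneg _)).1 h

/-- The coordinates `(w, s) ↦ w + (g(w) + s) ν`. -/
noncomputable def graphCoord (ν : E d) (g : hyperplane ν → ℝ) (p : hyperplane ν × ℝ) : E d :=
  graphMap ν g p.1 + p.2 • ν

theorem continuous_graphCoord (hg : Continuous g) : Continuous (graphCoord ν g) :=
  ((continuous_graphMap hg).comp continuous_fst).add (continuous_snd.smul continuous_const)

/-- `graphCoord` as a homeomorphism. -/
noncomputable def graphHomeo (hν : ‖ν‖ = 1) (hg : Continuous g) : hyperplane ν × ℝ ≃ₜ E d where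
  toFun := graphCoord ν g
  invFun x := (hyperplaneProj ν x, inner ℝ x ν - g (hyperplaneProj ν x))
  left_inv p := by
    simp [graphCoord, hyperplaneProj_graphMap, hyperplaneProj_normal, inner_add_left,
      inner_graphMap hν, inner_smul_left, hν]
  right_inv x := by
    simp only [graphCoord, graphMap, sub_smul]
    rw [add_assoc, add_sub_cancel, hyperplaneProj_add_smul hν]
  continuous_toFun := continuous_graphCoord hg
  continuous_invFun := by
    have := (hyperplaneProj ν).continuous
    fun_prop

/-- The map is the shear (w, t) ↦ (w, g w + t), which translates each vertical line, followed by the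
isometry `cylinderIsometry`. No differentiability of g is needed. -/
theorem measurePreserving_graphCoord (hν : ‖ν‖ = 1) (hg : Continuous g) :
    MeasurePreserving (graphCoord ν g) := by
  have h1 : MeasurePreserving (fun p : hyperplane ν × ℝ => (p.1, g p.1 + p.2)) := by
    refine MeasurePreserving.skew_product (g := fun w t => g w + t) (MeasurePreserving.id volume)
      (by unfold Function.uncurry; fun_prop) (ae_of_all _ fun w => ?_)
    exact map_add_left_eq_self volume (g w)
  have h2 := (cylinderIsometry hν).measurePreserving.comp
    ((WithLp.volume_preserving_toLp (hyperplane ν) ℝ).comp h1)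
  convert h2 using 1
  ext1 p
  change _ + _ + _ = _ + (g p.1 + p.2) • ν
  rw [add_smul, add_assoc]
  rfl

theorem preimage_graphCoord_epigraph (hν : ‖ν‖ = 1) :
    graphCoord ν g ⁻¹' epigraph ν g = univ ×ˢ Ioi 0 := by
  ext p
  simp [epigraph, graphCoord, hyperplaneProj_graphMap, hyperplaneProj_normal, inner_add_left,
      inner_graphMap hν, inner_smul_left, hν]

theorem setIntegral_epigraph (hν : ‖ν‖ = 1) (hg : Continuous g) (F : E d → ℝ) :
    ∫ x in epigraph ν g, F x =
      ∫ p, F (graphCoord ν g p) ∂((volume : Measure (hyperplane ν)).prod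
        (volume.restrict (Ioi (0 : ℝ)))) := by
  have h := (measurePreserving_graphCoord hν hg).setIntegral_preimage_emb
    (graphHomeo hν hg).measurableEmbedding F (epigraph ν g)
  rw [← h, preimage_graphCoord_epigraph hν, Measure.volume_eq_prod, ← Measure.prod_restrict,
    Measure.restrict_univ]

/-- Integration by parts for Lipschitz functions against the constant 1, whose line derivative is
zero. -/
theorem integral_lineDeriv_eq_zero {X : Type*} [NormedAddCommGroup X] [NormedSpace ℝ X]
    [MeasurableSpace X] [BorelSpace X] [FiniteDimensional ℝ X] {μ : Measure X}
    [μ.IsAddHaarMeasure] {h : X → ℝ} {C : ℝ≥0} (hh : LipschitzWith C h)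
    (hc : HasCompactSupport h) (v : X) : ∫ x, lineDeriv ℝ h x v ∂μ = 0 := by
  have := (LipschitzWith.const (1 : ℝ)).integral_lineDeriv_mul_eq (μ := μ) hh hc (-v)
  simpa [lineDeriv] using this.symm

variable {φ : E d → ℝ}

/-- Along the graph lifted by s, the function w ↦ φ(w + (g w + s)ν) is Lipschitz with compact
support, so its derivative in direction q has integral zero. By Rademacher and the chain rule this
derivative is ∂_q φ + ⟨∇g, q⟩ ∂_ν φ almost everywhere. A tangential derivative is thus traded for
one along ν. -/
theorem integral_fderiv_graphCoord (hν : ‖ν‖ = 1) (hg : LipschitzWith K g) (hφ : ContDiff ℝ 1 φ)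
    (hc : HasCompactSupport φ) (q : hyperplane ν) (s : ℝ) :
    ∫ w, fderiv ℝ φ (graphCoord ν g (w, s)) q =
      ∫ w, -(inner ℝ (gradient g w) q * fderiv ℝ φ (graphCoord ν g (w, s)) ν) := by
  obtain ⟨C, hC⟩ := hφ.lipschitzWith_of_hasCompactSupport hc one_ne_zero
  set e : E d → E d := fun x => x + s • ν
  have he : LipschitzWith 1 e := by
    refine LipschitzWith.of_dist_le_mul fun x y => ?_
    simp [e]
  have hlip := hC.comp (he.comp (lipschitzWith_graphMap hν hg))
  have hsupp : HasCompactSupport (φ ∘ e ∘ graphMap ν g) := by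
    have hemb : Topology.IsClosedEmbedding (e ∘ graphMap ν g) := by
      refine Function.LeftInverse.isClosedEmbedding (f := hyperplaneProj ν) (fun w => ?_)
        (hyperplaneProj ν).continuous
        (he.continuous.comp (continuous_graphMap hg.continuous))
      simp [e, hyperplaneProj_graphMap, hyperplaneProj_normal]
    exact hc.comp_isClosedEmbedding hemb
  have h0 := integral_lineDeriv_eq_zero (μ := volume) hlip hsupp q
  have hae : (fun w => lineDeriv ℝ (φ ∘ e ∘ graphMap ν g) w q) =ᵐ[volume] fun w =>
      fderiv ℝ φ (graphCoord ν g (w, s)) q +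
        inner ℝ (gradient g w) q * fderiv ℝ φ (graphCoord ν g (w, s)) ν := by
    filter_upwards [hg.ae_differentiableAt (μ := volume)] with w hw
    have h1 := hasFDerivAt_graphMap hw
    have h2 : HasFDerivAt (e ∘ graphMap ν g) (tangentMap ν (gradient g w)) w := h1.add_const _
    have h3 : HasFDerivAt φ (fderiv ℝ φ (graphCoord ν g (w, s))) ((e ∘ graphMap ν g) w) :=
      (hφ.differentiable one_ne_zero _).hasFDerivAt
    have h4 := h3.comp w h2
    rw [h4.hasLineDerivAt q |>.lineDeriv]
    simp [tangentMap_apply]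
  rw [integral_congr_ae hae] at h0
  have hcoord : Continuous fun w : hyperplane ν => graphCoord ν g (w, s) :=
    (continuous_graphCoord hg.continuous).comp (by fun_prop)
  have hint : ∀ u, Integrable (fun w => fderiv ℝ φ (graphCoord ν g (w, s)) u) volume := by
    intro u
    refine Continuous.integrable_of_hasCompactSupport
      (((hφ.continuous_fderiv one_ne_zero).comp hcoord).clm_apply continuous_const) ?_
    have hemb : Topology.IsClosedEmbedding fun w : hyperplane ν => graphCoord ν g (w, s) := by
      refine Function.LeftInverse.isClosedEmbedding (f := hyperplaneProj ν) (fun w => ?_)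
        (hyperplaneProj ν).continuous hcoord
      simp [graphCoord, hyperplaneProj_graphMap, hyperplaneProj_normal]
    exact (hc.fderiv_apply ℝ u).comp_isClosedEmbedding hemb
  have hint2 : Integrable (fun w => inner ℝ (gradient g w) q *
      fderiv ℝ φ (graphCoord ν g (w, s)) ν) volume := by
    refine (hint ν).bdd_mul (c := K * ‖q‖)
      (measurable_gradient.inner measurable_const).aestronglyMeasurable (ae_of_all _ fun w => ?_)
    exact (norm_inner_le_norm _ _).trans (by gcongr; exact norm_gradient_le hg w)
  rw [integral_add (hint q) hint2] at h0
  rw [integral_neg]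
  linarith

/-- The divergence theorem in the epigraph of a Lipschitz function. -/
theorem setIntegral_epigraph_fderiv (hν : ‖ν‖ = 1) (hg : LipschitzWith K g) (hφ : ContDiff ℝ 1 φ)
    (hc : HasCompactSupport φ) (v : E d) :
    ∫ x in epigraph ν g, fderiv ℝ φ x v =
      ∫ w, φ (graphMap ν g w) * inner ℝ v (((gradient g w : hyperplane ν) : E d) - ν) := by
  set q := hyperplaneProj ν v
  set c : ℝ := inner ℝ v ν
  have hv : v = q + c • ν := (hyperplaneProj_add_smul hν v).symm
  set H : E d → hyperplane ν × ℝ → ℝ := fun u p => fderiv ℝ φ (graphCoord ν g p) u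
  have hH : ∀ u, Integrable (H u) (volume : Measure (hyperplane ν × ℝ)) := by
    intro u
    refine Continuous.integrable_of_hasCompactSupport
      (((hφ.continuous_fderiv one_ne_zero).comp
        (continuous_graphCoord hg.continuous)).clm_apply continuous_const) ?_
    exact (hc.fderiv_apply ℝ u).comp_homeomorph (graphHomeo hν hg.continuous)
  set m := (volume : Measure (hyperplane ν)).prod (volume.restrict (Ioi (0 : ℝ)))
  have hm : m ≤ (volume : Measure (hyperplane ν × ℝ)) := by
    have : m = (volume : Measure (hyperplane ν × ℝ)).restrict (univ ×ˢ Ioi 0) := by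
      rw [Measure.volume_eq_prod, ← Measure.prod_restrict, Measure.restrict_univ]
    rw [this]
    exact Measure.restrict_le_self
  have hHm : ∀ u, Integrable (H u) m := fun u => (hH u).mono_measure hm
  have hmeas : Measurable fun p : hyperplane ν × ℝ => inner ℝ (gradient g p.1) q :=
    (measurable_gradient.comp measurable_fst).inner measurable_const
  have hgH : Integrable (fun p => inner ℝ (gradient g p.1) q * H ν p) m := by
    refine (hHm ν).bdd_mul (c := K * ‖q‖) hmeas.aestronglyMeasurable (ae_of_all _ fun p => ?_)
    exact (norm_inner_le_norm _ _).trans (by gcongr; exact norm_gradient_le hg _)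
  have hgHn : Integrable (fun p => -(inner ℝ (gradient g p.1) q * H ν p)) m := hgH.neg
  -- Fubini with s as the outer variable: the slice identity removes the part q of v that is
  -- orthogonal to ν.
  have h1 : ∫ p, H q p ∂m = ∫ p, -(inner ℝ (gradient g p.1) q * H ν p) ∂m := by
    rw [integral_prod_symm _ (hHm q), integral_prod_symm _ hgHn]
    exact integral_congr_ae (ae_of_all _ fun s => integral_fderiv_graphCoord hν hg hφ hc q s)
  -- Fubini in the other order: along ν the fundamental theorem of calculus leaves only the value on
  -- the graph.
  have h2 : ∀ w, ∫ s in Ioi (0 : ℝ), H ν (w, s) = -φ (graphMap ν g w) := by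
    intro w
    set f : ℝ → ℝ := fun s => φ (graphMap ν g w + s • ν)
    have hf : ContDiff ℝ 1 f := hφ.comp (by fun_prop)
    have hfc : HasCompactSupport f := by
      have hemb : Topology.IsClosedEmbedding fun s : ℝ => graphMap ν g w + s • ν := by
        refine Function.LeftInverse.isClosedEmbedding
          (f := fun x => inner ℝ x ν - g w) (fun s => ?_) (by fun_prop) (by fun_prop)
        simp [inner_add_left, inner_graphMap hν, inner_smul_left, hν]
      exact hc.comp_isClosedEmbedding hemb
    have hd : ∀ s, deriv f s = H ν (w, s) := by
      intro s
      have e1 : HasDerivAt (fun s : ℝ => graphMap ν g w + s • ν) ν s := by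
        simpa using ((hasDerivAt_id s).smul_const ν).const_add (graphMap ν g w)
      exact ((hφ.differentiable one_ne_zero _).hasFDerivAt.comp_hasDerivAt s e1).deriv
    have := hfc.integral_Ioi_deriv_eq hf 0
    simp only [hd] at this
    rw [this]
    simp [f]
  have h3 : ∫ x in epigraph ν g, fderiv ℝ φ x v =
      ∫ p, (c - inner ℝ (gradient g p.1) q) * H ν p ∂m := by
    rw [setIntegral_epigraph hν hg.continuous]
    have : ∀ p, fderiv ℝ φ (graphCoord ν g p) v = H q p + c * H ν p := by
      intro p
      conv_lhs => rw [hv]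
      simp [H]
    simp only [this]
    rw [integral_add (hHm _) ((hHm ν).const_mul c), h1, ← integral_add hgHn
      ((hHm ν).const_mul c)]
    exact integral_congr_ae (ae_of_all _ fun p => by ring)
  have hint : Integrable (fun p : hyperplane ν × ℝ => (c - inner ℝ (gradient g p.1) q) * H ν p)
      m := by
    refine (((hHm ν).const_mul c).sub hgH).congr (ae_of_all _ fun p => ?_)
    simp only [Pi.sub_apply]
    ring
  rw [h3, integral_prod _ hint]
  refine integral_congr_ae (ae_of_all _ fun w => ?_)
  simp only
  rw [integral_const_mul, h2, inner_sub_right]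
  have : inner ℝ v ((gradient g w : hyperplane ν) : E d) = inner ℝ (gradient g w) q := by
    conv_lhs => rw [hv]
    rw [inner_add_left, inner_smul_left, real_inner_comm _ ν, inner_hyperplane, mul_zero,
      add_zero, ← Submodule.coe_inner, real_inner_comm]
  rw [this]
  ring

end Epigraph

/-! ### Boundary charts: outer normal, surface measure, local divergence theorem. -/

section Chart

variable {d : ℕ} {Ω : Set (E d)}

/-- In the ball `B(x₀, r)` the set `Ω` is the strict epigraph of `g` in direction `ν`. -/
structure IsGraphChart (Ω : Set (E d)) (ν : E d) (g : hyperplane ν → ℝ) (K : ℝ≥0) (x₀ : E d)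
    (r : ℝ) : Prop where
  norm_eq : ‖ν‖ = 1
  lipschitz : LipschitzWith K g
  pos : 0 < r
  mem_iff : ∀ y ∈ Metric.ball x₀ r, (y ∈ Ω ↔ y ∈ epigraph ν g)

theorem HasLipschitzBoundary.exists_isGraphChart (h : HasLipschitzBoundary Ω) {x₀ : E d}
    (hx₀ : x₀ ∈ frontier Ω) :
    ∃ (ν : E d) (g : hyperplane ν → ℝ) (K : ℝ≥0) (r : ℝ), IsGraphChart Ω ν g K x₀ r := by
  obtain ⟨ν, ψ, K, r, hν, hψ, hψν, hr, hmem⟩ := h x₀ hx₀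
  refine ⟨ν, fun w => ψ w, K, r, hν, ?_, hr, fun y hy => ?_⟩
  · have := hψ.comp (LipschitzWith.subtype_val (hyperplane ν : Set (E d)))
    rwa [mul_one] at this
  · rw [hmem y hy]
    have : ψ y = ψ (hyperplaneProj ν y) := by
      conv_lhs => rw [← hyperplaneProj_add_smul hν y]
      exact hψν _ _
    simp [epigraph, this]

/-- If n₁ ≠ n₂, the direction w = n₁ - n₂ satisfies ⟨w, n₁⟩ = ‖w‖²/2 = -⟨w, n₂⟩. For small t > 0 the
point x + t w is then outside Ω according to n₁ and inside according to n₂. The aperture ε = ‖w‖/4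
is half of what these inner products allow. -/
theorem IsOuterNormal.eq {x n₁ n₂ : E d} (h₁ : IsOuterNormal Ω x n₁) (h₂ : IsOuterNormal Ω x n₂) :
    n₁ = n₂ := by
  by_contra hne
  set w := n₁ - n₂
  have hw : 0 < ‖w‖ := norm_pos_iff.2 (sub_ne_zero.2 hne)
  have e1 : inner ℝ w n₁ = ‖w‖ ^ 2 / 2 := by
    have := norm_sub_sq_real n₁ n₂
    rw [h₁.1, h₂.1] at this
    simp only [w, inner_sub_left, real_inner_self_eq_norm_sq, h₁.1, real_inner_comm n₁ n₂]
    rw [this]; ring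
  have e2 : inner ℝ w n₂ = -(‖w‖ ^ 2 / 2) := by
    have := norm_sub_sq_real n₁ n₂
    rw [h₁.1, h₂.1] at this
    simp only [w, inner_sub_left, real_inner_self_eq_norm_sq, h₂.1]
    rw [this]; ring
  obtain ⟨r₁, hr₁, H₁⟩ := h₁.2 (‖w‖ / 4) (by positivity)
  obtain ⟨r₂, hr₂, H₂⟩ := h₂.2 (‖w‖ / 4) (by positivity)
  set t := min r₁ r₂ / (2 * ‖w‖)
  have ht : 0 < t := by positivity
  have htw : t * ‖w‖ = min r₁ r₂ / 2 := by simp only [t]; field_simp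
  have hmin : 0 < min r₁ r₂ := lt_min hr₁ hr₂
  have hball : ∀ r, min r₁ r₂ ≤ r → x + t • w ∈ Metric.ball x r := by
    intro r hr
    rw [Metric.mem_ball, dist_eq_norm, add_sub_cancel_left, norm_smul, Real.norm_eq_abs,
      abs_of_pos ht, htw]
    linarith
  have hn : ‖t • w‖ = t * ‖w‖ := by rw [norm_smul, Real.norm_eq_abs, abs_of_pos ht]
  have hpos : 0 < t * ‖w‖ ^ 2 := by positivity
  have A := (H₁ _ (hball r₁ (min_le_left _ _))).1 (by
    rw [add_sub_cancel_left, hn, inner_smul_left, e1]; simp; nlinarith)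
  have B := (H₂ _ (hball r₂ (min_le_right _ _))).2 (by
    rw [add_sub_cancel_left, hn, inner_smul_left, e2]; simp; nlinarith)
  exact A B

theorem IsOuterNormal.outerNormal_eq {x n : E d} (h : IsOuterNormal Ω x n) :
    outerNormal Ω x = n := by
  have hex : ∃ ν, IsOuterNormal Ω x ν := ⟨n, h⟩
  rw [outerNormal, dif_pos hex]
  exact hex.choose_spec.eq h

/-- `IsOuterNormal` is a cone condition at the single point x, so differentiability of a defining
function at x is enough. A first-order error of at most ε‖N‖‖y - x‖ cannot change the sign of F
outside the cone of aperture ε. -/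
theorem isOuterNormal_of_hasFDerivAt {F : E d → ℝ} {N x : E d} {r : ℝ} (hN : N ≠ 0) (hr : 0 < r)
    (hF : HasFDerivAt F (innerSL ℝ N) x) (hFx : F x = 0)
    (hmem : ∀ y ∈ Metric.ball x r, (y ∈ Ω ↔ F y < 0)) :
    IsOuterNormal Ω x (‖N‖⁻¹ • N) := by
  have hN' : 0 < ‖N‖ := norm_pos_iff.2 hN
  refine ⟨by rw [norm_smul, norm_inv, norm_norm, inv_mul_cancel₀ hN'.ne'], fun ε hε => ?_⟩
  have h := hF.isLittleO.def (c := ε * ‖N‖) (by positivity)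
  obtain ⟨s, hs, hball⟩ := Metric.eventually_nhds_iff_ball.1 h
  refine ⟨min r s, lt_min hr hs, fun y hy => ?_⟩
  have h1 := hball y (Metric.ball_subset_ball (min_le_right _ _) hy)
  have h2 := hmem y (Metric.ball_subset_ball (min_le_left _ _) hy)
  rw [hFx, sub_zero, Real.norm_eq_abs, abs_le, innerSL_apply_apply] at h1
  rw [inner_smul_right, real_inner_comm, h2]
  constructor
  · intro h3
    rw [lt_inv_mul_iff₀ hN'] at h3
    linarith
  · intro h3
    rw [inv_mul_lt_iff₀ hN'] at h3
    linarith

variable {ν : E d} {g : hyperplane ν → ℝ} {K : ℝ≥0} {x₀ : E d} {r : ℝ}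

/-- The candidate for the outer normal on the graph of `g`. -/
noncomputable def graphNormal (ν : E d) (g : hyperplane ν → ℝ) (x : E d) : E d :=
  (areaElement g (hyperplaneProj ν x))⁻¹ •
    (((gradient g (hyperplaneProj ν x) : hyperplane ν) : E d) - ν)

theorem measurable_graphNormal : Measurable (graphNormal ν g) := by
  have h := (hyperplaneProj ν).continuous.measurable
  have h1 : Measurable fun x => ((gradient g (hyperplaneProj ν x) : hyperplane ν) : E d) :=
    measurable_subtype_coe.comp (measurable_gradient.comp h)
  exact (measurable_areaElement.comp h).inv.smul (h1.sub_const ν)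

/-- The factor that normalizes the normal is exactly the area element, so the two cancel in the
surface integral. -/
theorem norm_gradient_sub (hν : ‖ν‖ = 1) (w : hyperplane ν) :
    ‖((gradient g w : hyperplane ν) : E d) - ν‖ = areaElement g w := by
  have h := norm_add_smul_sq hν (gradient g w) (-1)
  rw [neg_one_smul, ← sub_eq_add_neg] at h
  rw [areaElement, ← Real.sqrt_sq (norm_nonneg (((gradient g w : hyperplane ν) : E d) - ν)), h]
  congr 1
  ring

/-- Transversality: together with `areaElement_le` this keeps -⟨n, ν⟩ above a positive constant that
depends only on the Lipschitz constant. The trace inequality rests on this bound. -/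
theorem inner_graphNormal (hν : ‖ν‖ = 1) (x : E d) :
    inner ℝ (graphNormal ν g x) ν = -(areaElement g (hyperplaneProj ν x))⁻¹ := by
  rw [graphNormal, inner_smul_left, inner_sub_left, inner_hyperplane, real_inner_self_eq_norm_sq,
    hν]
  simp

namespace IsGraphChart

/-- A point strictly below the graph has a neighbourhood that misses Ω, and a point strictly above
lies in the open set Ω. A point on the graph is the limit of the points y + t ν of Ω as t decreases
to 0. -/
theorem mem_frontier_iff (h : IsGraphChart Ω ν g K x₀ r) (hΩ : IsOpen Ω) {y : E d}
    (hy : y ∈ Metric.ball x₀ r) :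
    y ∈ frontier Ω ↔ g (hyperplaneProj ν y) = inner ℝ y ν := by
  have hc : Continuous fun y => inner ℝ y ν - g (hyperplaneProj ν y) := by
    have := h.lipschitz.continuous.comp (hyperplaneProj ν).continuous
    have h2 : Continuous fun y : E d => inner ℝ y ν := by fun_prop
    exact h2.sub this
  rw [hΩ.frontier_eq]
  constructor
  · rintro ⟨hcl, hnot⟩
    rw [h.mem_iff y hy, epigraph, mem_ofPred_eq, not_lt] at hnot
    refine le_antisymm ?_ hnot
    by_contra hlt
    rw [not_le] at hlt
    have : {z | inner ℝ z ν - g (hyperplaneProj ν z) < 0} ∩ Metric.ball x₀ r ∈ 𝓝 y := by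
      refine inter_mem ((isOpen_lt hc continuous_const).mem_nhds ?_) (Metric.isOpen_ball.mem_nhds hy)
      simp only [mem_ofPred_eq]; linarith
    obtain ⟨z, hz, hzΩ⟩ := mem_closure_iff_nhds.1 hcl _ this
    have h1 := (h.mem_iff z hz.2).1 hzΩ
    have h2 := hz.1
    simp only [epigraph, mem_ofPred_eq] at h1 h2
    linarith
  · intro heq
    refine ⟨?_, fun hyΩ => ?_⟩
    · rw [mem_closure_iff_nhds]
      intro U hU
      have ht : Tendsto (fun t : ℝ => y + t • ν) (𝓝[>] 0) (𝓝 y) := by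
        have : Continuous fun t : ℝ => y + t • ν := by fun_prop
        simpa using (this.tendsto 0).mono_left nhdsWithin_le_nhds
      have hev : ∀ᶠ t : ℝ in 𝓝[>] 0, y + t • ν ∈ U ∩ Metric.ball x₀ r :=
        ht.eventually (inter_mem hU (Metric.isOpen_ball.mem_nhds hy))
      obtain ⟨t, ⟨htU, htB⟩, ht0⟩ := (hev.and self_mem_nhdsWithin).exists
      refine ⟨y + t • ν, htU, (h.mem_iff _ htB).2 ?_⟩
      have ht0' : 0 < t := ht0
      simp [epigraph, hyperplaneProj_normal, inner_add_left, inner_smul_left, h.norm_eq, heq, ht0']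
    · have := (h.mem_iff y hy).1 hyΩ
      simp only [epigraph, mem_ofPred_eq] at this
      exact absurd heq this.ne

theorem frontier_inter_ball (h : IsGraphChart Ω ν g K x₀ r) (hΩ : IsOpen Ω) :
    frontier Ω ∩ Metric.ball x₀ r = range (graphMap ν g) ∩ Metric.ball x₀ r := by
  ext y
  refine and_congr_left fun hy => ?_
  rw [h.mem_frontier_iff hΩ hy]
  constructor
  · intro heq
    refine ⟨hyperplaneProj ν y, ?_⟩
    rw [graphMap, heq, hyperplaneProj_add_smul h.norm_eq]
  · rintro ⟨w, rfl⟩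
    rw [hyperplaneProj_graphMap, inner_graphMap h.norm_eq]

theorem surfaceMeasure_restrict (h : IsGraphChart Ω ν g K x₀ r) (hΩ : IsOpen Ω) :
    (surfaceMeasure Ω).restrict (Metric.ball x₀ r) =
      ((volume.withDensity fun w => ENNReal.ofReal (areaElement g w)).map (graphMap ν g)).restrict
        (Metric.ball x₀ r) := by
  rw [← restrict_range_graphMap h.norm_eq h.lipschitz, surfaceMeasure,
    Measure.restrict_restrict Metric.isOpen_ball.measurableSet,
    Measure.restrict_restrict Metric.isOpen_ball.measurableSet, inter_comm,
    h.frontier_inter_ball hΩ, inter_comm]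

theorem isOuterNormal (h : IsGraphChart Ω ν g K x₀ r) {w : hyperplane ν}
    (hw : DifferentiableAt ℝ g w) (hwb : graphMap ν g w ∈ Metric.ball x₀ r) :
    IsOuterNormal Ω (graphMap ν g w) (graphNormal ν g (graphMap ν g w)) := by
  have hν := h.norm_eq
  rw [graphNormal, hyperplaneProj_graphMap, ← norm_gradient_sub hν]
  obtain ⟨s, hs, hsub⟩ := Metric.isOpen_iff.1 Metric.isOpen_ball _ hwb
  refine isOuterNormal_of_hasFDerivAt (F := fun x => g (hyperplaneProj ν x) - inner ℝ x ν) ?_ hs ?_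
    ?_ ?_
  · intro h0
    have := norm_gradient_sub (g := g) hν w
    rw [h0, norm_zero] at this
    linarith [one_le_areaElement (g := g) w]
  · have hg : HasFDerivAt g (innerSL ℝ (gradient g w)) (hyperplaneProj ν (graphMap ν g w)) := by
      rw [hyperplaneProj_graphMap]
      exact hw.hasGradientAt.hasFDerivAt
    have h1 := hg.comp _ (hyperplaneProj ν).hasFDerivAt
    have h2 : HasFDerivAt (fun x : E d => inner ℝ x ν) (innerSL ℝ ν) (graphMap ν g w) := by
      simp_rw [real_inner_comm ν]
      exact (innerSL ℝ ν).hasFDerivAt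
    refine (h1.sub h2).congr_fderiv ?_
    ext v
    simp only [sub_apply, ContinuousLinearMap.comp_apply, innerSL_apply_apply,
      inner_sub_left]
    rw [Submodule.coe_inner, coe_hyperplaneProj hν, inner_sub_right, inner_smul_right,
      inner_hyperplane]
    ring
  · simp [hyperplaneProj_graphMap, inner_graphMap hν]
  · intro y hy
    rw [h.mem_iff y (hsub hy), epigraph, mem_ofPred_eq, sub_neg]

/-- The exceptional set of Rademacher's theorem is null in the parameter domain. By the area formula
the surface measure in the ball is the image of a measure absolutely continuous there. -/
theorem ae_isOuterNormal (h : IsGraphChart Ω ν g K x₀ r) (hΩ : IsOpen Ω) :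
    ∀ᵐ x ∂(surfaceMeasure Ω), x ∈ Metric.ball x₀ r → IsOuterNormal Ω x (graphNormal ν g x) := by
  have hemb := measurableEmbedding_graphMap (ν := ν) h.lipschitz.continuous
  rw [← ae_restrict_iff' Metric.isOpen_ball.measurableSet, h.surfaceMeasure_restrict hΩ,
    ae_restrict_iff' Metric.isOpen_ball.measurableSet, hemb.ae_map_iff]
  refine (withDensity_absolutelyContinuous _ _).ae_le ?_
  filter_upwards [h.lipschitz.ae_differentiableAt (μ := volume)] with w hw hb
  exact h.isOuterNormal hw hb

theorem surfaceMeasure_ball_lt_top (h : IsGraphChart Ω ν g K x₀ r) (hΩ : IsOpen Ω) :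
    surfaceMeasure Ω (Metric.ball x₀ r) < ⊤ := by
  have hemb := measurableEmbedding_graphMap (ν := ν) h.lipschitz.continuous
  rw [← Measure.restrict_apply_self, h.surfaceMeasure_restrict hΩ, Measure.restrict_apply_self,
    hemb.map_apply, withDensity_apply _ (hemb.measurable Metric.isOpen_ball.measurableSet)]
  have hsub : graphMap ν g ⁻¹' Metric.ball x₀ r ⊆ hyperplaneProj ν '' Metric.ball x₀ r :=
    fun w hw => ⟨_, hw, hyperplaneProj_graphMap w⟩
  have hfin : volume (graphMap ν g ⁻¹' Metric.ball x₀ r) < ⊤ :=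
    (((hyperplaneProj ν).lipschitz.isBounded_image Metric.isBounded_ball).subset hsub).measure_lt_top
  calc _ ≤ ∫⁻ w in graphMap ν g ⁻¹' Metric.ball x₀ r, ENNReal.ofReal (√(1 + K ^ 2)) :=
        lintegral_mono fun w => ENNReal.ofReal_le_ofReal (areaElement_le h.lipschitz w)
    _ < ⊤ := by
      rw [setLIntegral_const]
      exact ENNReal.mul_lt_top ENNReal.ofReal_lt_top hfin

/-- As φ lives in the ball, Ω may be replaced by the epigraph and Γ by the graph. The area element
of the surface measure cancels the normalization in `graphNormal`. -/
theorem integral_fderiv (h : IsGraphChart Ω ν g K x₀ r) (hΩ : IsOpen Ω) {φ : E d → ℝ}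
    (hφ : ContDiff ℝ 1 φ) (hs : tsupport φ ⊆ Metric.ball x₀ r) (v : E d) :
    ∫ x in Ω, fderiv ℝ φ x v = ∫ x, φ x * inner ℝ v (outerNormal Ω x) ∂(surfaceMeasure Ω) := by
  have hν := h.norm_eq
  have hemb := measurableEmbedding_graphMap (ν := ν) h.lipschitz.continuous
  have hc : HasCompactSupport φ :=
    Metric.isCompact_of_isClosed_isBounded (isClosed_tsupport φ) (Metric.isBounded_ball.subset hs)
  have hz : ∀ x, x ∉ Metric.ball x₀ r → φ x = 0 := fun x hx =>
    image_eq_zero_of_notMem_tsupport fun hx' => hx (hs hx')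
  have hdz : ∀ x, x ∉ Metric.ball x₀ r → fderiv ℝ φ x v = 0 := fun x hx => by
    rw [fderiv_of_notMem_tsupport ℝ fun hx' => hx (hs hx')]; rfl
  have h1 : ∫ x in Ω, fderiv ℝ φ x v = ∫ x in epigraph ν g, fderiv ℝ φ x v := by
    rw [← integral_indicator hΩ.measurableSet,
      ← integral_indicator (measurableSet_epigraph h.lipschitz.continuous)]
    congr 1
    ext x
    by_cases hx : x ∈ Metric.ball x₀ r
    · simp only [indicator]
      congr 1
      exact propext (h.mem_iff x hx)
    · simp only [indicator, hdz x hx, ite_self]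
  have h2 : ∫ x, φ x * inner ℝ v (outerNormal Ω x) ∂(surfaceMeasure Ω) =
      ∫ x, φ x * inner ℝ v (graphNormal ν g x)
        ∂((volume.withDensity fun w => ENNReal.ofReal (areaElement g w)).map (graphMap ν g)) := by
    rw [← setIntegral_eq_integral_of_forall_compl_eq_zero (s := Metric.ball x₀ r)
        (fun x hx => by rw [hz x hx, zero_mul]),
      ← setIntegral_eq_integral_of_forall_compl_eq_zero (s := Metric.ball x₀ r)
        (f := fun x => φ x * inner ℝ v (graphNormal ν g x))
        (fun x hx => by rw [hz x hx, zero_mul]), ← h.surfaceMeasure_restrict hΩ]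
    refine setIntegral_congr_ae Metric.isOpen_ball.measurableSet ?_
    filter_upwards [h.ae_isOuterNormal hΩ] with x hx hb
    rw [(hx hb).outerNormal_eq]
  rw [h1, h2, setIntegral_epigraph_fderiv hν h.lipschitz hφ hc, hemb.integral_map,
    integral_withDensity_eq_integral_toReal_smul measurable_areaElement.ennreal_ofReal
      (ae_of_all _ fun _ => ENNReal.ofReal_lt_top)]
  refine integral_congr_ae (ae_of_all _ fun w => ?_)
  have hJ : 0 < areaElement g w := lt_of_lt_of_le one_pos (one_le_areaElement w)
  simp only [graphNormal, hyperplaneProj_graphMap, inner_smul_right, smul_eq_mul,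
    ENNReal.toReal_ofReal hJ.le]
  field_simp

end IsGraphChart

end Chart

/-! ### Partition of unity, divergence theorem and trace inequality in Lipschitz domains. -/

section Divergence

variable {d : ℕ} {Ω : Set (E d)}

/-- A partition of unity on the closure of `Ω`, subordinate to `Ω` and to finitely many boundary
charts. -/
structure BoundaryPartition (Ω : Set (E d)) where
  ι : Type
  [fintype : Fintype ι]
  ν : ι → E d
  g : ∀ i, hyperplane (ν i) → ℝ
  K : ι → ℝ≥0
  x : ι → E d
  r : ι → ℝ
  χ₀ : E d → ℝ
  χ : ι → E d → ℝ
  chart : ∀ i, IsGraphChart Ω (ν i) (g i) (K i) (x i) (r i)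
  contDiff₀ : ContDiff ℝ ∞ χ₀
  contDiff : ∀ i, ContDiff ℝ ∞ (χ i)
  tsupport₀ : tsupport χ₀ ⊆ Ω
  tsupport : ∀ i, tsupport (χ i) ⊆ Metric.ball (x i) (r i)
  nonneg : ∀ i y, 0 ≤ χ i y
  sum_eq : ∀ y ∈ closure Ω, χ₀ y + ∑ i, χ i y = 1

attribute [instance] BoundaryPartition.fintype

/-- The boundary is compact, so finitely many chart balls cover it, and with Ω itself they cover the
closure. The index `none` stands for Ω, whose function becomes `χ₀`. -/
theorem IsBoundedLipschitzDomain.nonempty_boundaryPartition (hΩ : IsBoundedLipschitzDomain Ω) :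
    Nonempty (BoundaryPartition Ω) := by
  have hcl : IsCompact (closure Ω) := hΩ.isBounded.isCompact_closure
  have hfr : IsCompact (frontier Ω) := hcl.of_isClosed_subset isClosed_frontier frontier_subset_closure
  choose ν g K r hchart using fun x₀ : frontier Ω => hΩ.lipschitz.exists_isGraphChart x₀.2
  obtain ⟨t, ht⟩ := hfr.elim_nhds_subcover' (fun x hx => Metric.ball x (r ⟨x, hx⟩))
    fun x hx => Metric.ball_mem_nhds _ (hchart ⟨x, hx⟩).pos
  let e := t.equivFin
  let p : Fin t.card → frontier Ω := fun i => (e.symm i).1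
  let U : Option (Fin t.card) → Set (E d) := fun i =>
    i.elim Ω fun i => Metric.ball (p i : E d) (r (p i))
  have hU : ∀ i, IsOpen (U i) := by
    rintro (_ | i)
    · exact hΩ.isOpen
    · exact Metric.isOpen_ball
  have hcov : closure Ω ⊆ ⋃ i, U i := by
    intro y hy
    by_cases hyΩ : y ∈ Ω
    · exact mem_iUnion.2 ⟨none, hyΩ⟩
    · have : y ∈ frontier Ω := by rw [hΩ.isOpen.frontier_eq]; exact ⟨hy, hyΩ⟩
      obtain ⟨z, hzt, hyz⟩ := mem_iUnion₂.1 (ht this)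
      refine mem_iUnion.2 ⟨some (e ⟨z, hzt⟩), ?_⟩
      simpa [U, p] using hyz
  obtain ⟨f, hf⟩ := SmoothPartitionOfUnity.exists_isSubordinate (modelWithCornersSelf ℝ (E d))
    isClosed_closure U hU hcov
  refine ⟨{ ι := Fin t.card, ν := fun i => ν (p i), g := fun i => g (p i), K := fun i => K (p i),
            x := fun i => p i, r := fun i => r (p i), χ₀ := f none, χ := fun i => f (some i),
            chart := fun i => hchart (p i), contDiff₀ := (f none).contMDiff.contDiff,
            contDiff := fun i => (f (some i)).contMDiff.contDiff, tsupport₀ := hf none,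
            tsupport := fun i => hf (some i), nonneg := fun i y => f.nonneg _ _,
            sum_eq := fun y hy => ?_ }⟩
  have := f.sum_eq_one hy
  rwa [finsum_eq_sum_of_fintype, Fintype.sum_option] at this

theorem frontier_subset_iUnion_ball (B : BoundaryPartition Ω) (hΩ : IsOpen Ω) :
    frontier Ω ⊆ ⋃ i, Metric.ball (B.x i) (B.r i) := by
  intro y hy
  by_contra hn
  simp only [mem_iUnion, not_exists] at hn
  have h := B.sum_eq y (frontier_subset_closure hy)
  rw [hΩ.frontier_eq] at hy
  rw [image_eq_zero_of_notMem_tsupport fun h' => hy.2 (B.tsupport₀ h'),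
    Finset.sum_eq_zero fun i _ => image_eq_zero_of_notMem_tsupport fun h' => hn i (B.tsupport i h')]
    at h
  norm_num at h

theorem ae_surfaceMeasure_mem_frontier : ∀ᵐ x ∂(surfaceMeasure Ω), x ∈ frontier Ω :=
  ae_restrict_mem isClosed_frontier.measurableSet

theorem isFiniteMeasure_surfaceMeasure (hΩ : IsBoundedLipschitzDomain Ω) :
    IsFiniteMeasure (surfaceMeasure Ω) := by
  obtain ⟨B⟩ := hΩ.nonempty_boundaryPartition
  refine ⟨?_⟩
  calc surfaceMeasure Ω univ ≤ surfaceMeasure Ω (⋃ i, Metric.ball (B.x i) (B.r i)) := by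
        refine measure_mono_ae ?_
        filter_upwards [ae_surfaceMeasure_mem_frontier] with x hx _
        exact frontier_subset_iUnion_ball B hΩ.isOpen hx
    _ ≤ ∑ i, surfaceMeasure Ω (Metric.ball (B.x i) (B.r i)) := measure_iUnion_fintype_le _ _
    _ < ⊤ := ENNReal.sum_lt_top.2 fun i _ => (B.chart i).surfaceMeasure_ball_lt_top hΩ.isOpen

theorem ae_norm_outerNormal (hΩ : IsBoundedLipschitzDomain Ω) :
    ∀ᵐ x ∂(surfaceMeasure Ω), ‖outerNormal Ω x‖ = 1 := by
  obtain ⟨B⟩ := hΩ.nonempty_boundaryPartition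
  filter_upwards [ae_surfaceMeasure_mem_frontier,
    ae_all_iff.2 fun i => (B.chart i).ae_isOuterNormal hΩ.isOpen] with x hx hn
  obtain ⟨i, hi⟩ := mem_iUnion.1 (frontier_subset_iUnion_ball B hΩ.isOpen hx)
  rw [(hn i hi).outerNormal_eq]
  exact (hn i hi).1

theorem aestronglyMeasurable_outerNormal (hΩ : IsBoundedLipschitzDomain Ω) :
    AEStronglyMeasurable (outerNormal Ω) (surfaceMeasure Ω) := by
  obtain ⟨B⟩ := hΩ.nonempty_boundaryPartition
  have h : (surfaceMeasure Ω).restrict (⋃ i, Metric.ball (B.x i) (B.r i)) = surfaceMeasure Ω :=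
    Measure.restrict_eq_self_of_ae_mem
      (ae_surfaceMeasure_mem_frontier.mono fun x hx => frontier_subset_iUnion_ball B hΩ.isOpen hx)
  rw [← h, aestronglyMeasurable_iUnion_iff]
  intro i
  refine (measurable_graphNormal (ν := B.ν i) (g := B.g i)).aestronglyMeasurable.congr ?_
  refine (ae_restrict_iff' Metric.isOpen_ball.measurableSet).2 ?_
  filter_upwards [(B.chart i).ae_isOuterNormal hΩ.isOpen] with x hx hb
  exact (hx hb).outerNormal_eq.symm

theorem Continuous.memLp_of_ae_mem_isCompact {μ : Measure (E d)} [IsFiniteMeasure μ] {k : Set (E d)}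
    (hk : IsCompact k) (hμ : ∀ᵐ x ∂μ, x ∈ k) {f : E d → ℝ} (hf : Continuous f) (p : ℝ≥0∞) :
    MemLp f p μ := by
  obtain ⟨C, hC⟩ := hk.exists_bound_of_continuousOn hf.continuousOn
  exact MemLp.of_bound hf.aestronglyMeasurable C (hμ.mono hC)

theorem IsBoundedLipschitzDomain.isCompact_frontier (hΩ : IsBoundedLipschitzDomain Ω) :
    IsCompact (frontier Ω) :=
  hΩ.isBounded.isCompact_closure.of_isClosed_subset isClosed_frontier frontier_subset_closure

theorem Continuous.memLp_surfaceMeasure (hΩ : IsBoundedLipschitzDomain Ω) {f : E d → ℝ}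
    (hf : Continuous f) (p : ℝ≥0∞) : MemLp f p (surfaceMeasure Ω) :=
  have := isFiniteMeasure_surfaceMeasure hΩ
  Continuous.memLp_of_ae_mem_isCompact hΩ.isCompact_frontier ae_surfaceMeasure_mem_frontier hf p

theorem IsBoundedLipschitzDomain.isFiniteMeasure (hΩ : IsBoundedLipschitzDomain Ω) :
    IsFiniteMeasure (volume.restrict Ω) :=
  ⟨by rw [Measure.restrict_apply_univ]; exact hΩ.isBounded.measure_lt_top⟩

theorem Continuous.memLp_restrict (hΩ : IsBoundedLipschitzDomain Ω) {f : E d → ℝ}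
    (hf : Continuous f) (p : ℝ≥0∞) : MemLp f p (volume.restrict Ω) :=
  have := hΩ.isFiniteMeasure
  Continuous.memLp_of_ae_mem_isCompact hΩ.isBounded.isCompact_closure
    ((ae_restrict_mem hΩ.isOpen.measurableSet).mono fun _ h => subset_closure h) hf p

theorem Integrable.mul_inner_outerNormal (hΩ : IsBoundedLipschitzDomain Ω) {f : E d → ℝ}
    (hf : Integrable f (surfaceMeasure Ω)) (v : E d) :
    Integrable (fun x => f x * inner ℝ v (outerNormal Ω x)) (surfaceMeasure Ω) := by
  refine hf.mul_bdd (c := ‖v‖) ((aestronglyMeasurable_const (b := v)).inner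
    (aestronglyMeasurable_outerNormal hΩ)) ?_
  filter_upwards [ae_norm_outerNormal hΩ] with x hx
  simpa [hx] using norm_inner_le_norm (𝕜 := ℝ) v (outerNormal Ω x)

theorem setIntegral_fderiv_eq_zero {φ : E d → ℝ} (hφ : ContDiff ℝ 1 φ) (hc : HasCompactSupport φ)
    (hs : tsupport φ ⊆ Ω) (v : E d) : ∫ x in Ω, fderiv ℝ φ x v = 0 := by
  obtain ⟨C, hC⟩ := hφ.lipschitzWith_of_hasCompactSupport hc one_ne_zero
  rw [setIntegral_eq_integral_of_forall_compl_eq_zero fun x hx => by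
    rw [fderiv_of_notMem_tsupport ℝ fun hx' => hx (hs hx')]; rfl]
  rw [← integral_lineDeriv_eq_zero (μ := volume) hC hc v]
  refine integral_congr_ae (ae_of_all _ fun x => ?_)
  exact ((hφ.differentiable one_ne_zero x).lineDeriv_eq_fderiv).symm

/-- The divergence theorem in a bounded Lipschitz domain. -/
theorem integral_fderiv_eq_boundary (hΩ : IsBoundedLipschitzDomain Ω) {φ : E d → ℝ}
    (hφ : ContDiff ℝ 1 φ) (v : E d) :
    ∫ x in Ω, fderiv ℝ φ x v = ∫ x, φ x * inner ℝ v (outerNormal Ω x) ∂(surfaceMeasure Ω) := by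
  obtain ⟨B⟩ := hΩ.nonempty_boundaryPartition
  have h0 : ContDiff ℝ 1 (fun x => B.χ₀ x * φ x) :=
    (B.contDiff₀.of_le (by simp)).mul hφ
  have hi : ∀ i, ContDiff ℝ 1 (fun x => B.χ i x * φ x) := fun i =>
    ((B.contDiff i).of_le (by simp)).mul hφ
  have s0 : tsupport (fun x => B.χ₀ x * φ x) ⊆ Ω := (tsupport_mul_subset_left).trans B.tsupport₀
  have si : ∀ i, tsupport (fun x => B.χ i x * φ x) ⊆ Metric.ball (B.x i) (B.r i) := fun i =>
    (tsupport_mul_subset_left).trans (B.tsupport i)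
  have hint : ∀ {ψ : E d → ℝ}, ContDiff ℝ 1 ψ → Integrable (fun x => fderiv ℝ ψ x v)
      (volume.restrict Ω) := fun hψ => memLp_one_iff_integrable.1 (Continuous.memLp_restrict hΩ
        ((hψ.continuous_fderiv one_ne_zero).clm_apply continuous_const) 1)
  have c0 : HasCompactSupport (fun x => B.χ₀ x * φ x) :=
    Metric.isCompact_of_isClosed_isBounded (isClosed_tsupport _) (hΩ.isBounded.subset s0)
  have hsum : ∀ x ∈ Ω, fderiv ℝ φ x v =
      fderiv ℝ (fun x => B.χ₀ x * φ x) x v + ∑ i, fderiv ℝ (fun x => B.χ i x * φ x) x v := by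
    intro x hx
    have heq : φ =ᶠ[𝓝 x] fun y => B.χ₀ y * φ y + ∑ i, B.χ i y * φ y := by
      filter_upwards [hΩ.isOpen.mem_nhds hx] with y hy
      rw [← Finset.sum_mul, ← add_mul, B.sum_eq y (subset_closure hy), one_mul]
    have hd0 := (h0.differentiable one_ne_zero x).hasFDerivAt
    have hdi := HasFDerivAt.fun_sum (u := Finset.univ) fun i (_ : i ∈ Finset.univ) =>
      ((hi i).differentiable one_ne_zero x).hasFDerivAt
    rw [heq.fderiv_eq, (hd0.fun_add hdi).fderiv]
    simp
  rw [setIntegral_congr_fun hΩ.isOpen.measurableSet hsum, integral_add (hint h0)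
    (integrable_finsetSum _ fun i _ => hint (hi i)), integral_finsetSum _ fun i _ => hint (hi i),
    setIntegral_fderiv_eq_zero h0 c0 s0, zero_add]
  -- On Γ the interior function `χ₀` vanishes, since its closed support lies in the open set Ω. The
  -- chart functions alone sum to 1 there.
  have hb : ∀ᵐ x ∂(surfaceMeasure Ω), φ x * inner ℝ v (outerNormal Ω x) =
      ∑ i, (B.χ i x * φ x) * inner ℝ v (outerNormal Ω x) := by
    filter_upwards [ae_surfaceMeasure_mem_frontier] with x hx
    have h := B.sum_eq x (frontier_subset_closure hx)
    rw [hΩ.isOpen.frontier_eq] at hx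
    rw [image_eq_zero_of_notMem_tsupport fun h' => hx.2 (B.tsupport₀ h'), zero_add] at h
    rw [← Finset.sum_mul, ← Finset.sum_mul, h, one_mul]
  rw [integral_congr_ae hb, integral_finsetSum]
  · exact Finset.sum_congr rfl fun i _ => (B.chart i).integral_fderiv hΩ.isOpen (hi i) (si i) v
  · intro i _
    exact Integrable.mul_inner_outerNormal hΩ (memLp_one_iff_integrable.1
      (Continuous.memLp_surfaceMeasure hΩ (hi i).continuous 1)) v

theorem fderiv_apply_eq_sum (φ : E d → ℝ) (x v : E d) :
    fderiv ℝ φ x v = ∑ j, v j * classicalPartial j φ x := by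
  have hv : v = ∑ j, v j • (basisVec j : E d) := by
    ext k
    simp [basisVec, Finset.sum_apply, Pi.single_apply]
  conv_lhs => rw [hv]
  simp [classicalPartial]

theorem fderiv_apply_sq_le (φ : E d → ℝ) (x : E d) {v : E d} (hv : ‖v‖ = 1) :
    (fderiv ℝ φ x v) ^ 2 ≤ ∑ j, classicalPartial j φ x ^ 2 := by
  rw [fderiv_apply_eq_sum]
  refine (Finset.sum_mul_sq_le_sq_mul_sq _ _ _).trans ?_
  have := EuclideanSpace.real_norm_sq_eq v
  rw [← this, hv]
  simp

theorem continuous_classicalPartial {j : Fin d} {φ : E d → ℝ} (hφ : ContDiff ℝ ∞ φ) :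
    Continuous (classicalPartial j φ) :=
  (hφ.continuous_fderiv (by simp)).clm_apply continuous_const

/-- The trace inequality for smooth functions. -/
theorem exists_trace_inequality (hΩ : IsBoundedLipschitzDomain Ω) :
    ∃ C : ℝ, ∀ φ : E d → ℝ, ContDiff ℝ ∞ φ →
      ∫ x, φ x ^ 2 ∂(surfaceMeasure Ω) ≤
        C * ((∫ x in Ω, φ x ^ 2) + ∑ j, ∫ x in Ω, classicalPartial j φ x ^ 2) := by
  obtain ⟨B⟩ := hΩ.nonempty_boundaryPartition
  -- The divergence theorem for χ φ² in the chart direction ν. Since -⟨ν, n⟩ is bounded below on the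
  -- support, the boundary integral of χ φ² is controlled by -∫ ∂_ν(χ φ²), and the product rule with
  -- 2|φ ∂_ν φ| ≤ φ² + (∂_ν φ)² finishes.
  have hloc : ∀ i, ∃ C : ℝ, ∀ φ : E d → ℝ, ContDiff ℝ ∞ φ →
      ∫ x, B.χ i x * φ x ^ 2 ∂(surfaceMeasure Ω) ≤
        C * ((∫ x in Ω, φ x ^ 2) + ∑ j, ∫ x in Ω, classicalPartial j φ x ^ 2) := by
    intro i
    have hχ := B.contDiff i
    have hDχ : Continuous fun x => fderiv ℝ (B.χ i) x (B.ν i) :=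
      (hχ.continuous_fderiv (by simp)).clm_apply continuous_const
    obtain ⟨M₁, hM₁⟩ := hΩ.isBounded.isCompact_closure.exists_bound_of_continuousOn
      hχ.continuous.continuousOn
    obtain ⟨M₂, hM₂⟩ := hΩ.isBounded.isCompact_closure.exists_bound_of_continuousOn
      hDχ.continuousOn
    -- Upper bound of the area element, hence 1 ≤ c · (-⟨ν, n⟩) almost everywhere on the part of Γ
    -- in the ball.
    set c := √(1 + (B.K i : ℝ) ^ 2)
    have hc : 0 < c := by positivity
    set M := |M₁| + |M₂|
    refine ⟨c * M, fun φ hφ => ?_⟩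
    have hψ : ContDiff ℝ 1 fun x => B.χ i x * φ x ^ 2 := (hχ.mul (hφ.pow 2)).of_le (by simp)
    have hs : tsupport (fun x => B.χ i x * φ x ^ 2) ⊆ Metric.ball (B.x i) (B.r i) :=
      (tsupport_mul_subset_left).trans (B.tsupport i)
    have hdiv := (B.chart i).integral_fderiv hΩ.isOpen hψ hs (B.ν i)
    have hνn : ∀ᵐ x ∂(surfaceMeasure Ω), B.χ i x * φ x ^ 2 ≤
        c * -(B.χ i x * φ x ^ 2 * inner ℝ (B.ν i) (outerNormal Ω x)) := by
      filter_upwards [(B.chart i).ae_isOuterNormal hΩ.isOpen] with x hx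
      by_cases hb : x ∈ Metric.ball (B.x i) (B.r i)
      · rw [(hx hb).outerNormal_eq, real_inner_comm, inner_graphNormal (B.chart i).norm_eq]
        have hJ := one_le_areaElement (g := B.g i) (hyperplaneProj (B.ν i) x)
        have hJc := areaElement_le (B.chart i).lipschitz (hyperplaneProj (B.ν i) x)
        have hnn : 0 ≤ B.χ i x * φ x ^ 2 := mul_nonneg (B.nonneg i x) (sq_nonneg _)
        have h1 : 1 ≤ c * (areaElement (B.g i) (hyperplaneProj (B.ν i) x))⁻¹ := by
          rw [← div_eq_mul_inv, one_le_div (by linarith)]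
          exact hJc
        calc _ = B.χ i x * φ x ^ 2 * 1 := by ring
          _ ≤ B.χ i x * φ x ^ 2 * (c * (areaElement (B.g i) (hyperplaneProj (B.ν i) x))⁻¹) := by
            gcongr
          _ = _ := by ring
      · rw [image_eq_zero_of_notMem_tsupport fun h' => hb (B.tsupport i h')]
        simp
    have hint : Integrable (fun x => B.χ i x * φ x ^ 2) (surfaceMeasure Ω) :=
      memLp_one_iff_integrable.1 (Continuous.memLp_surfaceMeasure hΩ hψ.continuous 1)
    have hI : ∀ {f : E d → ℝ}, Continuous f → Integrable f (volume.restrict Ω) := fun hf =>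
      memLp_one_iff_integrable.1 (Continuous.memLp_restrict hΩ hf 1)
    have hpart := fun j => continuous_classicalPartial (j := j) hφ
    calc ∫ x, B.χ i x * φ x ^ 2 ∂(surfaceMeasure Ω)
        ≤ ∫ x, c * -(B.χ i x * φ x ^ 2 * inner ℝ (B.ν i) (outerNormal Ω x))
            ∂(surfaceMeasure Ω) :=
          integral_mono_ae hint
            ((Integrable.mul_inner_outerNormal hΩ hint (B.ν i)).neg.const_mul c) hνn
      _ = c * -∫ x in Ω, fderiv ℝ (fun x => B.χ i x * φ x ^ 2) x (B.ν i) := by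
          rw [integral_const_mul, integral_neg, hdiv]
      _ ≤ c * ∫ x in Ω, M * (φ x ^ 2 + ∑ j, classicalPartial j φ x ^ 2) := by
          refine mul_le_mul_of_nonneg_left ?_ hc.le
          rw [← integral_neg]
          refine setIntegral_mono_on
            (hI ((hψ.continuous_fderiv one_ne_zero).clm_apply continuous_const)).neg
            (hI (by have := hφ.continuous; fun_prop)) hΩ.isOpen.measurableSet fun x hx => ?_
          have hd : fderiv ℝ (fun x => B.χ i x * φ x ^ 2) x (B.ν i) =
              2 * B.χ i x * φ x * fderiv ℝ φ x (B.ν i) + φ x ^ 2 * fderiv ℝ (B.χ i) x (B.ν i) := by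
            have h1 := (hχ.differentiable (by simp) x).hasFDerivAt
            have h2 := (hφ.differentiable (by simp) x).hasFDerivAt
            rw [(h1.fun_mul (h2.pow 2)).fderiv]
            simp
            ring
          have e1 := hM₁ x (subset_closure hx)
          have e2 := hM₂ x (subset_closure hx)
          rw [Real.norm_eq_abs] at e1 e2
          have e1' := e1.trans (le_abs_self M₁)
          have e2' := e2.trans (le_abs_self M₂)
          have e3 := fderiv_apply_sq_le φ x (B.chart i).norm_eq
          rw [hd]
          set a := φ x
          set D := fderiv ℝ φ x (B.ν i)
          set S := ∑ j, classicalPartial j φ x ^ 2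
          have h3 : -(2 * B.χ i x * a * D) ≤ |M₁| * (a ^ 2 + D ^ 2) := by
            calc -(2 * B.χ i x * a * D) ≤ |2 * B.χ i x * a * D| := neg_le_abs _
              _ = |B.χ i x| * (2 * |a| * |D|) := by
                rw [abs_mul, abs_mul, abs_mul, abs_two]; ring
              _ ≤ |M₁| * (a ^ 2 + D ^ 2) := by
                refine mul_le_mul e1' ?_ (by positivity) (abs_nonneg _)
                rw [← sq_abs a, ← sq_abs D]
                exact two_mul_le_add_sq _ _
          have h4 : -(a ^ 2 * fderiv ℝ (B.χ i) x (B.ν i)) ≤ |M₂| * a ^ 2 := by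
            have := neg_le_abs (fderiv ℝ (B.χ i) x (B.ν i))
            nlinarith [sq_nonneg a]
          have h5 : |M₁| * D ^ 2 ≤ |M₁| * S := by gcongr
          have h6 : 0 ≤ |M₂| * S := mul_nonneg (abs_nonneg _) ((sq_nonneg D).trans e3)
          simp only [M]
          linarith
      _ = c * M * ((∫ x in Ω, φ x ^ 2) + ∑ j, ∫ x in Ω, classicalPartial j φ x ^ 2) := by
          have i1 : Integrable (fun x => φ x ^ 2) (volume.restrict Ω) := hI (hφ.continuous.pow 2)
          have i2 : ∀ j, Integrable (fun x => classicalPartial j φ x ^ 2) (volume.restrict Ω) :=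
            fun j => hI ((hpart j).pow 2)
          rw [integral_const_mul, integral_add i1 (integrable_finsetSum _ fun j _ => i2 j),
            integral_finsetSum _ fun j _ => i2 j]
          ring
  choose C hC using hloc
  refine ⟨∑ i, C i, fun φ hφ => ?_⟩
  rw [Finset.sum_mul]
  refine le_trans (le_of_eq ?_) (Finset.sum_le_sum fun i _ => hC i φ hφ)
  rw [← integral_finsetSum]
  · refine integral_congr_ae ?_
    filter_upwards [ae_surfaceMeasure_mem_frontier] with x hx
    have h := B.sum_eq x (frontier_subset_closure hx)
    rw [hΩ.isOpen.frontier_eq] at hx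
    rw [image_eq_zero_of_notMem_tsupport fun h' => hx.2 (B.tsupport₀ h'), zero_add] at h
    rw [← Finset.sum_mul, h, one_mul]
  · intro i _
    exact memLp_one_iff_integrable.1 (Continuous.memLp_surfaceMeasure hΩ
      ((B.contDiff i).continuous.mul (hφ.continuous.pow 2)) 1)

end Divergence

/-! ### Mollification in L². -/

section Convolution

variable {d : ℕ}

open scoped Convolution

/-- Strong continuity of translations, read off from the continuous action of `DomAddAct` on `Lp`
with finite exponent. The element `DomAddAct.mk (-t)` sends w to w(· - t). -/
theorem exists_eLpNorm_translate_sub_le {w : E d → ℝ} (hw : MemLp w 2 volume) {ε : ℝ≥0∞}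
    (hε : 0 < ε) :
    ∃ δ > 0, ∀ t : E d, ‖t‖ < δ → eLpNorm (fun x => w (x - t) - w x) 2 volume ≤ ε := by
  set F : E d → Lp ℝ 2 (volume : Measure (E d)) := fun t => DomAddAct.mk (-t) +ᵥ hw.toLp w
  have : Fact ((2 : ℝ≥0∞) ≠ ⊤) := ⟨by norm_num⟩
  have hF : Continuous F := by
    have h1 : Continuous fun t : E d => DomAddAct.mk (-t) :=
      DomAddAct.continuous_mk.comp continuous_neg
    exact h1.vadd continuous_const
  have h0 : F 0 = hw.toLp w := by simp [F]
  have hev : ∀ᶠ t in 𝓝 (0 : E d), edist (F t) (F 0) < ε :=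
    (hF.tendsto 0).eventually (Metric.eball_mem_nhds _ hε)
  obtain ⟨δ, hδ, hball⟩ := Metric.eventually_nhds_iff_ball.1 hev
  refine ⟨δ, hδ, fun t ht => ?_⟩
  have h1 := (hball t (by simpa using ht)).le
  rw [h0, Lp.edist_def] at h1
  refine le_trans (le_of_eq (eLpNorm_congr_ae ?_)) h1
  have h2 : (F t : E d → ℝ) =ᵐ[volume] fun x => w (x - t) := by
    have e : F t = (hw.comp_measurePreserving (measurePreserving_vadd (-t) volume)).toLp
        (w <| (-t) +ᵥ ·) := DomAddAct.mk_vadd_toLp (-t) hw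
    rw [e]
    filter_upwards [MemLp.coeFn_toLp (hw.comp_measurePreserving
      (measurePreserving_vadd (-t) volume))] with x hx
    refine hx.trans ?_
    simp only [vadd_eq_add, Function.comp]
    congr 1
    abel
  filter_upwards [h2, hw.coeFn_toLp] with x hx1 hx2
  simp only [Pi.sub_apply, hx1, hx2]

/-- Jensen's inequality for the square and the probability density ρ: write ρ f = √ρ · (√ρ f) and
apply Cauchy-Schwarz. -/
theorem sq_lintegral_mul_le {α : Type*} [MeasurableSpace α] {μ : Measure α} {ρ f : α → ℝ≥0∞}
    (hρ : AEMeasurable ρ μ) (hf : AEMeasurable f μ) (h1 : ∫⁻ t, ρ t ∂μ = 1) :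
    (∫⁻ t, ρ t * f t ∂μ) ^ 2 ≤ ∫⁻ t, ρ t * f t ^ 2 ∂μ := by
  have hs : ∀ a : ℝ≥0∞, (a ^ (1 / 2 : ℝ)) ^ 2 = a := fun a => by
    rw [← ENNReal.rpow_natCast, ← ENNReal.rpow_mul]; simp
  have hm : ∀ t, ρ t * f t = ρ t ^ (1 / 2 : ℝ) * (ρ t ^ (1 / 2 : ℝ) * f t) := fun t => by
    rw [← mul_assoc, ← sq, hs]
  have h := ENNReal.lintegral_mul_le_Lp_mul_Lq μ (p := 2) (q := 2)
    (by constructor <;> norm_num) (hρ.pow_const (1 / 2 : ℝ))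
    ((hρ.pow_const (1 / 2 : ℝ)).mul hf)
  simp only [Pi.mul_apply, ← hm] at h
  have e1 : ∀ t, (ρ t ^ (1 / 2 : ℝ)) ^ (2 : ℝ) = ρ t := fun t => by
    rw [← ENNReal.rpow_mul]; simp
  have e2 : ∀ t, (ρ t ^ (1 / 2 : ℝ) * f t) ^ (2 : ℝ) = ρ t * f t ^ 2 := fun t => by
    rw [ENNReal.mul_rpow_of_nonneg _ _ (by norm_num), e1]; norm_num
  simp only [e1, e2, h1, ENNReal.one_rpow, one_mul] at h
  calc _ ≤ ((∫⁻ t, ρ t * f t ^ 2 ∂μ) ^ (1 / 2 : ℝ)) ^ 2 := by gcongr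
    _ = _ := hs _

/-- A smooth mollifier. -/
structure IsKernel (ρ : E d → ℝ) : Prop where
  contDiff : ContDiff ℝ ∞ ρ
  compact : HasCompactSupport ρ
  nonneg : ∀ t, 0 ≤ ρ t
  integral_eq : ∫ t, ρ t = 1

/-- The mollification of `w` by `ρ`. -/
noncomputable def mollify (ρ w : E d → ℝ) : E d → ℝ :=
  ρ ⋆[ContinuousLinearMap.lsmul ℝ ℝ, volume] w

theorem mollify_apply_swap (ρ w : E d → ℝ) (x : E d) :
    mollify ρ w x = ∫ y, ρ (x - y) * w y := by
  rw [mollify, convolution_eq_swap]; rfl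

variable {ρ w : E d → ℝ}

theorem IsKernel.integrable_mul (hρ : IsKernel ρ) (hw : LocallyIntegrable w volume) (x : E d) :
    Integrable (fun t => ρ t * w (x - t)) volume :=
  hρ.compact.convolutionExists_left (ContinuousLinearMap.lsmul ℝ ℝ) hρ.contDiff.continuous hw x

theorem IsKernel.contDiff_mollify (hρ : IsKernel ρ) (hw : LocallyIntegrable w volume) :
    ContDiff ℝ ∞ (mollify ρ w) :=
  hρ.compact.contDiff_convolution_left _ hρ.contDiff hw

theorem IsKernel.classicalPartial_mollify (hρ : IsKernel ρ) (hw : LocallyIntegrable w volume)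
    (j : Fin d) (x : E d) :
    classicalPartial j (mollify ρ w) x = ∫ y, classicalPartial j ρ (x - y) * w y := by
  have h := hρ.compact.hasFDerivAt_convolution_left (ContinuousLinearMap.lsmul ℝ ℝ)
    (hρ.contDiff.of_le (by simp)) hw x
  have hc := (hρ.compact.fderiv ℝ).convolutionExists_left
    ((ContinuousLinearMap.lsmul ℝ ℝ : ℝ →L[ℝ] ℝ →L[ℝ] ℝ).precompL (E d))
    (hρ.contDiff.continuous_fderiv (by simp)) hw x
  rw [classicalPartial, mollify, h.fderiv, convolution, ContinuousLinearMap.integral_apply hc]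
  rw [← integral_sub_left_eq_self _ volume x]
  simp [classicalPartial, ContinuousLinearMap.precompL_apply]

/-- The difference is the ρ-average of the translation errors w(x - t) - w(x). Jensen and Tonelli
bound its norm by the worst translate with t in the support of ρ. Genuine measurability of w serves
Tonelli and is removed below by passing to a measurable representative. -/
theorem eLpNorm_mollify_sub_le_of_measurable (hρ : IsKernel ρ) (hwm : Measurable w)
    (hw : MemLp w 2 volume) {ε : ℝ≥0∞} {δ : ℝ}
    (hδ : ∀ t : E d, ‖t‖ < δ → eLpNorm (fun x => w (x - t) - w x) 2 volume ≤ ε)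
    (hsupp : ∀ t ∈ tsupport ρ, ‖t‖ < δ) :
    eLpNorm (mollify ρ w - w) 2 volume ≤ ε := by
  have hloc : LocallyIntegrable w volume := hw.locallyIntegrable (by norm_num)
  have hρm : Measurable fun t => ENNReal.ofReal (ρ t) :=
    hρ.contDiff.continuous.measurable.ennreal_ofReal
  have hint1 : ∫⁻ t, ENNReal.ofReal (ρ t) = 1 := by
    rw [← ofReal_integral_eq_lintegral_ofReal
      (hρ.contDiff.continuous.integrable_of_hasCompactSupport hρ.compact)
      (ae_of_all _ hρ.nonneg), hρ.integral_eq, ENNReal.ofReal_one]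
  have hsq : ∀ f : E d → ℝ, eLpNorm f 2 volume ^ 2 = ∫⁻ x, ‖f x‖ₑ ^ 2 := fun f => by
    have := eLpNorm_nnreal_pow_eq_lintegral (f := f) (μ := (volume : Measure (E d)))
      (p := 2) (by norm_num)
    simpa using this
  have hpt : ∀ x, ‖(mollify ρ w - w) x‖ₑ ^ 2 ≤
      ∫⁻ t, ENNReal.ofReal (ρ t) * ‖w (x - t) - w x‖ₑ ^ 2 := by
    intro x
    have e1 : (mollify ρ w - w) x = ∫ t, ρ t * (w (x - t) - w x) := by
      simp only [mul_sub]
      rw [integral_sub (hρ.integrable_mul hloc x)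
        ((hρ.contDiff.continuous.integrable_of_hasCompactSupport hρ.compact).mul_const _),
        integral_mul_const, hρ.integral_eq, one_mul]
      rfl
    refine le_trans ?_ (sq_lintegral_mul_le hρm.aemeasurable (by fun_prop) hint1)
    gcongr
    rw [e1]
    refine (enorm_integral_le_lintegral_enorm _).trans (lintegral_mono fun t => ?_)
    rw [enorm_mul, Real.enorm_of_nonneg (hρ.nonneg t)]
  have hmain : eLpNorm (mollify ρ w - w) 2 volume ^ 2 ≤ ε ^ 2 := by
    rw [hsq]
    calc _ ≤ ∫⁻ x, ∫⁻ t, ENNReal.ofReal (ρ t) * ‖w (x - t) - w x‖ₑ ^ 2 := lintegral_mono hpt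
      _ = ∫⁻ t, ∫⁻ x, ENNReal.ofReal (ρ t) * ‖w (x - t) - w x‖ₑ ^ 2 := by
        refine lintegral_lintegral_swap (Measurable.aemeasurable ?_)
        have hρ' := hρ.contDiff.continuous.measurable
        unfold Function.uncurry
        fun_prop
      _ ≤ ∫⁻ t, ENNReal.ofReal (ρ t) * ε ^ 2 := by
        refine lintegral_mono fun t => ?_
        rw [lintegral_const_mul _ (by fun_prop)]
        by_cases ht : t ∈ tsupport ρ
        · have := hδ t (hsupp t ht)
          rw [← hsq]
          gcongr
        · simp [image_eq_zero_of_notMem_tsupport ht]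
      _ = ε ^ 2 := by rw [lintegral_mul_const _ hρm, hint1, one_mul]
  exact (ENNReal.pow_le_pow_left_iff (by norm_num)).1 hmain

/-- Mollifications converge in `L²`. -/
theorem exists_eLpNorm_mollify_sub_le (hw : MemLp w 2 volume) {ε : ℝ≥0∞} (hε : 0 < ε) :
    ∃ δ > 0, ∀ ρ : E d → ℝ, IsKernel ρ → (∀ t ∈ tsupport ρ, ‖t‖ < δ) →
      eLpNorm (mollify ρ w - w) 2 volume ≤ ε := by
  set w' := hw.1.mk w
  have hww' : w =ᵐ[volume] w' := hw.1.ae_eq_mk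
  have hw' : MemLp w' 2 volume := (memLp_congr_ae hww').1 hw
  obtain ⟨δ, hδ, h⟩ := exists_eLpNorm_translate_sub_le hw' hε
  refine ⟨δ, hδ, fun ρ hρ hs => ?_⟩
  have e : mollify ρ w = mollify ρ w' := by
    ext x
    rw [mollify_apply_swap, mollify_apply_swap]
    exact integral_congr_ae (hww'.mono fun y hy => by simp only [hy])
  rw [e, eLpNorm_congr_ae (g := mollify ρ w' - w') (hww'.mono fun y hy => by simp [hy])]
  exact eLpNorm_mollify_sub_le_of_measurable hρ hw.1.stronglyMeasurable_mk.measurable hw' h hs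

theorem exists_isKernel (c : E d) {δ : ℝ} (hδ : 0 < δ) :
    ∃ ρ : E d → ℝ, IsKernel ρ ∧ tsupport ρ = Metric.closedBall c δ := by
  let b : ContDiffBump c := ⟨δ / 2, δ, by positivity, by linarith⟩
  exact ⟨b.normed volume, ⟨b.contDiff_normed, b.hasCompactSupport_normed, b.nonneg_normed,
    b.integral_normed⟩, b.tsupport_normed_eq⟩

end Convolution

/-! ### Uniqueness and linearity of weak derivatives. -/

section WeakDerivative

variable {d : ℕ} {Ω : Set (E d)} {j : Fin d}

theorem MemL2.integrable_mul {f g : E d → ℝ} (hf : MemL2 Ω f) (hg : MemL2 Ω g) :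
    Integrable (fun x => f x * g x) (volume.restrict Ω) :=
  MemLp.integrable_mul hf hg

theorem memL2_of_hasCompactSupport {φ : E d → ℝ} (hφ : Continuous φ) (hc : HasCompactSupport φ) :
    MemL2 Ω φ :=
  (hφ.memLp_of_hasCompactSupport (μ := volume) hc).restrict Ω

theorem MemL2.ae_eq_zero (hΩ : IsOpen Ω) {f : E d → ℝ} (hf : MemL2 Ω f)
    (h : ∀ φ : E d → ℝ, ContDiff ℝ ∞ φ → HasCompactSupport φ → tsupport φ ⊆ Ω →
      ∫ x in Ω, f x * φ x = 0) : f =ᵐ[volume.restrict Ω] 0 := by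
  have hloc : LocallyIntegrableOn f Ω volume :=
    locallyIntegrableOn_of_locallyIntegrable_restrict (hf.locallyIntegrable (by norm_num))
  have := hΩ.ae_eq_zero_of_integral_contDiff_smul_eq_zero hloc fun φ h1 h2 h3 => by
    rw [← h φ h1 h2 h3, ← setIntegral_eq_integral_of_forall_compl_eq_zero (s := Ω) fun x hx => by
      rw [image_eq_zero_of_notMem_tsupport fun h' => hx (h3 h'), zero_smul]]
    exact integral_congr_ae (ae_of_all _ fun x => mul_comm _ _)
  exact (ae_restrict_iff' hΩ.measurableSet).2 this

theorem IsWeakPartial.ae_eq (hΩ : IsOpen Ω) {w g g' : E d → ℝ} (h : IsWeakPartial Ω j w g)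
    (h' : IsWeakPartial Ω j w g') : g =ᵐ[volume.restrict Ω] g' := by
  have := MemL2.ae_eq_zero hΩ (h.1.sub h'.1) fun φ h1 h2 h3 => by
    have hφ : MemL2 Ω φ := memL2_of_hasCompactSupport h1.continuous h2
    have e := (h.2 φ h1 h2 h3).symm.trans (h'.2 φ h1 h2 h3)
    simp only [Pi.sub_apply, sub_mul]
    rw [integral_sub (h.1.integrable_mul hφ) (h'.1.integrable_mul hφ)]
    linarith
  filter_upwards [this] with x hx
  simpa [sub_eq_zero] using hx

theorem MemH1.isWeakPartial {w : E d → ℝ} (h : MemH1 Ω w) (j : Fin d) :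
    IsWeakPartial Ω j w (weakPartial Ω j w) := by
  rw [weakPartial, dif_pos (h.2 j)]
  exact (h.2 j).choose_spec

theorem MemH1.memL2_weakPartial {w : E d → ℝ} (h : MemH1 Ω w) (j : Fin d) :
    MemL2 Ω (weakPartial Ω j w) := (h.isWeakPartial j).1

theorem hasCompactSupport_classicalPartial {φ : E d → ℝ} (hc : HasCompactSupport φ) :
    HasCompactSupport (classicalPartial j φ) := hc.fderiv_apply ℝ _

theorem classicalPartial_mul {φ ψ : E d → ℝ} (hφ : ContDiff ℝ ∞ φ) (hψ : ContDiff ℝ ∞ ψ)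
    (x : E d) : classicalPartial j (fun y => φ y * ψ y) x =
      φ x * classicalPartial j ψ x + ψ x * classicalPartial j φ x := by
  have h1 := (hφ.differentiable (by simp) x).hasFDerivAt
  have h2 := (hψ.differentiable (by simp) x).hasFDerivAt
  rw [classicalPartial, (h1.fun_mul h2).fderiv]
  simp [classicalPartial]

theorem IsWeakPartial.sub {w w' g g' : E d → ℝ} (hw : MemL2 Ω w) (hw' : MemL2 Ω w')
    (h : IsWeakPartial Ω j w g) (h' : IsWeakPartial Ω j w' g') :
    IsWeakPartial Ω j (fun x => w x - w' x) (fun x => g x - g' x) := by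
  refine ⟨h.1.sub h'.1, fun φ h1 h2 h3 => ?_⟩
  have hφ : MemL2 Ω φ := memL2_of_hasCompactSupport h1.continuous h2
  have hdφ : MemL2 Ω (classicalPartial j φ) := memL2_of_hasCompactSupport
    (continuous_classicalPartial h1) (hasCompactSupport_classicalPartial h2)
  simp only [sub_mul]
  rw [integral_sub (hw.integrable_mul hdφ) (hw'.integrable_mul hdφ),
    integral_sub (h.1.integrable_mul hφ) (h'.1.integrable_mul hφ), h.2 φ h1 h2 h3, h'.2 φ h1 h2 h3]
  ring

theorem MemH1.sub {w w' : E d → ℝ} (h : MemH1 Ω w) (h' : MemH1 Ω w') :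
    MemH1 Ω (fun x => w x - w' x) :=
  ⟨h.1.sub h'.1, fun j => ⟨_, (h.isWeakPartial j).sub h.1 h'.1 (h'.isWeakPartial j)⟩⟩

theorem MemH1.weakPartial_sub (hΩ : IsOpen Ω) {w w' : E d → ℝ} (h : MemH1 Ω w) (h' : MemH1 Ω w')
    (j : Fin d) : weakPartial Ω j (fun x => w x - w' x) =ᵐ[volume.restrict Ω]
      fun x => weakPartial Ω j w x - weakPartial Ω j w' x :=
  ((h.sub h').isWeakPartial j).ae_eq hΩ ((h.isWeakPartial j).sub h.1 h'.1 (h'.isWeakPartial j))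

theorem isWeakPartial_classicalPartial (hΩ : IsBoundedLipschitzDomain Ω) {φ : E d → ℝ}
    (hφ : ContDiff ℝ ∞ φ) : IsWeakPartial Ω j φ (classicalPartial j φ) := by
  refine ⟨Continuous.memLp_restrict hΩ (continuous_classicalPartial hφ) 2, fun ψ h1 h2 h3 => ?_⟩
  have hprod : ContDiff ℝ ∞ fun y => φ y * ψ y := hφ.mul h1
  have h := setIntegral_fderiv_eq_zero (Ω := Ω) (hprod.of_le (by simp)) h2.mul_left
    (tsupport_mul_subset_right.trans h3) (basisVec j)
  have e : ∀ x, fderiv ℝ (fun y => φ y * ψ y) x (basisVec j) =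
      φ x * classicalPartial j ψ x + classicalPartial j φ x * ψ x := fun x => by
    rw [mul_comm (classicalPartial j φ x)]
    exact classicalPartial_mul hφ h1 x
  simp only [e] at h
  have hψ : MemL2 Ω ψ := memL2_of_hasCompactSupport h1.continuous h2
  have hdψ : MemL2 Ω (classicalPartial j ψ) := memL2_of_hasCompactSupport
    (continuous_classicalPartial h1) (hasCompactSupport_classicalPartial h2)
  have hφ2 : MemL2 Ω φ := Continuous.memLp_restrict hΩ hφ.continuous 2
  have hdφ2 : MemL2 Ω (classicalPartial j φ) :=
    Continuous.memLp_restrict hΩ (continuous_classicalPartial hφ) 2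
  rw [integral_add (hφ2.integrable_mul hdψ) (hdφ2.integrable_mul hψ)] at h
  linarith

theorem ContDiff.memH1 (hΩ : IsBoundedLipschitzDomain Ω) {φ : E d → ℝ} (hφ : ContDiff ℝ ∞ φ) :
    MemH1 Ω φ :=
  ⟨Continuous.memLp_restrict hΩ hφ.continuous 2, fun _ => ⟨_, isWeakPartial_classicalPartial hΩ hφ⟩⟩

theorem ContDiff.weakPartial_eq (hΩ : IsBoundedLipschitzDomain Ω) {φ : E d → ℝ}
    (hφ : ContDiff ℝ ∞ φ) :
    weakPartial Ω j φ =ᵐ[volume.restrict Ω] classicalPartial j φ :=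
  ((ContDiff.memH1 hΩ hφ).isWeakPartial j).ae_eq hΩ.isOpen (isWeakPartial_classicalPartial hΩ hφ)

end WeakDerivative

/-! ### Local smooth approximation up to the boundary by shifted mollifiers. -/

section Density

variable {d : ℕ} {Ω : Set (E d)} {j : Fin d} {w g θ ρ : E d → ℝ}

/-- Translation by the support of `ρ` moves no point of `Ω` into `supp θ \ Ω`. -/
def ShiftsInto (Ω : Set (E d)) (θ ρ : E d → ℝ) : Prop :=
  ∀ x ∈ Ω, ∀ s ∈ tsupport ρ, x - s ∈ tsupport θ → x - s ∈ Ω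

theorem MemL2.mul_of_hasCompactSupport (hw : MemL2 Ω w) (hθ : Continuous θ)
    (hc : HasCompactSupport θ) : MemL2 Ω fun x => θ x * w x := by
  obtain ⟨C, hC⟩ := hc.exists_bound_of_continuous hθ
  exact MemLp.mul (q := 2) (p := ⊤) hw (memLp_top_of_bound hθ.aestronglyMeasurable C
    (ae_of_all _ hC))

theorem MemL2.memLp_indicator (hΩ : IsOpen Ω) (hw : MemL2 Ω w) :
    MemLp (Ω.indicator w) 2 volume :=
  (memLp_indicator_iff_restrict hΩ.measurableSet).2 hw

/-- Mollification commutes with weak differentiation. -/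
theorem classicalPartial_mollify_indicator (hΩ : IsOpen Ω) (hw : MemL2 Ω w)
    (hg : IsWeakPartial Ω j w g) (hθ : ContDiff ℝ ∞ θ) (hc : HasCompactSupport θ)
    (hρ : IsKernel ρ) (hs : ShiftsInto Ω θ ρ) {x : E d} (hx : x ∈ Ω) :
    classicalPartial j (mollify ρ (Ω.indicator fun y => θ y * w y)) x =
      mollify ρ (Ω.indicator fun y => θ y * g y + classicalPartial j θ y * w y) x := by
  have hW : MemLp (Ω.indicator fun y => θ y * w y) 2 volume :=
    (hw.mul_of_hasCompactSupport hθ.continuous hc).memLp_indicator hΩ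
  rw [hρ.classicalPartial_mollify (hW.locallyIntegrable (by norm_num)), mollify_apply_swap]
  set φ : E d → ℝ := fun y => ρ (x - y)
  have hφ : ContDiff ℝ ∞ φ := hρ.contDiff.comp (contDiff_const.sub contDiff_id)
  have hφc : HasCompactSupport φ := hρ.compact.comp_homeomorph (Homeomorph.subLeft x)
  have hdφ : ∀ y, classicalPartial j ρ (x - y) = -classicalPartial j φ y := by
    intro y
    have h1 : HasFDerivAt (fun y => x - y) (-ContinuousLinearMap.id ℝ (E d)) y :=
      (hasFDerivAt_id y).const_sub x
    have h2 := (hρ.contDiff.differentiable (by simp) (x - y)).hasFDerivAt.comp y h1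
    have h3 : fderiv ℝ φ y = _ := h2.fderiv
    simp [classicalPartial, h3]
  have hprod : ContDiff ℝ ∞ fun y => θ y * φ y := hθ.mul hφ
  -- This is the purpose of `ShiftsInto`: even for x close to Γ, the product of θ with ρ(x - ·) is a
  -- test function supported in Ω. The jump of the zero extension across Γ therefore does not enter.
  have hsupp : tsupport (fun y => θ y * φ y) ⊆ Ω := by
    intro y hy
    have h1 : y ∈ tsupport θ := tsupport_mul_subset_left hy
    have h2 : y ∈ tsupport φ := tsupport_mul_subset_right hy
    have h3 : x - y ∈ tsupport ρ :=
      tsupport_comp_subset_preimage ρ (continuous_const.sub continuous_id) h2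
    have := hs x hx (x - y) h3
    rw [sub_sub_cancel] at this
    exact this h1
  have hid := hg.2 _ hprod hc.mul_right hsupp
  have e1 : ∫ y, classicalPartial j ρ (x - y) * Ω.indicator (fun y => θ y * w y) y =
      ∫ y in Ω, -(classicalPartial j φ y * (θ y * w y)) := by
    rw [← integral_indicator hΩ.measurableSet]
    refine integral_congr_ae (ae_of_all _ fun y => ?_)
    by_cases hy : y ∈ Ω <;> simp [hy, hdφ]
  have e2 : ∫ y, ρ (x - y) *
        Ω.indicator (fun y => θ y * g y + classicalPartial j θ y * w y) y =
      ∫ y in Ω, φ y * (θ y * g y + classicalPartial j θ y * w y) := by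
    rw [← integral_indicator hΩ.measurableSet]
    refine integral_congr_ae (ae_of_all _ fun y => ?_)
    by_cases hy : y ∈ Ω <;> simp [hy, φ]
  have c1 : Continuous (classicalPartial j φ) := continuous_classicalPartial hφ
  have c2 : Continuous (classicalPartial j θ) := continuous_classicalPartial hθ
  have i1 : Integrable (fun y => w y * (θ y * classicalPartial j φ y)) (volume.restrict Ω) :=
    hw.integrable_mul (memL2_of_hasCompactSupport (hθ.continuous.mul c1) hc.mul_right)
  have i2 : Integrable (fun y => w y * (φ y * classicalPartial j θ y)) (volume.restrict Ω) :=
    hw.integrable_mul (memL2_of_hasCompactSupport (hφ.continuous.mul c2) hφc.mul_right)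
  have i3 : Integrable (fun y => g y * (θ y * φ y)) (volume.restrict Ω) :=
    hg.1.integrable_mul (memL2_of_hasCompactSupport hprod.continuous hc.mul_right)
  simp only [classicalPartial_mul hθ hφ, mul_add] at hid
  rw [integral_add i1 i2] at hid
  rw [e1, e2]
  have e3 : ∫ y in Ω, -(classicalPartial j φ y * (θ y * w y)) =
      -∫ y in Ω, w y * (θ y * classicalPartial j φ y) := by
    rw [← integral_neg]
    exact integral_congr_ae (ae_of_all _ fun y => by ring)
  have e4 : ∫ y in Ω, φ y * (θ y * g y + classicalPartial j θ y * w y) =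
      (∫ y in Ω, g y * (θ y * φ y)) + ∫ y in Ω, w y * (φ y * classicalPartial j θ y) := by
    rw [← integral_add i3 i2]
    exact integral_congr_ae (ae_of_all _ fun y => by ring)
  rw [e3, e4]
  linarith

/-- There are mollifiers of arbitrarily small support which shift `Ω` into itself on `supp θ`. -/
def HasShiftingKernels (Ω : Set (E d)) (θ : E d → ℝ) : Prop :=
  ∀ η > 0, ∃ ρ : E d → ℝ, IsKernel ρ ∧ (∀ s ∈ tsupport ρ, ‖s‖ < η) ∧ ShiftsInto Ω θ ρ

theorem hasShiftingKernels_of_tsupport_subset (h : tsupport θ ⊆ Ω) : HasShiftingKernels Ω θ := by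
  intro η hη
  obtain ⟨ρ, hρ, hs⟩ := exists_isKernel (0 : E d) (half_pos hη)
  refine ⟨ρ, hρ, fun s hs' => ?_, fun x _ s _ hxs => h hxs⟩
  rw [hs, mem_closedBall_zero_iff] at hs'
  linarith

/-- A kernel concentrated near -tν averages over points close to x + tν, that is, over points pushed
into the epigraph. If its radius is small compared with t, the Lipschitz graph cannot catch up with
the shift. -/
theorem IsGraphChart.hasShiftingKernels {ν : E d} {g : hyperplane ν → ℝ} {K : ℝ≥0} {x₀ : E d}
    {r : ℝ} (h : IsGraphChart Ω ν g K x₀ r) (hθ : tsupport θ ⊆ Metric.ball x₀ r) :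
    HasShiftingKernels Ω θ := by
  have hcomp : IsCompact (tsupport θ) :=
    Metric.isCompact_of_isClosed_isBounded (isClosed_tsupport θ) (Metric.isBounded_ball.subset hθ)
  obtain ⟨δ, hδ, hthick⟩ := hcomp.exists_thickening_subset_open Metric.isOpen_ball hθ
  intro η hη
  -- Every s in the support has ‖s‖ ≤ t + δ' < 3t. So s is shorter than η, and x stays in the
  -- δ-thickening of supp θ, which lies inside the ball of the chart.
  set t := min η δ / 3
  have ht : 0 < t := by positivity
  have htη : 3 * t ≤ η := by simp only [t]; linarith [min_le_left η δ]
  have htδ : 3 * t ≤ δ := by simp only [t]; linarith [min_le_right η δ]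
  -- An error e with ‖e‖ ≤ δ' raises g by at most K δ' and lowers the height by at most δ'. Together
  -- this is (K + 1) δ' < t.
  set δ' := t / (K + 2)
  have hK : (0 : ℝ) < K + 2 := by positivity
  have hδ' : 0 < δ' := by positivity
  have hδ't : (K + 2) * δ' = t := by simp only [δ']; field_simp
  have hδ'lt : δ' ≤ t := by nlinarith [K.coe_nonneg]
  obtain ⟨ρ, hρ, hs⟩ := exists_isKernel (-(t • ν)) hδ'
  have hν := h.norm_eq
  have hnorm : ∀ s ∈ tsupport ρ, ‖s‖ < 3 * t := by
    intro s hs'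
    rw [hs, mem_closedBall_iff_norm, sub_neg_eq_add] at hs'
    have : ‖s‖ ≤ ‖s + t • ν‖ + ‖t • ν‖ := by
      simpa using norm_sub_le (s + t • ν) (t • ν)
    rw [norm_smul, hν, Real.norm_eq_abs, abs_of_pos ht] at this
    linarith
  refine ⟨ρ, hρ, fun s hs' => (hnorm s hs').trans_le htη, fun x hx s hs' hxs => ?_⟩
  have hxball : x ∈ Metric.ball x₀ r := by
    refine hthick (Metric.mem_thickening_iff.2 ⟨x - s, hxs, ?_⟩)
    rw [dist_eq_norm, sub_sub_cancel]
    exact (hnorm s hs').trans_le htδ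
  rw [h.mem_iff _ (hθ hxs)]
  have hxe := (h.mem_iff x hxball).1 hx
  simp only [epigraph, mem_ofPred_eq] at hxe ⊢
  set e := s + t • ν
  have he : ‖e‖ ≤ δ' := by
    rw [hs, mem_closedBall_iff_norm, sub_neg_eq_add] at hs'
    exact hs'
  have hse : x - s = x - e + t • ν := by simp only [e]; abel
  have hP : hyperplaneProj ν (x - s) = hyperplaneProj ν x - hyperplaneProj ν e := by
    rw [hse]; simp [hyperplaneProj_normal]
  have hPe : ‖hyperplaneProj ν e‖ ≤ δ' := by
    have := norm_le_norm_add_smul hν (hyperplaneProj ν e) (inner ℝ e ν)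
    rw [hyperplaneProj_add_smul hν] at this
    exact this.trans he
  have hg : g (hyperplaneProj ν (x - s)) ≤ g (hyperplaneProj ν x) + K * δ' := by
    have h1 := h.lipschitz.dist_le_mul (hyperplaneProj ν (x - s)) (hyperplaneProj ν x)
    rw [Real.dist_eq, dist_eq_norm, hP, sub_sub_cancel_left, norm_neg] at h1
    have h2 := (le_abs_self _).trans h1
    have h3 : (K : ℝ) * ‖hyperplaneProj ν e‖ ≤ K * δ' := by gcongr
    rw [hP]
    linarith
  have hin : inner ℝ (x - s) ν = inner ℝ x ν - inner ℝ e ν + t := by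
    rw [hse, inner_add_left, inner_sub_left, inner_smul_left, real_inner_self_eq_norm_sq, hν]
    simp
  have hie : inner ℝ e ν ≤ δ' := by
    have := real_inner_le_norm e ν
    rw [hν, mul_one] at this
    exact this.trans he
  rw [hin]
  nlinarith

theorem eLpNorm_restrict_le_of_eqOn {f f' : E d → ℝ} {ε : ℝ≥0∞} (hΩ : IsOpen Ω)
    (hf : eLpNorm f' 2 volume ≤ ε) (h : ∀ x ∈ Ω, f x = f' x) :
    eLpNorm f 2 (volume.restrict Ω) ≤ ε := by
  refine le_trans (le_of_eq (eLpNorm_congr_ae ?_))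
    ((eLpNorm_mono_measure f' Measure.restrict_le_self).trans hf)
  exact (ae_restrict_mem hΩ.measurableSet).mono fun x hx => h x hx

/-- Mollify the extension of θ w by zero. A kernel whose shifts respect Ω makes differentiation
commute with mollification in Ω, so convergence of the derivatives is again L² convergence of
mollifications. One kernel, finer than finitely many thresholds, serves θ w and all its partial
derivatives. -/
theorem exists_contDiff_approx_mul (hΩ : IsOpen Ω) (hw : MemH1 Ω w) (hθ : ContDiff ℝ ∞ θ)
    (hc : HasCompactSupport θ) (hsh : HasShiftingKernels Ω θ) {ε : ℝ≥0∞} (hε : 0 < ε) :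
    ∃ ψ : E d → ℝ, ContDiff ℝ ∞ ψ ∧
      eLpNorm (fun x => ψ x - θ x * w x) 2 (volume.restrict Ω) ≤ ε ∧
      ∀ j, eLpNorm (fun x => classicalPartial j ψ x -
        (θ x * weakPartial Ω j w x + classicalPartial j θ x * w x)) 2 (volume.restrict Ω) ≤ ε := by
  set W : E d → ℝ := Ω.indicator fun y => θ y * w y
  set G : Fin d → E d → ℝ := fun j =>
    Ω.indicator fun y => θ y * weakPartial Ω j w y + classicalPartial j θ y * w y
  have hW : MemLp W 2 volume := (hw.1.mul_of_hasCompactSupport hθ.continuous hc).memLp_indicator hΩ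
  have hG : ∀ j, MemLp (G j) 2 volume := fun j =>
    MemL2.memLp_indicator hΩ (MemLp.add
      ((hw.memL2_weakPartial j).mul_of_hasCompactSupport hθ.continuous hc)
      (hw.1.mul_of_hasCompactSupport (continuous_classicalPartial hθ)
        (hasCompactSupport_classicalPartial hc)))
  obtain ⟨δ₀, hδ₀, H₀⟩ := exists_eLpNorm_mollify_sub_le hW hε
  choose δ hδ H using fun j => exists_eLpNorm_mollify_sub_le (hG j) hε
  obtain ⟨η, hη, hη₀, hηj⟩ : ∃ η > 0, η ≤ δ₀ ∧ ∀ j, η ≤ δ j := by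
    have h : ∀ᶠ η in 𝓝[>] (0 : ℝ), η ≤ δ₀ ∧ ∀ j, η ≤ δ j :=
      ((eventually_le_nhds hδ₀).and
        (eventually_all.2 fun j => eventually_le_nhds (hδ j))).filter_mono nhdsWithin_le_nhds
    obtain ⟨η, h1, h2⟩ := (h.and self_mem_nhdsWithin).exists
    exact ⟨η, h2, h1.1, h1.2⟩
  obtain ⟨ρ, hρ, hsmall, hshift⟩ := hsh η hη
  refine ⟨mollify ρ W, hρ.contDiff_mollify (hW.locallyIntegrable (by norm_num)), ?_, fun j => ?_⟩
  · refine eLpNorm_restrict_le_of_eqOn hΩ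
      (H₀ ρ hρ fun t ht => (hsmall t ht).trans_le hη₀) fun x hx => ?_
    simp [W, hx]
  · refine eLpNorm_restrict_le_of_eqOn hΩ
      (H j ρ hρ fun t ht => (hsmall t ht).trans_le (hηj j)) fun x hx => ?_
    rw [classicalPartial_mollify_indicator hΩ hw.1 (hw.isWeakPartial j) hθ hc hρ hshift hx]
    simp [G, hx]

end Density

/-! ### Density, existence and uniqueness of traces, Green's formula. -/

section Trace

variable {d : ℕ} {Ω : Set (E d)} {w z g h : E d → ℝ}

theorem classicalPartial_sum {ι : Type*} (s : Finset ι) {f : ι → E d → ℝ}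
    (hf : ∀ i ∈ s, ContDiff ℝ ∞ (f i)) (j : Fin d) (x : E d) :
    classicalPartial j (fun y => ∑ i ∈ s, f i y) x = ∑ i ∈ s, classicalPartial j (f i) x := by
  have := HasFDerivAt.fun_sum (u := s) (x := x) fun i hi =>
    ((hf i hi).differentiable (by simp) x).hasFDerivAt
  rw [classicalPartial, this.fderiv]
  simp [classicalPartial]

theorem classicalPartial_sub {φ ψ : E d → ℝ} (hφ : ContDiff ℝ ∞ φ) (hψ : ContDiff ℝ ∞ ψ)
    (j : Fin d) : classicalPartial j (φ - ψ) = classicalPartial j φ - classicalPartial j ψ := by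
  ext x
  have h1 := (hφ.differentiable (by simp) x).hasFDerivAt
  have h2 := (hψ.differentiable (by simp) x).hasFDerivAt
  rw [classicalPartial, (h1.sub h2).fderiv]
  simp [classicalPartial]

/-- Functions which are smooth up to the boundary are dense in `H¹(Ω)`. -/
theorem exists_contDiff_approx (hΩ : IsBoundedLipschitzDomain Ω) (hw : MemH1 Ω w) {ε : ℝ≥0∞}
    (hε : 0 < ε) :
    ∃ ψ : E d → ℝ, ContDiff ℝ ∞ ψ ∧ eLpNorm (ψ - w) 2 (volume.restrict Ω) ≤ ε ∧
      ∀ j, eLpNorm (classicalPartial j ψ - weakPartial Ω j w) 2 (volume.restrict Ω) ≤ ε := by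
  obtain ⟨B⟩ := hΩ.nonempty_boundaryPartition
  let θ : Option B.ι → E d → ℝ := fun i => i.elim B.χ₀ B.χ
  have hθ : ∀ i, ContDiff ℝ ∞ (θ i) := by
    rintro (_ | i)
    · exact B.contDiff₀
    · exact B.contDiff i
  have hc : ∀ i, HasCompactSupport (θ i) := by
    rintro (_ | i)
    · exact Metric.isCompact_of_isClosed_isBounded (isClosed_tsupport _)
        (hΩ.isBounded.subset B.tsupport₀)
    · exact Metric.isCompact_of_isClosed_isBounded (isClosed_tsupport _)
        (Metric.isBounded_ball.subset (B.tsupport i))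
  have hsh : ∀ i, HasShiftingKernels Ω (θ i) := by
    rintro (_ | i)
    · exact hasShiftingKernels_of_tsupport_subset B.tsupport₀
    · exact (B.chart i).hasShiftingKernels (B.tsupport i)
  have hsum : ∀ x ∈ Ω, ∑ i, θ i x = 1 := by
    intro x hx
    rw [Fintype.sum_option]
    exact B.sum_eq x (subset_closure hx)
  -- The partition functions sum to 1 near each point of Ω, so the terms ∂_j θ_i · w created by
  -- localization cancel in the sum.
  have hdsum : ∀ j, ∀ x ∈ Ω, ∑ i, classicalPartial j (θ i) x = 0 := by
    intro j x hx
    rw [← classicalPartial_sum _ fun i _ => hθ i]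
    have : (fun y => ∑ i, θ i y) =ᶠ[𝓝 x] fun _ => 1 := by
      filter_upwards [hΩ.isOpen.mem_nhds hx] with y hy using hsum y hy
    rw [classicalPartial, this.fderiv_eq]
    simp
  set n : ℝ≥0∞ := ((Fintype.card (Option B.ι) : ℕ) : ℝ≥0∞)
  have hn : n ≠ ⊤ := ENNReal.natCast_ne_top _
  have hε' : 0 < ε / n := ENNReal.div_pos hε.ne' hn
  have hn0 : n ≠ 0 := by simp [n]
  choose ψ hψ h1 h2 using fun i =>
    exists_contDiff_approx_mul hΩ.isOpen hw (hθ i) (hc i) (hsh i) hε'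
  have hψs : ContDiff ℝ ∞ fun x => ∑ i, ψ i x := ContDiff.sum fun i _ => hψ i
  have hbound : ∀ {F : E d → ℝ} {f : Option B.ι → E d → ℝ},
      (∀ i, AEStronglyMeasurable (f i) (volume.restrict Ω)) →
      (∀ i, eLpNorm (f i) 2 (volume.restrict Ω) ≤ ε / n) → (∀ x ∈ Ω, F x = ∑ i, f i x) →
      eLpNorm F 2 (volume.restrict Ω) ≤ ε := by
    intro F f hm hf hF
    have e : F =ᵐ[volume.restrict Ω] ∑ i, f i := by
      filter_upwards [ae_restrict_mem hΩ.isOpen.measurableSet] with x hx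
      rw [hF x hx, Finset.sum_apply]
    rw [eLpNorm_congr_ae e]
    refine (eLpNorm_sum_le (fun i _ => hm i) (by norm_num)).trans
      ((Finset.sum_le_sum fun i _ => hf i).trans ?_)
    rw [Finset.sum_const, Finset.card_univ, nsmul_eq_mul]
    exact (ENNReal.mul_div_cancel hn0 hn).le
  have hmw := hw.1.aestronglyMeasurable
  refine ⟨fun x => ∑ i, ψ i x, hψs, ?_, fun j => ?_⟩
  · refine hbound (fun i => ?_) h1 fun x hx => ?_
    · exact (hψ i).continuous.aestronglyMeasurable.sub
        ((hθ i).continuous.aestronglyMeasurable.mul hmw)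
    · rw [Finset.sum_sub_distrib, ← Finset.sum_mul, hsum x hx, one_mul]
      rfl
  · refine hbound (fun i => ?_) (fun i => h2 i j) fun x hx => ?_
    · exact (continuous_classicalPartial (hψ i)).aestronglyMeasurable.sub
        (((hθ i).continuous.aestronglyMeasurable.mul
          (hw.memL2_weakPartial j).aestronglyMeasurable).add
        ((continuous_classicalPartial (hθ i)).aestronglyMeasurable.mul hmw))
    · rw [Finset.sum_sub_distrib, Finset.sum_add_distrib, ← Finset.sum_mul, ← Finset.sum_mul,
        hsum x hx, hdsum j x hx, one_mul, zero_mul, add_zero, Pi.sub_apply,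
        classicalPartial_sum _ fun i _ => hψ i]

theorem eLpNorm_two_eq {α : Type*} [MeasurableSpace α] {μ : Measure α} {f : α → ℝ}
    (hf : MemLp f 2 μ) : eLpNorm f 2 μ = ENNReal.ofReal (√(∫ x, f x ^ 2 ∂μ)) := by
  rw [hf.eLpNorm_eq_integral_rpow_norm (by norm_num) (by norm_num), Real.sqrt_eq_rpow]
  simp

/-- The distance of a smooth function to `w ∈ H¹(Ω)`. -/
noncomputable def sobolevDist (Ω : Set (E d)) (w φ : E d → ℝ) : ℝ≥0∞ :=
  eLpNorm (φ - w) 2 (volume.restrict Ω) +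
    ∑ j, eLpNorm (classicalPartial j φ - weakPartial Ω j w) 2 (volume.restrict Ω)

theorem exists_eLpNorm_surfaceMeasure_le (hΩ : IsBoundedLipschitzDomain Ω) :
    ∃ C : ℝ≥0, ∀ φ : E d → ℝ, ContDiff ℝ ∞ φ →
      eLpNorm φ 2 (surfaceMeasure Ω) ≤ C * (eLpNorm φ 2 (volume.restrict Ω) +
        ∑ j, eLpNorm (classicalPartial j φ) 2 (volume.restrict Ω)) := by
  obtain ⟨C, hC⟩ := exists_trace_inequality hΩ
  refine ⟨Real.toNNReal (√|C|), fun φ hφ => ?_⟩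
  have m1 : MemLp φ 2 (volume.restrict Ω) := Continuous.memLp_restrict hΩ hφ.continuous 2
  have m2 : ∀ j, MemLp (classicalPartial j φ) 2 (volume.restrict Ω) := fun j =>
    Continuous.memLp_restrict hΩ (continuous_classicalPartial hφ) 2
  rw [eLpNorm_two_eq (Continuous.memLp_surfaceMeasure hΩ hφ.continuous 2), eLpNorm_two_eq m1]
  simp only [eLpNorm_two_eq (m2 _)]
  rw [← ENNReal.ofReal_sum_of_nonneg fun _ _ => Real.sqrt_nonneg _,
    ← ENNReal.ofReal_add (Real.sqrt_nonneg _) (Finset.sum_nonneg fun _ _ => Real.sqrt_nonneg _)]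
  change _ ≤ ENNReal.ofReal (√|C|) * _
  rw [← ENNReal.ofReal_mul (Real.sqrt_nonneg _)]
  refine ENNReal.ofReal_le_ofReal ?_
  set a := ∫ x in Ω, φ x ^ 2
  set b : Fin d → ℝ := fun j => ∫ x in Ω, classicalPartial j φ x ^ 2
  have ha : 0 ≤ a := integral_nonneg fun _ => sq_nonneg _
  have hb : ∀ j, 0 ≤ b j := fun j => integral_nonneg fun _ => sq_nonneg _
  have hsb : 0 ≤ ∑ j, √(b j) := Finset.sum_nonneg fun _ _ => Real.sqrt_nonneg _
  have h1 : ∑ j, b j ≤ (∑ j, √(b j)) ^ 2 := by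
    calc ∑ j, b j = ∑ j, √(b j) ^ 2 := Finset.sum_congr rfl fun j _ => (Real.sq_sqrt (hb j)).symm
      _ ≤ _ := Finset.sum_sq_le_sq_sum_of_nonneg fun _ _ => Real.sqrt_nonneg _
  rw [Real.sqrt_le_left (by positivity)]
  calc _ ≤ C * (a + ∑ j, b j) := hC φ hφ
    _ ≤ |C| * (a + ∑ j, b j) := by
      gcongr
      exact le_abs_self C
    _ ≤ |C| * (√a + ∑ j, √(b j)) ^ 2 := by
      gcongr
      nlinarith [Real.sq_sqrt ha, Real.sqrt_nonneg a, mul_nonneg (Real.sqrt_nonneg a) hsb]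
    _ = _ := by rw [mul_pow, Real.sq_sqrt (abs_nonneg C)]

/-- The trace inequality applied to φ - ψ, with both compared to w. It shows that the boundary
values of an approximating sequence are Cauchy and that two such sequences have the same limit. -/
theorem exists_eLpNorm_sub_surfaceMeasure_le (hΩ : IsBoundedLipschitzDomain Ω) :
    ∃ C : ℝ≥0, ∀ w : E d → ℝ, MemH1 Ω w → ∀ φ ψ : E d → ℝ, ContDiff ℝ ∞ φ → ContDiff ℝ ∞ ψ →
      eLpNorm (φ - ψ) 2 (surfaceMeasure Ω) ≤ C * (sobolevDist Ω w φ + sobolevDist Ω w ψ) := by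
  obtain ⟨C, hC⟩ := exists_eLpNorm_surfaceMeasure_le hΩ
  refine ⟨C, fun w hw φ ψ hφ hψ => (hC (φ - ψ) (hφ.sub hψ)).trans ?_⟩
  have key : ∀ {a b c : E d → ℝ}, AEStronglyMeasurable a (volume.restrict Ω) →
      AEStronglyMeasurable b (volume.restrict Ω) → AEStronglyMeasurable c (volume.restrict Ω) →
      eLpNorm (a - b) 2 (volume.restrict Ω) ≤
        eLpNorm (a - c) 2 (volume.restrict Ω) + eLpNorm (b - c) 2 (volume.restrict Ω) := by
    intro a b c ha hb hc
    have : a - b = (a - c) - (b - c) := by abel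
    rw [this]
    exact eLpNorm_sub_le (ha.sub hc) (hb.sub hc) (by norm_num)
  refine mul_le_mul' le_rfl ?_
  simp only [sobolevDist]
  rw [add_add_add_comm, ← Finset.sum_add_distrib]
  refine add_le_add ?_ (Finset.sum_le_sum fun j _ => ?_)
  · exact key hφ.continuous.aestronglyMeasurable hψ.continuous.aestronglyMeasurable
      hw.1.aestronglyMeasurable
  · rw [classicalPartial_sub hφ hψ]
    exact key (continuous_classicalPartial hφ).aestronglyMeasurable
      (continuous_classicalPartial hψ).aestronglyMeasurable
      (hw.memL2_weakPartial j).aestronglyMeasurable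

theorem tendsto_sobolevDist {φ : ℕ → E d → ℝ}
    (h0 : Tendsto (fun k => eLpNorm (φ k - w) 2 (volume.restrict Ω)) atTop (𝓝 0))
    (h1 : ∀ j, Tendsto (fun k => eLpNorm (classicalPartial j (φ k) - weakPartial Ω j w) 2
      (volume.restrict Ω)) atTop (𝓝 0)) :
    Tendsto (fun k => sobolevDist Ω w (φ k)) atTop (𝓝 0) := by
  have := h0.add (tendsto_finsetSum Finset.univ fun j _ => h1 j)
  simpa [sobolevDist] using this

/-- Every function in `H¹(Ω)` has a trace. -/
theorem MemH1.exists_isTrace (hΩ : IsBoundedLipschitzDomain Ω) (hw : MemH1 Ω w) :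
    ∃ g, IsTrace Ω w g := by
  have hε : ∀ k : ℕ, (0 : ℝ≥0∞) < (k + 1 : ℝ≥0∞)⁻¹ := fun k => ENNReal.inv_pos.2 (by simp)
  choose φ hφ h1 h2 using fun k => exists_contDiff_approx hΩ hw (hε k)
  have hlim : Tendsto (fun k : ℕ => (k + 1 : ℝ≥0∞)⁻¹) atTop (𝓝 0) := by
    have := (tendsto_add_atTop_iff_nat 1).2 ENNReal.tendsto_inv_nat_nhds_zero
    simpa using this
  have t1 := tendsto_of_tendsto_of_tendsto_of_le_of_le tendsto_const_nhds hlim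
    (fun _ => zero_le) h1
  have t2 := fun j => tendsto_of_tendsto_of_tendsto_of_le_of_le tendsto_const_nhds hlim
    (fun _ => zero_le) fun k => h2 k j
  have t3 := tendsto_sobolevDist t1 t2
  obtain ⟨C, hC⟩ := exists_eLpNorm_sub_surfaceMeasure_le hΩ
  have hm : ∀ k, MemLp (φ k) 2 (surfaceMeasure Ω) := fun k =>
    Continuous.memLp_surfaceMeasure hΩ (hφ k).continuous 2
  -- The limit in the complete space L²(Γ) is the trace.
  have hcau : CauchySeq fun k => (hm k).toLp := by
    refine EMetric.cauchySeq_iff.2 fun ε hε => ?_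
    have t4 : Tendsto (fun p : ℕ × ℕ => (C : ℝ≥0∞) *
        (sobolevDist Ω w (φ p.1) + sobolevDist Ω w (φ p.2))) atTop (𝓝 0) := by
      rw [← prod_atTop_atTop_eq]
      have := ENNReal.Tendsto.const_mul (a := (C : ℝ≥0∞))
        ((t3.comp tendsto_fst).add (t3.comp (tendsto_snd (f := (atTop : Filter ℕ)))))
        (Or.inr ENNReal.coe_ne_top)
      simpa using this
    obtain ⟨N, hN⟩ := eventually_atTop.1 (t4.eventually (gt_mem_nhds hε))
    refine ⟨max N.1 N.2, fun m hm' n hn' => ?_⟩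
    rw [Lp.edist_toLp_toLp]
    exact (hC w hw _ _ (hφ m) (hφ n)).trans_lt
      (hN (m, n) ⟨(le_max_left _ _).trans hm', (le_max_right _ _).trans hn'⟩)
  obtain ⟨G, hG⟩ := cauchySeq_tendsto_of_complete hcau
  refine ⟨G, hw, Lp.memLp G, φ, hφ, t1, t2, ?_⟩
  have := (Lp.tendsto_Lp_iff_tendsto_eLpNorm' _ _).1 hG
  refine this.congr fun k => eLpNorm_congr_ae ?_
  filter_upwards [(hm k).coeFn_toLp] with x hx
  simp [hx]

theorem MemH1.isTrace_trace (hΩ : IsBoundedLipschitzDomain Ω) (hw : MemH1 Ω w) :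
    IsTrace Ω w (trace Ω w) := by
  have h := hw.exists_isTrace hΩ
  rw [trace, dif_pos h]
  exact h.choose_spec

/-- The trace is unique. -/
theorem IsTrace.ae_eq (hΩ : IsBoundedLipschitzDomain Ω) (hg : IsTrace Ω w g) (hh : IsTrace Ω w h) :
    g =ᵐ[surfaceMeasure Ω] h := by
  obtain ⟨hw, hg2, φ, hφ, a1, a2, a3⟩ := hg
  obtain ⟨-, hh2, ψ, hψ, b1, b2, b3⟩ := hh
  obtain ⟨C, hC⟩ := exists_eLpNorm_sub_surfaceMeasure_le hΩ
  have hlim : Tendsto (fun k => eLpNorm (φ k - g) 2 (surfaceMeasure Ω) +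
      C * (sobolevDist Ω w (φ k) + sobolevDist Ω w (ψ k)) +
      eLpNorm (ψ k - h) 2 (surfaceMeasure Ω)) atTop (𝓝 0) := by
    have := (a3.add (ENNReal.Tendsto.const_mul (a := (C : ℝ≥0∞))
      ((tendsto_sobolevDist a1 a2).add (tendsto_sobolevDist b1 b2))
      (Or.inr ENNReal.coe_ne_top))).add b3
    simpa using this
  have hle : ∀ k, eLpNorm (g - h) 2 (surfaceMeasure Ω) ≤ eLpNorm (φ k - g) 2 (surfaceMeasure Ω) +
      C * (sobolevDist Ω w (φ k) + sobolevDist Ω w (ψ k)) +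
      eLpNorm (ψ k - h) 2 (surfaceMeasure Ω) := by
    intro k
    have e : g - h = (φ k - ψ k) - (φ k - g) + (ψ k - h) := by abel
    have mφ := (hφ k).continuous.aestronglyMeasurable (μ := surfaceMeasure Ω)
    have mψ := (hψ k).continuous.aestronglyMeasurable (μ := surfaceMeasure Ω)
    rw [e]
    refine (eLpNorm_add_le ((mφ.sub mψ).sub (mφ.sub hg2.1)) (mψ.sub hh2.1) (by norm_num)).trans ?_
    gcongr
    rw [add_comm]
    refine (eLpNorm_sub_le (mφ.sub mψ) (mφ.sub hg2.1) (by norm_num)).trans ?_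
    gcongr
    exact hC w hw _ _ (hφ k) (hψ k)
  have h0 : eLpNorm (g - h) 2 (surfaceMeasure Ω) = 0 :=
    le_antisymm (ge_of_tendsto' hlim hle) zero_le
  rw [eLpNorm_eq_zero_iff (hg2.sub hh2).1 (by norm_num)] at h0
  filter_upwards [h0] with x hx
  simpa [sub_eq_zero] using hx

theorem IsTrace.sub (hΩ : IsBoundedLipschitzDomain Ω) (hg : IsTrace Ω w g) (hh : IsTrace Ω z h) :
    IsTrace Ω (fun x => w x - z x) (fun x => g x - h x) := by
  obtain ⟨hw, hg2, φ, hφ, a1, a2, a3⟩ := hg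
  obtain ⟨hz, hh2, ψ, hψ, b1, b2, b3⟩ := hh
  have key : ∀ {μ : Measure (E d)} {f f' : E d → ℝ} {p q : ℕ → E d → ℝ},
      (∀ k, AEStronglyMeasurable (p k) μ) → (∀ k, AEStronglyMeasurable (q k) μ) →
      AEStronglyMeasurable f μ → AEStronglyMeasurable f' μ →
      Tendsto (fun k => eLpNorm (p k - f) 2 μ) atTop (𝓝 0) →
      Tendsto (fun k => eLpNorm (q k - f') 2 μ) atTop (𝓝 0) →
      Tendsto (fun k => eLpNorm ((p k - q k) - (f - f')) 2 μ) atTop (𝓝 0) := by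
    intro μ f f' p q hp hq hf hf' h1 h2
    have := h1.add h2
    rw [add_zero] at this
    refine tendsto_of_tendsto_of_tendsto_of_le_of_le tendsto_const_nhds this
      (fun _ => zero_le) fun k => ?_
    have e : (p k - q k) - (f - f') = (p k - f) - (q k - f') := by abel
    simp only [e]
    exact eLpNorm_sub_le ((hp k).sub hf) ((hq k).sub hf') (by norm_num)
  refine ⟨hw.sub hz, hg2.sub hh2, fun k => φ k - ψ k, fun k => (hφ k).sub (hψ k), ?_, fun j => ?_,
    ?_⟩
  · exact key (fun k => (hφ k).continuous.aestronglyMeasurable)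
      (fun k => (hψ k).continuous.aestronglyMeasurable) hw.1.1 hz.1.1 a1 b1
  · refine (key (fun k => (continuous_classicalPartial (hφ k)).aestronglyMeasurable)
      (fun k => (continuous_classicalPartial (hψ k)).aestronglyMeasurable)
      (hw.memL2_weakPartial j).1 (hz.memL2_weakPartial j).1 (a2 j) (b2 j)).congr fun k => ?_
    refine eLpNorm_congr_ae ?_
    filter_upwards [hw.weakPartial_sub hΩ.isOpen hz j] with x hx
    simp [classicalPartial_sub (hφ k) (hψ k), hx]
  · exact key (fun k => (hφ k).continuous.aestronglyMeasurable)
      (fun k => (hψ k).continuous.aestronglyMeasurable) hg2.1 hh2.1 a3 b3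

theorem trace_sub (hΩ : IsBoundedLipschitzDomain Ω) (hw : MemH1 Ω w) (hz : MemH1 Ω z) :
    trace Ω (fun x => w x - z x) =ᵐ[surfaceMeasure Ω] fun x => trace Ω w x - trace Ω z x :=
  ((hw.sub hz).isTrace_trace hΩ).ae_eq hΩ ((hw.isTrace_trace hΩ).sub hΩ (hz.isTrace_trace hΩ))

theorem tendsto_integral_mul {α : Type*} [MeasurableSpace α] {μ : Measure α} {f g : ℕ → α → ℝ}
    {f₀ g₀ : α → ℝ} (hf : ∀ k, MemLp (f k) 2 μ) (hg : ∀ k, MemLp (g k) 2 μ) (hf₀ : MemLp f₀ 2 μ)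
    (hg₀ : MemLp g₀ 2 μ) (h1 : Tendsto (fun k => eLpNorm (f k - f₀) 2 μ) atTop (𝓝 0))
    (h2 : Tendsto (fun k => eLpNorm (g k - g₀) 2 μ) atTop (𝓝 0)) :
    Tendsto (fun k => ∫ x, f k x * g k x ∂μ) atTop (𝓝 (∫ x, f₀ x * g₀ x ∂μ)) := by
  have t1 : Tendsto (fun k => (hf k).toLp) atTop (𝓝 hf₀.toLp) :=
    (Lp.tendsto_Lp_iff_tendsto_eLpNorm'' _ hf _ hf₀).2 h1
  have t2 : Tendsto (fun k => (hg k).toLp) atTop (𝓝 hg₀.toLp) :=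
    (Lp.tendsto_Lp_iff_tendsto_eLpNorm'' _ hg _ hg₀).2 h2
  have key : ∀ {p q : α → ℝ} (hp : MemLp p 2 μ) (hq : MemLp q 2 μ),
      inner ℝ hp.toLp hq.toLp = ∫ x, p x * q x ∂μ := by
    intro p q hp hq
    rw [L2.inner_def]
    refine integral_congr_ae ?_
    filter_upwards [hp.coeFn_toLp, hq.coeFn_toLp] with x h1 h2
    rw [h1, h2]
    simp [mul_comm]
  have := t1.inner (𝕜 := ℝ) t2
  simpa only [key] using this

theorem inner_basisVec (x : E d) (j : Fin d) : inner ℝ (basisVec j) x = x j := by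
  simp [basisVec, EuclideanSpace.inner_single_left]

theorem MemLp.mul_outerNormal (hΩ : IsBoundedLipschitzDomain Ω)
    (hg : MemLp g 2 (surfaceMeasure Ω)) (j : Fin d) :
    MemLp (fun x => g x * outerNormal Ω x j) 2 (surfaceMeasure Ω) := by
  have hm : AEStronglyMeasurable (fun x => outerNormal Ω x j) (surfaceMeasure Ω) := by
    simp only [← inner_basisVec]
    exact aestronglyMeasurable_const.inner (aestronglyMeasurable_outerNormal hΩ)
  refine hg.of_le (hg.1.mul hm) ?_
  filter_upwards [ae_norm_outerNormal hΩ] with x hx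
  rw [norm_mul]
  refine mul_le_of_le_one_right (norm_nonneg _) ?_
  exact (PiLp.norm_apply_le _ j).trans hx.le

/-- Green's formula for functions in `H¹(Ω)`. -/
theorem IsTrace.green (hΩ : IsBoundedLipschitzDomain Ω) (hg : IsTrace Ω w g) (hh : IsTrace Ω z h)
    (j : Fin d) :
    (∫ x in Ω, w x * weakPartial Ω j z x) + ∫ x in Ω, z x * weakPartial Ω j w x =
      ∫ x, g x * (h x * outerNormal Ω x j) ∂(surfaceMeasure Ω) := by
  obtain ⟨hw, hg2, φ, hφ, a1, a2, a3⟩ := hg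
  obtain ⟨hz, hh2, ψ, hψ, b1, b2, b3⟩ := hh
  have mφ := fun k => Continuous.memLp_restrict hΩ (hφ k).continuous 2
  have mψ := fun k => Continuous.memLp_restrict hΩ (hψ k).continuous 2
  have mdφ := fun k => Continuous.memLp_restrict hΩ (continuous_classicalPartial (j := j) (hφ k)) 2
  have mdψ := fun k => Continuous.memLp_restrict hΩ (continuous_classicalPartial (j := j) (hψ k)) 2
  have sφ := fun k => Continuous.memLp_surfaceMeasure hΩ (hφ k).continuous 2
  have sψ := fun k => Continuous.memLp_surfaceMeasure hΩ (hψ k).continuous 2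
  have t1 := tendsto_integral_mul mφ mdψ hw.1 (hz.memL2_weakPartial j) a1 (b2 j)
  have t2 := tendsto_integral_mul mψ mdφ hz.1 (hw.memL2_weakPartial j) b1 (a2 j)
  have b3' : Tendsto (fun k => eLpNorm ((fun x => ψ k x * outerNormal Ω x j) -
      fun x => h x * outerNormal Ω x j) 2 (surfaceMeasure Ω)) atTop (𝓝 0) := by
    refine tendsto_of_tendsto_of_tendsto_of_le_of_le tendsto_const_nhds b3
      (fun _ => zero_le) fun k => eLpNorm_mono_ae ?_
    filter_upwards [ae_norm_outerNormal hΩ] with x hx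
    simp only [Pi.sub_apply]
    rw [← sub_mul, norm_mul]
    exact mul_le_of_le_one_right (norm_nonneg _) ((PiLp.norm_apply_le _ j).trans hx.le)
  have t3 := tendsto_integral_mul sφ (fun k => MemLp.mul_outerNormal hΩ (sψ k) j) hg2
    (MemLp.mul_outerNormal hΩ hh2 j) a3 b3'
  -- Both sides are limits of the two sides of the divergence theorem for the smooth products φ_k
  -- ψ_k.
  refine tendsto_nhds_unique (t1.add t2) (t3.congr fun k => ?_)
  have hdiv := integral_fderiv_eq_boundary hΩ (((hφ k).mul (hψ k)).of_le (by simp)) (basisVec j)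
  rw [← integral_add (MemL2.integrable_mul (mφ k) (mdψ k)) (MemL2.integrable_mul (mψ k) (mdφ k))]
  calc _ = _ := integral_congr_ae (ae_of_all _ fun x => by
        simp only [inner_basisVec]; ring)
    _ = _ := hdiv.symm
    _ = _ := integral_congr_ae (ae_of_all _ fun x => classicalPartial_mul (hφ k) (hψ k) x)

end Trace

/-! ### Finite element functions belong to H¹(Ω). -/

section FiniteElements

/-- A continuous function which is Lipschitz on each set of a finite closed cover is Lipschitz. -/
theorem lipschitzWith_of_finite_closed_cover {ι X : Type*} [Finite ι] [NormedAddCommGroup X]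
    [NormedSpace ℝ X] {C : ι → Set X} (hC : ∀ i, IsClosed (C i)) (hcov : ∀ x, ∃ i, x ∈ C i)
    {F : X → ℝ} (hF : Continuous F) {K : ℝ≥0} (hK : ∀ i, LipschitzOnWith K F (C i)) :
    LipschitzWith K F := by
  refine LipschitzWith.of_le_add_mul K fun b a => ?_
  rw [dist_eq_norm]
  set γ : ℝ → X := fun t => a + t • (b - a)
  have hγ : Continuous γ := by fun_prop
  have hγd : ∀ s t, ‖γ t - γ s‖ = |t - s| * ‖b - a‖ := fun s t => by
    rw [← Real.norm_eq_abs, ← norm_smul, sub_smul]; simp [γ]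
  -- Mean value inequality along the segment from a to b: it suffices to bound right slopes of F ∘ γ
  -- by any r > K‖b - a‖.
  have h := image_le_of_liminf_slope_right_le_deriv_boundary (f := fun t => F (γ t)) (a := 0)
    (b := 1) (B := fun t => F a + K * ‖b - a‖ * t) (B' := fun _ => K * ‖b - a‖)
    (hF.comp hγ).continuousOn (by simp [γ]) (by fun_prop)
    (fun x _ => by
      simpa using (((hasDerivAt_id x).const_mul (K * ‖b - a‖)).const_add (F a)).hasDerivWithinAt)
    (fun x _ r hr => ?_) (right_mem_Icc.2 zero_le_one)
  · simpa [γ] using h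
  -- A piece containing γ x gives the slope bound for every z with γ z in it. A piece not containing
  -- γ x is closed, so it is avoided for z near x. There are finitely many pieces, and γ z always
  -- lies in one of them.
  · have hev : ∀ i, ∀ᶠ z in 𝓝[>] x, γ z ∈ C i → slope (fun t => F (γ t)) x z < r := by
      intro i
      by_cases hx : γ x ∈ C i
      · filter_upwards [self_mem_nhdsWithin] with z (hz : x < z) hzi
        have hz' : 0 < z - x := sub_pos.2 hz
        have h1 := (hK i).dist_le_mul _ hzi _ hx
        rw [Real.dist_eq, dist_eq_norm, hγd, abs_of_pos hz'] at h1
        refine lt_of_le_of_lt ?_ hr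
        rw [slope_def_field, div_le_iff₀ hz']
        calc _ ≤ _ := (le_abs_self _).trans h1
          _ = _ := by ring
      · have : ∀ᶠ z in 𝓝 x, γ z ∉ C i :=
          hγ.continuousAt.eventually ((hC i).isOpen_compl.mem_nhds hx)
        filter_upwards [nhdsWithin_le_nhds this] with z hz hzi using absurd hzi hz
    refine Eventually.frequently ?_
    filter_upwards [eventually_all.2 hev] with z hz
    obtain ⟨i, hi⟩ := hcov (γ z)
    exact hz i hi

variable {d : ℕ} {Ω : Set (E d)} {𝒯 : Mesh d} {v : E d → ℝ}

theorem isCompact_hull (T : Finset (E d)) : IsCompact (hull T) :=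
  T.finite_toSet.isCompact_convexHull ℝ

theorem Mesh.isCompact_fictitiousDomain : IsCompact 𝒯.fictitiousDomain :=
  𝒯.elems.isCompact_biUnion fun T _ => isCompact_hull T

theorem contDiff_affineMap (L : E d →ᵃ[ℝ] ℝ) : ContDiff ℝ ∞ L := by
  rw [L.decomp]
  exact (LinearMap.toContinuousLinearMap L.linear).contDiff.add contDiff_const

theorem lineDeriv_affineMap (L : E d →ᵃ[ℝ] ℝ) (x e : E d) :
    lineDeriv ℝ L x e = L.linear e := by
  have h : ∀ t : ℝ, L (x + t • e) = L x + t * L.linear e := fun t => by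
    rw [add_comm x, ← vadd_eq_add, L.map_vadd, map_smul]
    simp [add_comm]
  rw [lineDeriv]
  simp only [h]
  simp

/-- A cut-off finite element function is Lipschitz. -/
theorem Mesh.MemV.exists_lipschitzWith_mul (hv : 𝒯.MemV v) {χ : E d → ℝ} (hχ : ContDiff ℝ ∞ χ)
    (hc : HasCompactSupport χ) (hs : ∀ x, χ x ≠ 0 → x ∈ 𝒯.fictitiousDomain) :
    ∃ K, LipschitzWith K fun x => χ x * v x := by
  choose L hL using fun T : 𝒯.elems => hv.2 T.1 T.2
  have hlip : ∀ T, ∃ K, LipschitzWith K fun x => χ x * L T x := fun T =>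
    (hχ.mul (contDiff_affineMap (L T))).lipschitzWith_of_hasCompactSupport hc.mul_right (by simp)
  choose K hK using hlip
  -- Outside Ω* nothing is known about v. The additional closed set {χ = 0} covers that region, and
  -- χ v vanishes on it.
  let C : Option 𝒯.elems → Set (E d) := fun i => i.elim {x | χ x = 0} fun T => hull T.1
  have hC : ∀ i, IsClosed (C i) := by
    rintro (_ | T)
    · exact isClosed_eq hχ.continuous continuous_const
    · exact (isCompact_hull _).isClosed
  have hcov : ∀ x, ∃ i, x ∈ C i := by
    intro x
    by_cases hx : χ x = 0
    · exact ⟨none, hx⟩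
    · obtain ⟨T, hT, hxT⟩ := mem_iUnion₂.1 (hs x hx)
      exact ⟨some ⟨T, hT⟩, hxT⟩
  have hcont : Continuous fun x => χ x * v x := by
    refine (locallyFinite_of_finite C).continuous (iUnion_eq_univ_iff.2 hcov) hC ?_
    rintro (_ | T)
    · exact (continuousOn_const (c := (0 : ℝ))).congr fun x (hx : χ x = 0) => by simp [hx]
    · exact (hK T).continuous.continuousOn.congr fun x hx => by rw [hL T hx]
  refine ⟨∑ T, K T, lipschitzWith_of_finite_closed_cover hC hcov hcont ?_⟩
  rintro (_ | T)
  · intro x hx y hy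
    have hx' : χ x = 0 := hx
    have hy' : χ y = 0 := hy
    simp [hx', hy']
  · have h1 : LipschitzOnWith (∑ T, K T) (fun x => χ x * L T x) (hull T.1) :=
      ((hK T).weaken (Finset.single_le_sum (f := K) (fun _ _ => zero_le) (Finset.mem_univ T))).lipschitzOnWith
    intro x hx y hy
    have := h1 hx hy
    simp only at this ⊢
    rwa [hL T hx, hL T hy]

/-- The cutoff equals 1 on a neighbourhood of each point of k, so that multiplying by it changes no
derivative there. -/
theorem exists_cutoff (hΩ : IsOpen Ω) {k : Set (E d)} (hk : IsCompact k) (hkΩ : k ⊆ Ω) :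
    ∃ χ : E d → ℝ, ContDiff ℝ ∞ χ ∧ HasCompactSupport χ ∧ tsupport χ ⊆ Ω ∧
      ∀ x ∈ k, ∀ᶠ y in 𝓝 x, χ y = 1 := by
  obtain ⟨δ, hδ, hsub⟩ := hk.exists_cthickening_subset_open hΩ hkΩ
  obtain ⟨f, h1, h2, -⟩ := exists_contMDiffMap_one_nhds_of_subset_interior (n := ⊤)
    (modelWithCornersSelf ℝ (E d)) hk.isClosed (t := Metric.cthickening δ k)
    ((Metric.self_subset_thickening hδ k).trans (Metric.thickening_subset_interior_cthickening δ k))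
  have hts : tsupport f ⊆ Metric.cthickening δ k :=
    closure_minimal (fun x hx => by_contra fun h => hx (h2 x h)) Metric.isClosed_cthickening
  exact ⟨f, f.contMDiff.contDiff, hk.cthickening.of_isClosed_subset (isClosed_tsupport _) hts,
    hts.trans hsub, fun x hx => (eventually_nhdsSet_iff_forall.1 h1) x hx⟩

/-- Finite element functions belong to `H¹(Ω)`. -/
theorem Mesh.MemV.memH1 (hΩ : IsBoundedLipschitzDomain Ω) (hcov : Ω ⊆ 𝒯.fictitiousDomain)
    (hv : 𝒯.MemV v) : MemH1 Ω v := by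
  have hΩo := hΩ.isOpen
  have hfin := hΩ.isFiniteMeasure
  -- The values of v outside Ω* are arbitrary. A continuous extension v' from the compact set Ω*
  -- makes the line derivative measurable, and that line derivative is the weak derivative.
  obtain ⟨v', hv'⟩ := ContinuousMap.exists_restrict_eq
    (Mesh.isCompact_fictitiousDomain (𝒯 := 𝒯)).isClosed ⟨_, hv.1.domRestrict⟩
  have hvv' : ∀ x ∈ 𝒯.fictitiousDomain, v' x = v x := fun x hx => by
    have := congrArg (fun f => f ⟨x, hx⟩) hv'
    simpa using this
  have hv2 : MemL2 Ω v := by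
    refine (memLp_congr_ae ?_).1 (Continuous.memLp_restrict hΩ v'.continuous 2)
    exact (ae_restrict_mem hΩo.measurableSet).mono fun x hx => hvv' x (hcov hx)
  refine ⟨hv2, fun j => ⟨fun x => lineDeriv ℝ v' x (basisVec j), ?_, fun φ h1 h2 h3 => ?_⟩⟩
  · choose L hL using fun T : 𝒯.elems => hv.2 T.1 T.2
    refine MemLp.of_bound (measurable_lineDeriv v'.continuous).aestronglyMeasurable
      (∑ T, |(L T).linear (basisVec j)|) ?_
    -- Frontiers of convex sets are null, so almost every point of Ω is interior to a simplex. There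
    -- v' is affine and its line derivative is one of finitely many constants.
    have hfr : ∀ᵐ x ∂(volume : Measure (E d)), ∀ T : 𝒯.elems, x ∉ frontier (hull T.1) := by
      refine ae_all_iff.2 fun T => ?_
      have := (convex_convexHull ℝ (T.1 : Set (E d))).addHaar_frontier volume
      exact measure_eq_zero_iff_ae_notMem.1 this
    filter_upwards [ae_restrict_mem hΩo.measurableSet, ae_restrict_of_ae hfr] with x hx hxf
    obtain ⟨T, hT, hxT⟩ := mem_iUnion₂.1 (hcov hx)
    have hint : x ∈ interior (hull T) := by
      by_contra hn
      refine hxf ⟨T, hT⟩ ?_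
      rw [(isCompact_hull T).isClosed.frontier_eq]
      exact ⟨hxT, hn⟩
    have heq : (v' : E d → ℝ) =ᶠ[𝓝 x] L ⟨T, hT⟩ := by
      filter_upwards [mem_interior_iff_mem_nhds.1 hint] with y hy
      rw [hvv' y (mem_iUnion₂.2 ⟨T, hT, hy⟩)]
      exact hL ⟨T, hT⟩ hy
    rw [heq.lineDeriv_eq, lineDeriv_affineMap]
    exact Finset.single_le_sum (f := fun T => |(L T).linear (basisVec j)|)
      (fun _ _ => abs_nonneg _) (Finset.mem_univ (⟨T, hT⟩ : 𝒯.elems))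
  -- Integration by parts is available for globally Lipschitz functions. The product χ v is one, and
  -- it agrees with v near the support of φ.
  · obtain ⟨χ, hχ, hχc, hχs, hχ1⟩ := exists_cutoff hΩo h2 h3
    obtain ⟨K, hK⟩ := hv.exists_lipschitzWith_mul hχ hχc fun x hx =>
      hcov (hχs (subset_tsupport _ hx))
    obtain ⟨K', hK'⟩ := h1.lipschitzWith_of_hasCompactSupport h2 (by simp)
    have hid := hK.integral_lineDeriv_mul_eq (μ := volume) hK' h2 (basisVec j)
    have hd : ∀ x, lineDeriv ℝ φ x (-basisVec j) = -classicalPartial j φ x := fun x => by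
      rw [(h1.differentiable (by simp) x).lineDeriv_eq_fderiv, map_neg]; rfl
    have e1 : ∫ x in Ω, v x * classicalPartial j φ x =
        -∫ x, lineDeriv ℝ φ x (-basisVec j) * (χ x * v x) := by
      rw [← integral_neg, ← integral_indicator hΩo.measurableSet]
      refine integral_congr_ae (ae_of_all _ fun x => ?_)
      by_cases hx : x ∈ tsupport φ
      · rw [indicator_of_mem (h3 hx)]
        simp only [hd, (hχ1 x hx).self_of_nhds]
        ring
      · have : classicalPartial j φ x = 0 := by
          rw [classicalPartial, fderiv_of_notMem_tsupport ℝ hx]; rfl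
        simp only [hd, indicator, this]
        simp
    have e2 : ∫ x in Ω, lineDeriv ℝ v' x (basisVec j) * φ x =
        ∫ x, lineDeriv ℝ (fun x => χ x * v x) x (basisVec j) * φ x := by
      rw [← integral_indicator hΩo.measurableSet]
      refine integral_congr_ae (ae_of_all _ fun x => ?_)
      by_cases hx : x ∈ tsupport φ
      · rw [indicator_of_mem (h3 hx)]
        have : (v' : E d → ℝ) =ᶠ[𝓝 x] fun x => χ x * v x := by
          filter_upwards [hχ1 x hx, hΩo.mem_nhds (h3 hx)] with y hy hyΩ
          rw [hy, one_mul, hvv' y (hcov hyΩ)]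
        rw [this.lineDeriv_eq]
      · simp [indicator, image_eq_zero_of_notMem_tsupport hx]
    rw [e1, e2, hid]

end FiniteElements

/-! ### Linearity of the forms. -/

section Forms

variable {d : ℕ} {Ω : Set (E d)} {σ σ' τ : E d → Matrix (Fin d) (Fin d) ℝ} {v v' w f : E d → E d}
  {p p' q : E d → ℝ}

theorem memL2_strain (hv : ∀ i, MemH1 Ω fun x => v x i) (i j : Fin d) :
    MemL2 Ω fun x => strain Ω v x i j := by
  have : (fun x => strain Ω v x i j) = fun x => (1 / 2 : ℝ) *
      (weakPartial Ω j (fun y => v y i) x + weakPartial Ω i (fun y => v y j) x) := by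
    ext x
    simp only [strain]
    ring
  rw [this]
  exact (((hv i).memL2_weakPartial j).add ((hv j).memL2_weakPartial i)).const_mul _

theorem memL2_divergence (hv : ∀ i, MemH1 Ω fun x => v x i) : MemL2 Ω (divergence Ω v) :=
  memLp_finsetSum Finset.univ fun i _ => (hv i).memL2_weakPartial i

theorem strain_sub (hΩ : IsOpen Ω) (hv : ∀ i, MemH1 Ω fun x => v x i)
    (hv' : ∀ i, MemH1 Ω fun x => v' x i) :
    strain Ω (fun x => v x - v' x) =ᵐ[volume.restrict Ω] fun x => strain Ω v x - strain Ω v' x := by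
  have h : ∀ᵐ x ∂(volume.restrict Ω), ∀ i j, weakPartial Ω j (fun y => v y i - v' y i) x =
      weakPartial Ω j (fun y => v y i) x - weakPartial Ω j (fun y => v' y i) x :=
    ae_all_iff.2 fun i => ae_all_iff.2 fun j => (hv i).weakPartial_sub hΩ (hv' i) j
  filter_upwards [h] with x hx
  ext i j
  change (weakPartial Ω j (fun y => v y i - v' y i) x +
    weakPartial Ω i (fun y => v y j - v' y j) x) / 2 = strain Ω v x i j - strain Ω v' x i j
  simp only [strain, hx]
  ring

theorem divergence_sub (hΩ : IsOpen Ω) (hv : ∀ i, MemH1 Ω fun x => v x i)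
    (hv' : ∀ i, MemH1 Ω fun x => v' x i) :
    divergence Ω (fun x => v x - v' x) =ᵐ[volume.restrict Ω]
      fun x => divergence Ω v x - divergence Ω v' x := by
  have h : ∀ᵐ x ∂(volume.restrict Ω), ∀ i, weakPartial Ω i (fun y => v y i - v' y i) x =
      weakPartial Ω i (fun y => v y i) x - weakPartial Ω i (fun y => v' y i) x :=
    ae_all_iff.2 fun i => (hv i).weakPartial_sub hΩ (hv' i) i
  filter_upwards [h] with x hx
  change ∑ i, weakPartial Ω i (fun y => v y i - v' y i) x = _
  simp only [divergence, hx, Finset.sum_sub_distrib]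

theorem vectorTrace_sub (hΩ : IsBoundedLipschitzDomain Ω) (hv : ∀ i, MemH1 Ω fun x => v x i)
    (hv' : ∀ i, MemH1 Ω fun x => v' x i) :
    vectorTrace Ω (fun x => v x - v' x) =ᵐ[surfaceMeasure Ω]
      fun x => vectorTrace Ω v x - vectorTrace Ω v' x := by
  have h : ∀ᵐ x ∂(surfaceMeasure Ω), ∀ i, trace Ω (fun y => v y i - v' y i) x =
      trace Ω (fun y => v y i) x - trace Ω (fun y => v' y i) x :=
    ae_all_iff.2 fun i => trace_sub hΩ (hv i) (hv' i)
  filter_upwards [h] with x hx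
  ext i
  exact hx i

theorem MemH1.memLp_trace (hΩ : IsBoundedLipschitzDomain Ω) (hp : MemH1 Ω p) :
    MemLp (trace Ω p) 2 (surfaceMeasure Ω) :=
  (hp.isTrace_trace hΩ).2.1

theorem memLp_vectorTrace (hΩ : IsBoundedLipschitzDomain Ω) (hv : ∀ i, MemH1 Ω fun x => v x i)
    (i : Fin d) : MemLp (fun x => vectorTrace Ω v x i) 2 (surfaceMeasure Ω) :=
  (hv i).memLp_trace hΩ

theorem integrable_tensor (hσ : ∀ i j, MemL2 Ω fun x => σ x i j)
    (hτ : ∀ i j, MemL2 Ω fun x => τ x i j) :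
    Integrable (fun x => ∑ i, ∑ j, σ x i j * τ x i j) (volume.restrict Ω) :=
  integrable_finsetSum _ fun i _ => integrable_finsetSum _ fun j _ => (hσ i j).integrable_mul (hτ i j)

theorem integrable_stressFlux (hΩ : IsBoundedLipschitzDomain Ω)
    (hσ : ∀ i j, MemH1 Ω fun x => σ x i j)
    (hv : ∀ i, MemLp (fun x => v x i) 2 (surfaceMeasure Ω)) :
    Integrable (fun x => ∑ i, ∑ j, trace Ω (fun y => σ y i j) x * outerNormal Ω x j * v x i)
      (surfaceMeasure Ω) :=
  integrable_finsetSum _ fun i _ => integrable_finsetSum _ fun j _ =>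
    (MemLp.mul_outerNormal hΩ ((hσ i j).memLp_trace hΩ) j).integrable_mul (hv i)

theorem integrable_pressureFlux (hΩ : IsBoundedLipschitzDomain Ω) (hp : MemH1 Ω p)
    (hv : ∀ i, MemLp (fun x => v x i) 2 (surfaceMeasure Ω)) :
    Integrable (fun x => ∑ i, trace Ω p x * outerNormal Ω x i * v x i) (surfaceMeasure Ω) :=
  integrable_finsetSum _ fun i _ =>
    (MemLp.mul_outerNormal hΩ (hp.memLp_trace hΩ) i).integrable_mul (hv i)

theorem tensorInner_comm : tensorInner Ω σ τ = tensorInner Ω τ σ := by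
  simp only [tensorInner, mul_comm]

theorem scalarInner_comm : scalarInner Ω p q = scalarInner Ω q p := by
  simp only [scalarInner, mul_comm]

theorem tensorInner_sub_left (hσ : ∀ i j, MemL2 Ω fun x => σ x i j)
    (hσ' : ∀ i j, MemL2 Ω fun x => σ' x i j) (hτ : ∀ i j, MemL2 Ω fun x => τ x i j) :
    tensorInner Ω (fun x => σ x - σ' x) τ = tensorInner Ω σ τ - tensorInner Ω σ' τ := by
  simp only [tensorInner]
  rw [← integral_sub (integrable_tensor hσ hτ) (integrable_tensor hσ' hτ)]
  simp only [Matrix.sub_apply, sub_mul, Finset.sum_sub_distrib]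

theorem tensorInner_strain_sub (hΩ : IsOpen Ω) (hτ : ∀ i j, MemL2 Ω fun x => τ x i j)
    (hv : ∀ i, MemH1 Ω fun x => v x i) (hv' : ∀ i, MemH1 Ω fun x => v' x i) :
    tensorInner Ω τ (strain Ω fun x => v x - v' x) =
      tensorInner Ω τ (strain Ω v) - tensorInner Ω τ (strain Ω v') := by
  rw [tensorInner_comm (τ := strain Ω v), tensorInner_comm (τ := strain Ω v'),
    ← tensorInner_sub_left (memL2_strain hv) (memL2_strain hv') hτ, tensorInner_comm]
  refine integral_congr_ae ?_
  filter_upwards [strain_sub hΩ hv hv'] with x hx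
  rw [hx]

theorem scalarInner_sub_left (hp : MemL2 Ω p) (hp' : MemL2 Ω p') (hq : MemL2 Ω q) :
    scalarInner Ω (fun x => p x - p' x) q = scalarInner Ω p q - scalarInner Ω p' q := by
  simp only [scalarInner]
  rw [← integral_sub (hp.integrable_mul hq) (hp'.integrable_mul hq)]
  simp only [sub_mul]

theorem scalarInner_divergence_sub (hΩ : IsOpen Ω) (hq : MemL2 Ω q)
    (hv : ∀ i, MemH1 Ω fun x => v x i) (hv' : ∀ i, MemH1 Ω fun x => v' x i) :
    scalarInner Ω q (divergence Ω fun x => v x - v' x) =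
      scalarInner Ω q (divergence Ω v) - scalarInner Ω q (divergence Ω v') := by
  rw [scalarInner_comm (q := divergence Ω v), scalarInner_comm (q := divergence Ω v'),
    ← scalarInner_sub_left (memL2_divergence hv) (memL2_divergence hv') hq, scalarInner_comm]
  refine integral_congr_ae ?_
  filter_upwards [divergence_sub hΩ hv hv'] with x hx
  rw [hx]

theorem stressFlux_congr (h : v =ᵐ[surfaceMeasure Ω] v') : stressFlux Ω σ v = stressFlux Ω σ v' := by
  refine integral_congr_ae ?_
  filter_upwards [h] with x hx
  rw [hx]

theorem pressureFlux_congr (h : v =ᵐ[surfaceMeasure Ω] v') :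
    pressureFlux Ω p v = pressureFlux Ω p v' := by
  refine integral_congr_ae ?_
  filter_upwards [h] with x hx
  rw [hx]

theorem boundaryInner_congr_left (h : v =ᵐ[surfaceMeasure Ω] v') :
    boundaryInner Ω v w = boundaryInner Ω v' w := by
  refine integral_congr_ae ?_
  filter_upwards [h] with x hx
  rw [hx]

theorem stressFlux_sub_left (hΩ : IsBoundedLipschitzDomain Ω)
    (hσ : ∀ i j, MemH1 Ω fun x => σ x i j) (hσ' : ∀ i j, MemH1 Ω fun x => σ' x i j)
    (hv : ∀ i, MemLp (fun x => v x i) 2 (surfaceMeasure Ω)) :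
    stressFlux Ω (fun x => σ x - σ' x) v = stressFlux Ω σ v - stressFlux Ω σ' v := by
  simp only [stressFlux]
  rw [← integral_sub (integrable_stressFlux hΩ hσ hv) (integrable_stressFlux hΩ hσ' hv)]
  refine integral_congr_ae ?_
  have h : ∀ᵐ x ∂(surfaceMeasure Ω), ∀ i j, trace Ω (fun y => σ y i j - σ' y i j) x =
      trace Ω (fun y => σ y i j) x - trace Ω (fun y => σ' y i j) x :=
    ae_all_iff.2 fun i => ae_all_iff.2 fun j => trace_sub hΩ (hσ i j) (hσ' i j)
  filter_upwards [h] with x hx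
  simp only [Matrix.sub_apply, hx, sub_mul, Finset.sum_sub_distrib]

theorem stressFlux_sub_right (hΩ : IsBoundedLipschitzDomain Ω)
    (hσ : ∀ i j, MemH1 Ω fun x => σ x i j)
    (hv : ∀ i, MemLp (fun x => v x i) 2 (surfaceMeasure Ω))
    (hv' : ∀ i, MemLp (fun x => v' x i) 2 (surfaceMeasure Ω)) :
    stressFlux Ω σ (fun x => v x - v' x) = stressFlux Ω σ v - stressFlux Ω σ v' := by
  simp only [stressFlux]
  rw [← integral_sub (integrable_stressFlux hΩ hσ hv) (integrable_stressFlux hΩ hσ hv')]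
  simp only [PiLp.sub_apply, mul_sub, Finset.sum_sub_distrib]

theorem pressureFlux_sub_left (hΩ : IsBoundedLipschitzDomain Ω) (hp : MemH1 Ω p)
    (hp' : MemH1 Ω p') (hv : ∀ i, MemLp (fun x => v x i) 2 (surfaceMeasure Ω)) :
    pressureFlux Ω (fun x => p x - p' x) v = pressureFlux Ω p v - pressureFlux Ω p' v := by
  simp only [pressureFlux]
  rw [← integral_sub (integrable_pressureFlux hΩ hp hv) (integrable_pressureFlux hΩ hp' hv)]
  refine integral_congr_ae ?_
  filter_upwards [trace_sub hΩ hp hp'] with x hx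
  simp only [hx, sub_mul, Finset.sum_sub_distrib]

theorem pressureFlux_sub_right (hΩ : IsBoundedLipschitzDomain Ω) (hp : MemH1 Ω p)
    (hv : ∀ i, MemLp (fun x => v x i) 2 (surfaceMeasure Ω))
    (hv' : ∀ i, MemLp (fun x => v' x i) 2 (surfaceMeasure Ω)) :
    pressureFlux Ω p (fun x => v x - v' x) = pressureFlux Ω p v - pressureFlux Ω p v' := by
  simp only [pressureFlux]
  rw [← integral_sub (integrable_pressureFlux hΩ hp hv) (integrable_pressureFlux hΩ hp hv')]
  simp only [PiLp.sub_apply, mul_sub, Finset.sum_sub_distrib]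

theorem boundaryInner_sub_left (hv : ∀ i, MemLp (fun x => v x i) 2 (surfaceMeasure Ω))
    (hv' : ∀ i, MemLp (fun x => v' x i) 2 (surfaceMeasure Ω))
    (hw : ∀ i, MemLp (fun x => w x i) 2 (surfaceMeasure Ω)) :
    boundaryInner Ω (fun x => v x - v' x) w = boundaryInner Ω v w - boundaryInner Ω v' w := by
  have key : ∀ {z : E d → E d}, (∀ i, MemLp (fun x => z x i) 2 (surfaceMeasure Ω)) →
      Integrable (fun x => ∑ i, z x i * w x i) (surfaceMeasure Ω) := fun hz =>
    integrable_finsetSum _ fun i _ => (hz i).integrable_mul (hw i)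
  simp only [boundaryInner]
  rw [← integral_sub (key hv) (key hv')]
  simp only [PiLp.sub_apply, sub_mul, Finset.sum_sub_distrib]

/-- All components are in `H¹(Ω)`. -/
structure Fields.MemH1 (Ω : Set (E d)) (U : Fields d) : Prop where
  σ : ∀ i j, ThreeFieldStokes.MemH1 Ω fun x => U.σ x i j
  u : ∀ i, ThreeFieldStokes.MemH1 Ω fun x => U.u x i
  p : ThreeFieldStokes.MemH1 Ω U.p

theorem Mesh.MemVV.memH1 {𝒯 : Mesh d} {V : Fields d} (hΩ : IsBoundedLipschitzDomain Ω)
    (hcov : Ω ⊆ 𝒯.fictitiousDomain) (hV : 𝒯.MemVV V) : V.MemH1 Ω :=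
  ⟨fun i j => (hV.1 i j).memH1 hΩ hcov, fun i => (hV.2.1 i).memH1 hΩ hcov, hV.2.2.memH1 hΩ hcov⟩

/-- Strain, divergence and trace are built from chosen representatives, so each is linear only
almost everywhere and for H¹ arguments. Integrability of every product then allows the integrals to
be split. -/
theorem AForm_sub_left (hΩ : IsBoundedLipschitzDomain Ω) {P : Params} {h : ℝ} {U U' V : Fields d}
    (hU : U.MemH1 Ω) (hU' : U'.MemH1 Ω) (hV : V.MemH1 Ω) :
    AForm Ω P h (U - U') V = AForm Ω P h U V - AForm Ω P h U' V := by
  have hΩo := hΩ.isOpen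
  have tU := memLp_vectorTrace hΩ hU.u
  have tU' := memLp_vectorTrace hΩ hU'.u
  have tV := memLp_vectorTrace hΩ hV.u
  have hs : vectorTrace Ω (U - U').u =ᵐ[surfaceMeasure Ω]
    fun x => vectorTrace Ω U.u x - vectorTrace Ω U'.u x := vectorTrace_sub hΩ hU.u hU'.u
  have e1 : ∀ {τ}, (∀ i j, MemL2 Ω fun x => τ x i j) → tensorInner Ω (U - U').σ τ =
      tensorInner Ω U.σ τ - tensorInner Ω U'.σ τ := fun hτ =>
    tensorInner_sub_left (fun i j => (hU.σ i j).1) (fun i j => (hU'.σ i j).1) hτ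
  have e2 : boundaryInner Ω (vectorTrace Ω (U - U').u) (vectorTrace Ω V.u) =
      boundaryInner Ω (vectorTrace Ω U.u) (vectorTrace Ω V.u) -
        boundaryInner Ω (vectorTrace Ω U'.u) (vectorTrace Ω V.u) :=
    (boundaryInner_congr_left hs).trans (boundaryInner_sub_left tU tU' tV)
  have e3 : stressFlux Ω (U - U').σ (vectorTrace Ω V.u) = _ :=
    stressFlux_sub_left hΩ hU.σ hU'.σ tV
  have e4 : tensorInner Ω V.σ (strain Ω (U - U').u) = _ :=
    tensorInner_strain_sub hΩo (fun i j => (hV.σ i j).1) hU.u hU'.u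
  have e5 : stressFlux Ω V.σ (vectorTrace Ω (U - U').u) = _ :=
    (stressFlux_congr hs).trans (stressFlux_sub_right hΩ hV.σ tU tU')
  have e6 : scalarInner Ω (U - U').p (divergence Ω V.u) = _ :=
    scalarInner_sub_left hU.p.1 hU'.p.1 (memL2_divergence hV.u)
  have e7 : pressureFlux Ω (U - U').p (vectorTrace Ω V.u) = _ :=
    pressureFlux_sub_left hΩ hU.p hU'.p tV
  have e8 : scalarInner Ω V.p (divergence Ω (U - U').u) = _ :=
    scalarInner_divergence_sub hΩo hV.p.1 hU.u hU'.u
  have e9 : pressureFlux Ω V.p (vectorTrace Ω (U - U').u) = _ :=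
    (pressureFlux_congr hs).trans (pressureFlux_sub_right hΩ hV.p tU tU')
  simp only [AForm, aForm, bForm, e1 fun i j => (hV.σ i j).1, e1 (memL2_strain hV.u), e2, e3, e4,
    e5, e6, e7, e8, e9]
  ring

end Forms

/-! ### Strong form of the equations and consistency of the method. -/

section Consistency

variable {d : ℕ} {Ω : Set (E d)} {σ : E d → Matrix (Fin d) (Fin d) ℝ} {v f g : E d → E d}
  {p q φ : E d → ℝ} {U : Fields d} {η : ℝ}

/-- The trace of a smooth function is given by its boundary values. -/
theorem isTrace_of_contDiff (hΩ : IsBoundedLipschitzDomain Ω) (hφ : ContDiff ℝ ∞ φ) {h : E d → ℝ}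
    (hh : φ =ᵐ[surfaceMeasure Ω] h) : IsTrace Ω φ h := by
  refine ⟨ContDiff.memH1 hΩ hφ, (Continuous.memLp_surfaceMeasure hΩ hφ.continuous 2).ae_eq hh,
    fun _ => φ, fun _ => hφ, ?_, fun j => ?_, ?_⟩
  · simp
  · have : classicalPartial j φ - weakPartial Ω j φ =ᵐ[volume.restrict Ω] 0 := by
      filter_upwards [ContDiff.weakPartial_eq hΩ hφ (j := j)] with x hx
      simp [hx]
    simp [eLpNorm_congr_ae this]
  · have : φ - h =ᵐ[surfaceMeasure Ω] 0 := by
      filter_upwards [hh] with x hx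
      simp [hx]
    simp [eLpNorm_congr_ae this]

/-- A symmetric tensor is orthogonal to the antisymmetric part of the gradient, so the strain may be
replaced by the full gradient, to which Green's formula applies componentwise. -/
theorem tensorInner_strain_eq (hσ : ∀ i j, MemL2 Ω fun x => σ x i j)
    (hsymm : ∀ᵐ x ∂(volume.restrict Ω), ∀ i j, σ x i j = σ x j i)
    (hv : ∀ i, MemH1 Ω fun x => v x i) :
    tensorInner Ω σ (strain Ω v) =
      ∑ i, ∑ j, ∫ x in Ω, σ x i j * weakPartial Ω j (fun y => v y i) x := by
  have hint := fun i j => (hσ i j).integrable_mul ((hv i).memL2_weakPartial j)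
  have : ∀ i, ∑ j, ∫ x in Ω, σ x i j * weakPartial Ω j (fun y => v y i) x =
      ∫ x in Ω, ∑ j, σ x i j * weakPartial Ω j (fun y => v y i) x := fun i =>
    (integral_finsetSum _ fun j _ => hint i j).symm
  simp only [this]
  rw [← integral_finsetSum _ fun i _ => integrable_finsetSum _ fun j _ => hint i j]
  refine integral_congr_ae ?_
  filter_upwards [hsymm] with x hx
  have h1 : ∑ i, ∑ j, σ x i j * weakPartial Ω i (fun y => v y j) x =
      ∑ i, ∑ j, σ x i j * weakPartial Ω j (fun y => v y i) x := by
    rw [Finset.sum_comm]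
    exact Finset.sum_congr rfl fun i _ => Finset.sum_congr rfl fun j _ => by rw [hx j i]
  have h2 : ∀ i j, σ x i j * strain Ω v x i j =
      (σ x i j * weakPartial Ω j (fun y => v y i) x +
        σ x i j * weakPartial Ω i (fun y => v y j) x) / 2 := fun i j => by
    simp only [strain]
    ring
  simp only [h2, ← Finset.sum_div, Finset.sum_add_distrib, h1]
  ring

/-- Integration by parts in the stress and pressure terms. -/
theorem momentum_eq_sum (hΩ : IsBoundedLipschitzDomain Ω) (hσ : ∀ i j, MemH1 Ω fun x => σ x i j)
    (hsymm : ∀ᵐ x ∂(volume.restrict Ω), ∀ i j, σ x i j = σ x j i) (hp : MemH1 Ω p)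
    {t : E d → E d} (hv : ∀ i, IsTrace Ω (fun x => v x i) fun x => t x i) :
    tensorInner Ω σ (strain Ω v) - stressFlux Ω σ t - scalarInner Ω p (divergence Ω v) +
      pressureFlux Ω p t = ∑ i, ∫ x in Ω, (weakPartial Ω i p x -
        ∑ j, weakPartial Ω j (fun y => σ y i j) x) * v x i := by
  have htσ := fun i j => (hσ i j).isTrace_trace hΩ
  have htp := hp.isTrace_trace hΩ
  have hpt : scalarInner Ω p (divergence Ω v) =
      ∑ i, ∫ x in Ω, p x * weakPartial Ω i (fun y => v y i) x := by
    rw [← integral_finsetSum _ fun i _ => hp.1.integrable_mul ((hv i).1.memL2_weakPartial i)]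
    simp only [scalarInner, divergence, Finset.mul_sum]
  have iσ : ∀ i j, Integrable (fun x => trace Ω (fun y => σ y i j) x * outerNormal Ω x j * t x i)
      (surfaceMeasure Ω) := fun i j =>
    (MemLp.mul_outerNormal hΩ (htσ i j).2.1 j).integrable_mul (hv i).2.1
  have ip : ∀ i, Integrable (fun x => trace Ω p x * outerNormal Ω x i * t x i)
      (surfaceMeasure Ω) := fun i =>
    (MemLp.mul_outerNormal hΩ htp.2.1 i).integrable_mul (hv i).2.1
  have hsf : stressFlux Ω σ t = ∑ i, ∑ j, ∫ x, trace Ω (fun y => σ y i j) x *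
      (t x i * outerNormal Ω x j) ∂(surfaceMeasure Ω) := by
    simp only [stressFlux]
    rw [integral_finsetSum _ fun i _ => integrable_finsetSum _ fun j _ => iσ i j]
    refine Finset.sum_congr rfl fun i _ => ?_
    rw [integral_finsetSum _ fun j _ => iσ i j]
    exact Finset.sum_congr rfl fun j _ => integral_congr_ae (ae_of_all _ fun x => by ring)
  have hpf : pressureFlux Ω p t = ∑ i, ∫ x, trace Ω p x *
      (t x i * outerNormal Ω x i) ∂(surfaceMeasure Ω) := by
    simp only [pressureFlux]
    rw [integral_finsetSum _ fun i _ => ip i]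
    exact Finset.sum_congr rfl fun j _ => integral_congr_ae (ae_of_all _ fun x => by ring)
  have hr : ∀ i, ∫ x in Ω, (weakPartial Ω i p x -
        ∑ j, weakPartial Ω j (fun y => σ y i j) x) * v x i =
      (∫ x in Ω, v x i * weakPartial Ω i p x) -
        ∑ j, ∫ x in Ω, v x i * weakPartial Ω j (fun y => σ y i j) x := fun i => by
    have i1 := fun j => (hv i).1.1.integrable_mul ((hσ i j).memL2_weakPartial j)
    rw [← integral_finsetSum _ fun j _ => i1 j,
      ← integral_sub ((hv i).1.1.integrable_mul (hp.memL2_weakPartial i))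
        (integrable_finsetSum _ fun j _ => i1 j)]
    refine integral_congr_ae (ae_of_all _ fun x => ?_)
    simp only [← Finset.mul_sum]
    ring
  rw [tensorInner_strain_eq (fun i j => (hσ i j).1) hsymm fun i => (hv i).1, hpt, hsf, hpf]
  -- Green's formula for each pair (σ_ij, v_i) in direction j and each pair (p, v_i) in direction i.
  simp only [hr, ← fun i j => (htσ i j).green hΩ (hv i) j, ← fun i => htp.green hΩ (hv i) i,
    Finset.sum_add_distrib, Finset.sum_sub_distrib]
  ring

/-- The stress of a weak solution is symmetric. -/
theorem IsWeakSolution.stress_symm (hU : IsWeakSolution Ω η f g U) (hη : 0 < η) :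
    ∀ᵐ x ∂(volume.restrict Ω), ∀ i j, U.σ x i j = U.σ x j i := by
  have hτ : ∀ i j, MemL2 Ω fun x => U.σ x i j - U.σ x j i := fun i j =>
    (hU.stress_mem i j).sub (hU.stress_mem j i)
  -- With the test tensor σ - σᵀ the symmetric strain drops out. What is left is a positive multiple
  -- of (σ, σ - σᵀ) = ½‖σ - σᵀ‖².
  have h := hU.constitutive (fun x i j => U.σ x i j - U.σ x j i) hτ
  have h1 : ∀ x, ∑ i, ∑ j, strain Ω U.u x i j * (U.σ x i j - U.σ x j i) = 0 := fun x => by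
    have : ∑ i, ∑ j, strain Ω U.u x i j * U.σ x j i =
        ∑ i, ∑ j, strain Ω U.u x i j * U.σ x i j := by
      rw [Finset.sum_comm]
      refine Finset.sum_congr rfl fun i _ => Finset.sum_congr rfl fun j _ => ?_
      simp only [strain, add_comm]
    simp only [mul_sub, Finset.sum_sub_distrib, this, sub_self]
  have h2 : ∀ x, ∑ i, ∑ j, U.σ x i j * (U.σ x i j - U.σ x j i) =
      (1 / 2 : ℝ) * ∑ i, ∑ j, (U.σ x i j - U.σ x j i) ^ 2 := fun x => by
    have : ∑ i, ∑ j, U.σ x j i * (U.σ x i j - U.σ x j i) =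
        -∑ i, ∑ j, U.σ x i j * (U.σ x i j - U.σ x j i) := by
      rw [Finset.sum_comm, ← Finset.sum_neg_distrib]
      refine Finset.sum_congr rfl fun i _ => ?_
      rw [← Finset.sum_neg_distrib]
      exact Finset.sum_congr rfl fun j _ => by ring
    have e : ∀ i j, (U.σ x i j - U.σ x j i) ^ 2 = U.σ x i j * (U.σ x i j - U.σ x j i) -
        U.σ x j i * (U.σ x i j - U.σ x j i) := fun i j => by ring
    simp only [e, Finset.sum_sub_distrib, this]
    ring
  have h3 : ∫ x in Ω, ∑ i, ∑ j, (U.σ x i j - U.σ x j i) ^ 2 = 0 := by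
    simp only [tensorInner, h1, h2, integral_const_mul, integral_zero, sub_zero] at h
    have : (1 / (2 * η)) * (1 / 2 : ℝ) ≠ 0 := by positivity
    rw [← mul_assoc] at h
    exact (mul_eq_zero.1 h).resolve_left this
  have hint : Integrable (fun x => ∑ i, ∑ j, (U.σ x i j - U.σ x j i) ^ 2)
      (volume.restrict Ω) := by
    simp only [pow_two]
    exact integrable_tensor hτ hτ
  rw [integral_eq_zero_iff_of_nonneg (fun x => Finset.sum_nonneg fun i _ =>
    Finset.sum_nonneg fun j _ => sq_nonneg _) hint] at h3
  filter_upwards [h3] with x hx i j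
  have h4 := (Finset.sum_eq_zero_iff_of_nonneg fun i _ =>
    Finset.sum_nonneg fun j _ => sq_nonneg _).1 hx i (Finset.mem_univ _)
  have h5 := (Finset.sum_eq_zero_iff_of_nonneg fun j _ => sq_nonneg _).1 h4 j (Finset.mem_univ _)
  exact sub_eq_zero.1 (pow_eq_zero_iff two_ne_zero |>.1 h5)

/-- The momentum equation holds almost everywhere for a regular weak solution. -/
theorem IsWeakSolution.momentum_ae (hΩ : IsBoundedLipschitzDomain Ω)
    (hU : IsWeakSolution Ω η f g U) (hη : 0 < η) (hf : ∀ i, MemL2 Ω fun x => f x i)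
    (hσ : ∀ i j, MemH1 Ω fun x => U.σ x i j) (hp : MemH1 Ω U.p) (i : Fin d) :
    (fun x => weakPartial Ω i U.p x - ∑ j, weakPartial Ω j (fun y => U.σ y i j) x)
      =ᵐ[volume.restrict Ω] fun x => f x i := by
  set r : E d → ℝ := fun x =>
    weakPartial Ω i U.p x - ∑ j, weakPartial Ω j (fun y => U.σ y i j) x
  have hr : MemL2 Ω r := (hp.memL2_weakPartial i).sub
    (memLp_finsetSum Finset.univ fun j _ => (hσ i j).memL2_weakPartial j)
  have h0 : (fun x => r x - f x i) =ᵐ[volume.restrict Ω] 0 := by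
    refine MemL2.ae_eq_zero hΩ.isOpen (hr.sub (hf i)) fun φ hφ hc hs => ?_
    have hφ2 : MemL2 Ω φ := memL2_of_hasCompactSupport hφ.continuous hc
    have hbd : φ =ᵐ[surfaceMeasure Ω] 0 := by
      filter_upwards [ae_surfaceMeasure_mem_frontier] with x hx
      refine image_eq_zero_of_notMem_tsupport fun h => ?_
      exact (hΩ.isOpen.frontier_eq ▸ hx).2 (hs h)
    -- The test field φ e_i has zero trace, so it is admissible in the momentum equation, and the
    -- boundary terms of `momentum_eq_sum` vanish with t = 0.
    let v : E d → E d := fun x => WithLp.toLp 2 fun k => if k = i then φ x else 0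
    have hv : ∀ k, IsTrace Ω (fun x => v x k) fun x => (0 : E d → E d) x k := fun k => by
      by_cases hk : k = i
      · have h := isTrace_of_contDiff hΩ hφ hbd
        simpa [v, hk] using (show IsTrace Ω (fun x => φ x) fun _ => 0 from h)
      · simpa [v, hk] using isTrace_of_contDiff hΩ (contDiff_const (c := (0 : ℝ))) (ae_eq_refl _)
    have h1 := momentum_eq_sum hΩ hσ (hU.stress_symm hη) hp hv
    have h2 := hU.momentum v hv
    simp only [stressFlux, pressureFlux, Pi.zero_apply, PiLp.zero_apply, mul_zero,
      Finset.sum_const_zero, integral_zero, sub_zero, add_zero] at h1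
    rw [h2] at h1
    have h3 : vectorInner Ω f v = ∫ x in Ω, f x i * φ x := by simp [vectorInner, v]
    have h4 : ∑ k, ∫ x in Ω, (weakPartial Ω k U.p x -
        ∑ j, weakPartial Ω j (fun y => U.σ y k j) x) * v x k = ∫ x in Ω, r x * φ x := by
      rw [Finset.sum_eq_single i (fun k _ hk => by simp [v, hk]) (by simp)]
      simp [v, r]
    rw [h3, h4] at h1
    simp only [sub_mul]
    rw [integral_sub (hr.integrable_mul hφ2) ((hf i).integrable_mul hφ2), h1, sub_self]
  filter_upwards [h0] with x hx
  exact sub_eq_zero.1 hx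

/-- A weak solution with flux-free boundary values is divergence free, also when tested by
constants. -/
theorem IsWeakSolution.scalarInner_divergence (hΩ : IsBoundedLipschitzDomain Ω)
    (hU : IsWeakSolution Ω η f g U)
    (hgn : ∫ x, inner ℝ (outerNormal Ω x) (g x) ∂(surfaceMeasure Ω) = 0) (hq : MemL2 Ω q) :
    scalarInner Ω q (divergence Ω U.u) = 0 := by
  have hfin := hΩ.isFiniteMeasure
  have hu := fun i => (hU.velocity_trace i).1
  have hdiv := memL2_divergence hu
  -- Green's formula against the constant 1 turns the integral of the divergence into the flux of g.
  have h0 : ∫ x in Ω, divergence Ω U.u x = 0 := by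
    have hint : ∀ i, Integrable (weakPartial Ω i fun y => U.u y i) (volume.restrict Ω) := fun i =>
      ((hu i).memL2_weakPartial i).integrable (by norm_num)
    have hi : ∀ i, ∫ x in Ω, weakPartial Ω i (fun y => U.u y i) x =
        ∫ x, g x i * outerNormal Ω x i ∂(surfaceMeasure Ω) := fun i => by
      have h1 : ContDiff ℝ ∞ fun _ : E d => (1 : ℝ) := contDiff_const
      have := (isTrace_of_contDiff hΩ h1 (ae_eq_refl _)).green hΩ (hU.velocity_trace i) i
      have h2 : ∫ x in Ω, U.u x i * weakPartial Ω i (fun _ => (1 : ℝ)) x = 0 := by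
        rw [← integral_zero (E d) ℝ (μ := volume.restrict Ω)]
        refine integral_congr_ae ?_
        filter_upwards [ContDiff.weakPartial_eq hΩ h1 (j := i)] with x hx
        simp [hx, classicalPartial]
      simpa [h2] using this
    simp only [divergence]
    rw [integral_finsetSum _ fun i _ => hint i, ← hgn]
    simp only [hi]
    have := isFiniteMeasure_surfaceMeasure hΩ
    rw [← integral_finsetSum _ fun i _ =>
      (MemLp.mul_outerNormal hΩ (hU.velocity_trace i).2.1 i).integrable (by norm_num)]
    simp only [PiLp.inner_apply, RCLike.inner_apply, conj_trivial]
  have hvol : volume.real Ω ≠ 0 := by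
    rw [Measure.real, ENNReal.toReal_ne_zero]
    exact ⟨(hΩ.isOpen.measure_pos _ hΩ.isConnected.nonempty).ne', hΩ.isBounded.measure_lt_top.ne⟩
  -- The mean of q: the difference q - c is admissible in the incompressibility equation, and c
  -- itself is handled by the vanishing flux.
  set c : ℝ := (∫ x in Ω, q x) / volume.real Ω
  have hq0 : MemL20 Ω fun x => q x - c := by
    refine ⟨hq.sub (memLp_const c), ?_⟩
    rw [integral_sub (hq.integrable (by norm_num)) (integrable_const c), integral_const,
      measureReal_restrict_apply_univ, smul_eq_mul, mul_div_cancel₀ _ hvol, sub_self]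
  have h1 := hU.incompressible _ hq0
  rw [scalarInner_comm, scalarInner_sub_left hq (memLp_const c) hdiv] at h1
  have h2 : scalarInner Ω (fun _ => c) (divergence Ω U.u) = 0 := by
    simp only [scalarInner, integral_const_mul, h0, mul_zero]
  rw [h2, sub_zero] at h1
  exact h1

/-- A regular weak solution satisfies the discrete equations without stabilization. -/
theorem IsWeakSolution.AForm_eq (hΩ : IsBoundedLipschitzDomain Ω) {P : Params} {h : ℝ}
    {V : Fields d} (hU : IsWeakSolution Ω P.η f g U) (hη : 0 < P.η)
    (hf : ∀ i, MemL2 Ω fun x => f x i)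
    (hgn : ∫ x, inner ℝ (outerNormal Ω x) (g x) ∂(surfaceMeasure Ω) = 0)
    (hU1 : U.MemH1 Ω) (hV : V.MemH1 Ω) :
    AForm Ω P h U V = LForm Ω P h f g V := by
  -- By uniqueness the chosen trace of u coincides with the prescribed boundary value almost
  -- everywhere.
  have ht : vectorTrace Ω U.u =ᵐ[surfaceMeasure Ω] g := by
    have : ∀ᵐ x ∂(surfaceMeasure Ω), ∀ i, trace Ω (fun y => U.u y i) x = g x i :=
      ae_all_iff.2 fun i => ((hU1.u i).isTrace_trace hΩ).ae_eq hΩ (hU.velocity_trace i)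
    filter_upwards [this] with x hx
    ext i
    exact hx i
  have hmom := momentum_eq_sum hΩ hU1.σ (hU.stress_symm hη) hU1.p (t := vectorTrace Ω V.u)
    fun i => (hV.u i).isTrace_trace hΩ
  have hr : ∑ i, ∫ x in Ω, (weakPartial Ω i U.p x -
      ∑ j, weakPartial Ω j (fun y => U.σ y i j) x) * V.u x i = vectorInner Ω f V.u := by
    simp only [vectorInner]
    rw [integral_finsetSum _ fun i _ => (hf i).integrable_mul (hV.u i).1]
    refine Finset.sum_congr rfl fun i _ => integral_congr_ae ?_
    filter_upwards [hU.momentum_ae hΩ hη hf hU1.σ hU1.p i] with x hx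
    rw [hx]
  have hc := hU.constitutive V.σ fun i j => (hV.σ i j).1
  rw [tensorInner_comm (σ := strain Ω U.u)] at hc
  have hd := hU.scalarInner_divergence hΩ hgn hV.p.1
  simp only [AForm, LForm, aForm, bForm, stressFlux_congr ht, pressureFlux_congr ht,
    boundaryInner_congr_left ht, hd]
  linarith

end Consistency

end ThreeFieldStokes

theorem mainTheorem9 {d : ℕ} (hd : d = 2 ∨ d = 3)
    (Ω : Set (E d)) (hΩ : IsBoundedLipschitzDomain Ω)
    (𝒯 : Mesh d) (h𝒯 : 𝒯.Covers Ω) (o : 𝒯.Orientation)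
    (P : Params) (hP : P.Pos)
    (f g : E d → E d)
    (hf : ∀ i, MemL2 Ω (fun x => f x i))
    (hg : ∀ i, MemLp (fun x => g x i) 2 (surfaceMeasure Ω))
    (hgn : ∫ x, inner ℝ (outerNormal Ω x) (g x) ∂(surfaceMeasure Ω) = 0)
    (U : Fields d) (hU : IsWeakSolution Ω P.η f g U)
    (hσ : ∀ i j, MemH1 Ω (fun x => U.σ x i j))
    (hu : ∀ i, MemH2 Ω (fun x => U.u x i))
    (hp : MemH1 Ω U.p)
    (Uh : Fields d) (hUh : IsDiscreteSolution o Ω P f g Uh) :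
    ∀ Vh : Fields d, 𝒯.MemVV Vh →
      AForm Ω P 𝒯.meshSize U Vh = LForm Ω P 𝒯.meshSize f g Vh ∧
      AForm Ω P 𝒯.meshSize (U - Uh) Vh = SForm o Ω P Uh Vh := by
  have hη := hP.η
  have hU1 : U.MemH1 Ω := ⟨hσ, fun i => (hu i).1, hp⟩
  intro Vh hVh
  -- Membership in H¹(Ω) ensures that traces and weak derivatives of discrete fields are genuine and
  -- not the default value 0.
  have hV1 := hVh.memH1 hΩ h𝒯.1
  have h1 := hU.AForm_eq hΩ (h := 𝒯.meshSize) hη hf hgn hU1 hV1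
  refine ⟨h1, ?_⟩
  rw [AForm_sub_left hΩ hU1 (hUh.1.memH1 hΩ h𝒯.1) hV1, h1, ← hUh.2 Vh hVh]
  ring
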